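/- Let $n\ge 1$, $I=\{1,\dots,4n\}$, $i'=4n+1-i$. Put $p(i)=0$ if $i\in\{2,4,\dots,2n\}\cup\{2n+1,2n+3,\dots,4n-1\}$ and $p(i)=1$ otherwise; put $\delta_i=1$ if $i\in\{1,3,\dots,2n-1\}$ and $\delta_i=0$ otherwise. Let $\mathfrak{gl}(2n|2n)$ be the complex Lie superalgebra with basis $\mathbf e_{ij}$ of parity $p(i)+p(j)$ and bracket $[\mathbf e_{ij},\mathbf e_{kl}]=\delta_{jk}\mathbf e_{il}-(-1)^{(p(i)+p(j))(p(k)+p(l))}\delta_{il}\mathbf e_{kj}$, let $a^{st}=\sum(-1)^{(p(i)+1)p(j)}a_{ij}\mathbf e_{ji}$ and $J=\sum_k(-1)^{\delta_k}\mathbf e_{kk'}$, and let $\mathfrak g=\mathfrak{osp}(2n|2n)=\{a: a^{st}J+Ja=0\}$ with the form $(a|b)=\mathrm{str}(ab)$. Put $F_{ij}=\mathbf e_{ij}+(-1)^{p(i)p(j)+p(j)+1+\delta_i+\delta_j}\mathbf e_{j'i'}\in\mathfrak g$, $E_{ij}=\tfrac12(-1)^{p(i)}F_{ij}$, and let $f=F_{2n+1,2n-1}+\sum_{i=1}^{2n-1}F_{i+1,i}$,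 an odd principal nilpotent element. Let $x=\tfrac12\mathrm{diag}(2n-1,2n-2,\dots,1,0,0,-1,\dots,-(2n-1))\in\mathfrak g$, let $\mathfrak g_j$ be the eigenspace of $\mathrm{ad}\,x$ for $j\in\frac12\mathbb Z$, and put $\mathfrak n=\bigoplus_{j>0}\mathfrak g_j$, $\mathfrak p=\bigoplus_{j\le0}\mathfrak g_j$. Let $\bar{\mathfrak g}$ be $\mathfrak g$ with reversed parity, and let $\mathcal V(\bar{\mathfrak g})=S(\mathbb C[D]\otimes\bar{\mathfrak g})$ be the SUSY affine Poisson vertex algebra of level $1$: the free supercommutative algebra with odd derivation $D$ on $\bar{\mathfrak g}$, with the $\chi$-bracket determined by $\{\bar a_\chi\bar b\}=(-1)^{p(a)p(\bar b)}\overline{[a,b]}+\chi(a|b)$, sesquilinearity $\{u_\chi Dv\}=(-1)^{p(u)+1}(D+\chi)\{u_\chi v\}$ (where $D\chi=-\chi D-2\chi^2$) and the Leibniz rule $\{u_\chi vw\}=(-1)^{(p(u)+1)p(v)}v\{u_\chi w\}+\{u_\chi v\}w$ (together with the corresponding rules in the left argument). Let $\mathcal V(\bar{\mathfrak p})$ be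 the differential subalgebra generated by $\bar{\mathfrak p}$, let $\mathfrak J$ be the differential ideal of $\mathcal V(\bar{\mathfrak g})$ generated by $\{\bar a-(f|a): a\in\mathfrak n\}$, and let $$\mathcal W(\bar{\mathfrak g},f)=\{w\in\mathcal V(\bar{\mathfrak p}) : \{\bar a_\chi w\}\in\mathbb C[\chi]\otimes\mathfrak J\ \text{ for all } a\in\mathfrak n\}.$$ In $\mathcal V(\bar{\mathfrak p})((D^{-1}))$ one multiplies by $D\,a=D(a)+(-1)^{p(a)}aD$. Let $\mathcal M$ be the $4n\times4n$ matrix $\sum_i\mathbf e_{ii}\otimes D+\sum_{i\ge j}\mathbf e_{ji}\otimes\bar E_{ij}-f\otimes1$. Subtract its $(2n+1)$-st column from its $2n$-th column; in the resulting matrix subtract the $2n$-th row from the $(2n+1)$-st row; call the result $\widetilde{\mathcal A}$. Let $\mathcal A=\mathcal A_{\mathfrak{osp}}^{(2n|2n)}$ be the $(4n+1)\times(4n+1)$ matrix obtained from $\widetilde{\mathcal A}$ by inserting a new $(2n+1)$-st row and column whose only nonzero entry is the diagonal entry $D^{-1}$. For an $N\times N$ matrix let $\mathrm{rdet}(B)=\sum_{\sigma\in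 S_N}\mathrm{sgn}(\sigma)B_{1\sigma(1)}\cdots B_{N\sigma(N)}$. Let $A_{2n}$ be the row determinant of the upper left $2n\times2n$ block of $\widetilde{\mathcal A}$, and let $\widetilde w_{2n}=a_{2n}$ be the constant term of $A_{2n}=D^{2n}+a_1D^{2n-1}+\dots+a_{2n}$. For $1\le k\le4n-1$ let $w_k$ be the coefficient of $D^{4n-1-k}$ in $\mathrm{rdet}(\mathcal A)$. Then $$\mathrm{rdet}(\mathcal A)=D^{4n-1}+\sum_{k=0}^{4n-2}w_{4n-1-k}D^k+(-1)^n a_{2n}D^{-1}a_{2n},$$ and $w_1,w_2,\dots,w_{4n-1},\widetilde w_{2n}\in\mathcal W(\bar{\mathfrak g},f)$. -/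

import Mathlib

noncomputable section

namespace SUSYW

/-! ### The Lie superalgebra `osp(2n|2n)`

The index set `I = {1, …, 4n}` is `Fin (4 * n)`; the element `i : Fin (4 * n)` stands for the
index `i + 1`, and `i.rev` for the index `i' = 4n + 1 - i`. -/

/-- The sign `(-1) ^ q` of a parity `q`. -/
def sgn (q : ZMod 2) : ℂ := if q = 0 then 1 else -1

/-- The parity of the `i`-th basis vector: the even indices (counted from `1`) are
`2, 4, …, 2n` and `2n + 1, 2n + 3, …, 4n - 1`. -/
def par {n : ℕ} (i : Fin (4 * n)) : ZMod 2 :=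
  if ((i : ℕ) + 1 ≤ 2 * n ∧ Even ((i : ℕ) + 1)) ∨ (2 * n < (i : ℕ) + 1 ∧ Odd ((i : ℕ) + 1))
  then 0 else 1

/-- `δ_i = 1` for `i = 1, 3, …, 2n - 1` (counted from `1`), and `0` otherwise. -/
def del {n : ℕ} (i : Fin (4 * n)) : ZMod 2 :=
  if (i : ℕ) + 1 ≤ 2 * n ∧ Odd ((i : ℕ) + 1) then 1 else 0

/-- The underlying space of `gl(2n|2n)`. -/
abbrev Gl (n : ℕ) : Type := Matrix (Fin (4 * n)) (Fin (4 * n)) ℂ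

/-- The matrix `J = ∑ (-1)^{δ_k} e_{k k'}`. -/
def J (n : ℕ) : Gl n := Matrix.of fun i j => if j = i.rev then sgn (del i) else 0

/-- The supertranspose `∑ (-1)^{(p(i)+1)p(j)} a_{ij} e_{ji}`. -/
def supertranspose {n : ℕ} (a : Gl n) : Gl n :=
  Matrix.of fun j i => sgn ((par i + 1) * par j) * a i j

/-- The super commutator, that is, the bilinear extension of
`[e_{ij}, e_{kl}] = δ_{jk} e_{il} - (-1)^{(p(i)+p(j))(p(k)+p(l))} δ_{il} e_{kj}`. -/
def superComm {n : ℕ} (a b : Gl n) : Gl n :=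
  Matrix.of fun i l => ∑ m, (a i m * b m l
    - sgn ((par i + par m) * (par m + par l)) * (b i m * a m l))

/-- The homogeneous component of parity `q` of a matrix. -/
def glComp {n : ℕ} (q : ZMod 2) (a : Gl n) : Gl n :=
  Matrix.of fun i j => if par i + par j = q then a i j else 0

/-- The ortho-symplectic Lie superalgebra `osp(2n|2n)`. -/
def osp (n : ℕ) : Submodule ℂ (Gl n) where
  carrier := {a | supertranspose a * J n + J n * a = 0}
  add_mem' {a b} ha hb := by
    have h : supertranspose (a + b) = supertranspose a + supertranspose b := by
      ext i j; simp [supertranspose, mul_add]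
    simp only [Set.mem_ofPred_eq] at *
    rw [h, add_mul, mul_add, add_add_add_comm, ha, hb, add_zero]
  zero_mem' := by
    have h : supertranspose (0 : Gl n) = 0 := by ext i j; simp [supertranspose]
    simp [h]
  smul_mem' c a ha := by
    have h : supertranspose (c • a) = c • supertranspose a := by
      ext i j; simp [supertranspose, mul_left_comm]
    simp only [Set.mem_ofPred_eq] at *
    rw [h, smul_mul_assoc, mul_smul_comm, ← smul_add, ha, smul_zero]

theorem sgn_add (p q : ZMod 2) : sgn (p + q) = sgn p * sgn q := by
  have : ∀ p q : ZMod 2, p = 0 ∧ q = 0 ∨ p = 0 ∧ q = 1 ∨ p = 1 ∧ q = 0 ∨ p = 1 ∧ q = 1 := by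
    decide
  rcases this p q with ⟨rfl, rfl⟩ | ⟨rfl, rfl⟩ | ⟨rfl, rfl⟩ | ⟨rfl, rfl⟩ <;>
    simp [sgn, show (1 + 1 : ZMod 2) = 0 from rfl]

theorem sgn_mul_self (p : ZMod 2) : sgn p * sgn p = 1 := by
  unfold sgn; split_ifs <;> simp

theorem par_rev {n : ℕ} (i : Fin (4 * n)) : par i.rev = par i := by
  have := i.isLt
  unfold par
  congr 1
  simp only [Fin.val_rev, Nat.even_iff, Nat.odd_iff, eq_iff_iff]
  omega

theorem del_rev {n : ℕ} (i : Fin (4 * n)) : del i.rev = del i + par i := by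
  have := i.isLt
  unfold del par
  simp only [Fin.val_rev, Nat.even_iff, Nat.odd_iff]
  split_ifs <;> first | rfl | omega

/-- The sign that relates the entries `(i, j)` and `(j', i')` of an element of `osp(2n|2n)`. -/
def tau {n : ℕ} (i j : Fin (4 * n)) : ℂ := sgn (par i * par j + par j + 1 + del i + del j)

theorem tau_mul {n : ℕ} (k m l : Fin (4 * n)) :
    tau k m * tau m l = - (sgn ((par k + par m) * (par m + par l)) * tau k l) := by
  have h1 : (-1 : ℂ) = sgn 1 := by simp [sgn]
  rw [← neg_one_mul, h1]
  simp only [tau, ← sgn_add]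
  congr 1
  generalize par k = a, par m = b, par l = c, del k = d, del m = e, del l = g
  revert a b c d e g
  decide

theorem tau_rev {n : ℕ} (i j : Fin (4 * n)) : tau j.rev i.rev * tau i j = 1 := by
  simp only [tau, ← sgn_add, par_rev, del_rev]
  have : ∀ a b c d : ZMod 2, b * a + a + 1 + (c + b) + (d + a) + (a * b + b + 1 + d + c) = 0 := by
    decide
  rw [this]; simp [sgn]

theorem mem_osp_iff {n : ℕ} (a : Gl n) :
    a ∈ osp n ↔ ∀ i j, a j.rev i.rev = tau i j * a i j := by
  have key : ∀ i j, (supertranspose a * J n + J n * a) i j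
      = sgn ((par j + 1) * par i + del j.rev) * a j.rev i + sgn (del i) * a i.rev j := by
    intro i j
    have e1 : ∀ x : Fin (4 * n), (j = x.rev) = (x = j.rev) := by
      intro x; rw [eq_iff_iff]; exact ⟨fun h => by simp [h], fun h => by simp [h]⟩
    simp [Matrix.mul_apply, J, supertranspose, e1, sgn_add, par_rev]
    ring
  have conv : ∀ i j, (supertranspose a * J n + J n * a) i.rev j
      = sgn (del i + par i) * (a i j - tau i j * a j.rev i.rev) := by
    intro i j
    rw [key, Fin.rev_rev, par_rev, del_rev, del_rev, mul_sub, ← mul_assoc, tau, ← sgn_add]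
    have : ∀ x y c d : ZMod 2, c + x + (x * y + y + 1 + c + d) = (y + 1) * x + (d + y) + 1 := by
      decide
    rw [this, sgn_add _ 1]
    simp [sgn]
    ring
  constructor
  · intro h i j
    have h0 : supertranspose a * J n + J n * a = 0 := h
    have h1 := conv i j
    have hs : sgn (del i + par i) ≠ 0 := by unfold sgn; split_ifs <;> simp
    rw [h0, Matrix.zero_apply, eq_comm, mul_eq_zero, or_iff_right hs, sub_eq_zero] at h1
    rw [h1, ← mul_assoc, tau, sgn_mul_self, one_mul]
  · intro h
    change supertranspose a * J n + J n * a = 0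
    ext i j
    have h1 := conv i.rev j
    rw [Fin.rev_rev] at h1
    have h2 := h i.rev j
    rw [Fin.rev_rev] at h2
    rw [h1, h2, ← mul_assoc, tau, sgn_mul_self, one_mul, sub_self, mul_zero, Matrix.zero_apply]

theorem superComm_mem {n : ℕ} {a b : Gl n} (ha : a ∈ osp n) (hb : b ∈ osp n) :
    superComm a b ∈ osp n := by
  rw [mem_osp_iff] at *
  intro i j
  simp only [superComm, Matrix.of_apply, Finset.mul_sum]
  rw [← Equiv.sum_comp Fin.revPerm]
  refine Finset.sum_congr rfl fun m _ => ?_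
  simp only [Fin.revPerm_apply, par_rev, ha, hb]
  have h := tau_mul i m j
  have hs := sgn_mul_self ((par i + par m) * (par m + par j))
  have e : (par j + par m) * (par m + par i) = (par i + par m) * (par m + par j) := by ring
  rw [e]
  generalize sgn ((par i + par m) * (par m + par j)) = s at *
  linear_combination (a m j * b i m - s * a i m * b m j) * h + tau i j * a i m * b m j * hs

theorem glComp_mem {n : ℕ} (q : ZMod 2) {a : Gl n} (ha : a ∈ osp n) : glComp q a ∈ osp n := by
  rw [mem_osp_iff] at *
  intro i j
  simp only [glComp, Matrix.of_apply, par_rev, ha, add_comm (par j)]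
  split_ifs <;> simp

/-- The Lie superbracket of `osp(2n|2n)`. -/
def bracket {n : ℕ} : osp n →ₗ[ℂ] osp n →ₗ[ℂ] osp n :=
  LinearMap.mk₂ ℂ (fun a b => ⟨superComm a.1 b.1, superComm_mem a.2 b.2⟩)
    (fun a a' b => by
      ext i l
      simp only [superComm, Submodule.coe_add, Matrix.add_apply, Matrix.of_apply,
        ← Finset.sum_add_distrib]
      exact Finset.sum_congr rfl fun m _ => by ring)
    (fun c a b => by
      ext i l
      simp only [superComm, Submodule.coe_smul, Matrix.smul_apply, Matrix.of_apply,
        smul_eq_mul, Finset.mul_sum]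
      exact Finset.sum_congr rfl fun m _ => by ring)
    (fun a b b' => by
      ext i l
      simp only [superComm, Submodule.coe_add, Matrix.add_apply, Matrix.of_apply,
        ← Finset.sum_add_distrib]
      exact Finset.sum_congr rfl fun m _ => by ring)
    (fun c a b => by
      ext i l
      simp only [superComm, Submodule.coe_smul, Matrix.smul_apply, Matrix.of_apply,
        smul_eq_mul, Finset.mul_sum]
      exact Finset.sum_congr rfl fun m _ => by ring)

/-- The projection of `osp(2n|2n)` onto its subspace of parity `q`. -/
def comp {n : ℕ} (q : ZMod 2) : osp n →ₗ[ℂ] osp n where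
  toFun a := ⟨glComp q a.1, glComp_mem q a.2⟩
  map_add' a b := by ext i j; simp only [glComp, Submodule.coe_add, Matrix.add_apply, Matrix.of_apply]; split_ifs <;> simp
  map_smul' c a := by ext i j; simp [glComp]

/-- The invariant form `(a|b) = str(ab)`. -/
def form {n : ℕ} : osp n →ₗ[ℂ] osp n →ₗ[ℂ] ℂ :=
  LinearMap.mk₂ ℂ (fun a b => ∑ i, sgn (par i) * (a.1 * b.1) i i)
    (fun a a' b => by simp [add_mul, mul_add, Finset.sum_add_distrib])
    (fun c a b => by simp [Finset.mul_sum, mul_left_comm])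
    (fun a b b' => by simp [mul_add, Finset.sum_add_distrib])
    (fun c a b => by simp [Finset.mul_sum, mul_left_comm])

/-- The element `F_{ij} = e_{ij} + τ(i,j) e_{j'i'}` of `osp(2n|2n)`. -/
def F {n : ℕ} (i j : Fin (4 * n)) : osp n :=
  ⟨Matrix.single i j 1 + tau i j • Matrix.single j.rev i.rev 1, by
    rw [mem_osp_iff]
    intro k l
    have q1 : (i = l.rev ∧ j = k.rev) ↔ (k = j.rev ∧ l = i.rev) := by
      constructor <;> rintro ⟨rfl, rfl⟩ <;> simp
    have q2 : (j.rev = k ∧ i.rev = l) ↔ (k = j.rev ∧ l = i.rev) := by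
      constructor <;> rintro ⟨rfl, rfl⟩ <;> simp
    have q3 : (j.rev = l.rev ∧ i.rev = k.rev) ↔ (i = k ∧ j = l) := by
      simp only [Fin.rev_inj, and_comm]
    simp only [Matrix.add_apply, Matrix.smul_apply, Matrix.single_apply, smul_eq_mul, q1, q2, q3]
    have h := tau_rev i j
    by_cases h1 : k = j.rev ∧ l = i.rev <;> by_cases h2 : i = k ∧ j = l
    · have h5 : tau k l * tau i j = 1 := by rw [h2.1, h2.2, tau, sgn_mul_self]
      have h6 : tau k l = tau i j := by rw [h2.1, h2.2]
      simp only [if_pos h1, if_pos h2]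
      linear_combination - h5 - h6
    · simp only [if_pos h1, if_neg h2]
      rw [h1.1, h1.2]
      linear_combination -h
    · simp only [if_neg h1, if_pos h2]
      rw [← h2.1, ← h2.2]
      ring
    · simp [h1, h2]⟩

/-- The odd principal nilpotent element `f = F_{2n+1, 2n-1} + ∑_{i=1}^{2n-1} F_{i+1, i}`. -/
def f (n : ℕ) (hn : 0 < n) : osp n :=
  F ⟨2 * n, by omega⟩ ⟨2 * n - 2, by omega⟩
    + ∑ i : Fin (2 * n - 1), F ⟨i + 1, by omega⟩ ⟨i, by omega⟩

/-- The element `x = diag(2n-1, 2n-2, …, 1, 0, 0, -1, …, -(2n-1)) / 2`, where `h = 2x` is the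
Cartan element of the principal `osp(1|2)` containing `f`. -/
def x (n : ℕ) : osp n :=
  ⟨Matrix.diagonal fun i => if (i : ℕ) < 2 * n then (2 * n - 1 - (i : ℂ)) / 2
      else (2 * n - (i : ℂ)) / 2, by
    rw [mem_osp_iff]
    intro i j
    by_cases hij : i = j
    · subst hij
      have h : tau i i = -1 := by
        unfold tau
        have : ∀ a d : ZMod 2, a * a + a + 1 + d + d = 1 := by decide
        rw [this]; simp [sgn]
      have hi := i.isLt
      have hc : ((i.rev : ℕ) : ℂ) = 4 * n - 1 - (i : ℕ) := by
        rw [Fin.val_rev, Nat.cast_sub (by omega)]; push_cast; ring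
      rw [Matrix.diagonal_apply_eq, Matrix.diagonal_apply_eq, h, hc]
      have : ((i.rev : ℕ) < 2 * n) ↔ ¬ ((i : ℕ) < 2 * n) := by rw [Fin.val_rev]; omega
      simp only [this]
      split_ifs <;> ring
    · rw [Matrix.diagonal_apply_ne _ hij, Matrix.diagonal_apply_ne, mul_zero]
      exact fun h => hij (Fin.rev_injective h).symm⟩

/-- The eigenspace `g_{j/2}` of `ad x`. -/
def gPiece (n : ℕ) (j : ℤ) : Submodule ℂ (osp n) :=
  Module.End.eigenspace (bracket (x n)) ((j : ℂ) / 2)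

/-- `n = ⨁_{i > 0} g_i`. -/
def nPos (n : ℕ) : Submodule ℂ (osp n) := ⨆ (j : ℤ) (_ : 0 < j), gPiece n j

/-- `p = ⨁_{i ≤ 0} g_i`. -/
def pNonpos (n : ℕ) : Submodule ℂ (osp n) := ⨆ (j : ℤ) (_ : j ≤ 0), gPiece n j


theorem comp_add_comp {n : ℕ} (a : osp n) : comp 0 a + comp 1 a = a := by
  have h : ∀ q : ZMod 2, q = 0 ∨ q = 1 := by decide
  ext i j
  simp only [comp, glComp, LinearMap.coe_mk, AddHom.coe_mk, Submodule.coe_add, Matrix.add_apply,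
    Matrix.of_apply]
  rcases h (par i + par j) with h | h <;> simp [h]

theorem comp_comp {n : ℕ} (p q : ZMod 2) (a : osp n) :
    comp p (comp q a) = if p = q then comp q a else 0 := by
  ext i j
  split_ifs with h
  · subst h
    simp only [comp, glComp, LinearMap.coe_mk, AddHom.coe_mk, Matrix.of_apply]
    split_ifs <;> rfl
  · simp only [comp, glComp, LinearMap.coe_mk, AddHom.coe_mk, Matrix.of_apply]
    split_ifs with h1 h2
    · exact absurd (h1.symm.trans h2) h
    · rfl
    · rfl

theorem comp_self {n : ℕ} {p q : ZMod 2} {a : osp n} (ha : comp p a = a) :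
    comp q a = if q = p then a else 0 := by
  conv_lhs => rw [← ha]
  rw [comp_comp, ha]

theorem entry_eq_zero {n : ℕ} {p : ZMod 2} {a : osp n} (ha : comp p a = a) {i j : Fin (4 * n)}
    (h : par i + par j ≠ p) : a.1 i j = 0 := by
  rw [← ha]
  simp [comp, glComp, h]

theorem comp_bracket {n : ℕ} {p q : ZMod 2} {a b : osp n} (ha : comp p a = a)
    (hb : comp q b = b) : comp (p + q) (bracket a b) = bracket a b := by
  have hz : ∀ u v w : ZMod 2, u + w = (u + v) + (v + w) := by decide
  ext i l
  change (if par i + par l = p + q then superComm a.1 b.1 i l else 0) = superComm a.1 b.1 i l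
  split_ifs with h
  · rfl
  · symm
    change ∑ m, (a.1 i m * b.1 m l
      - sgn ((par i + par m) * (par m + par l)) * (b.1 i m * a.1 m l)) = 0
    refine Finset.sum_eq_zero fun m _ => ?_
    have h1 : a.1 i m * b.1 m l = 0 := by
      by_cases h2 : par i + par m = p
      · rw [entry_eq_zero hb, mul_zero]
        rintro rfl; exact h (by rw [hz _ (par m), h2])
      · rw [entry_eq_zero ha h2, zero_mul]
    have h3 : b.1 i m * a.1 m l = 0 := by
      by_cases h2 : par i + par m = q
      · rw [entry_eq_zero ha, mul_zero]
        rintro rfl; exact h (by rw [hz _ (par m), h2, add_comm])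
      · rw [entry_eq_zero hb h2, zero_mul]
    rw [h1, h3, mul_zero, sub_zero]

theorem form_eq_zero {n : ℕ} {p q : ZMod 2} {a b : osp n} (ha : comp p a = a)
    (hb : comp q b = b) (hpq : p ≠ q) : form a b = 0 := by
  change ∑ i, sgn (par i) * (a.1 * b.1) i i = 0
  refine Finset.sum_eq_zero fun i _ => ?_
  rw [Matrix.mul_apply, Finset.sum_eq_zero, mul_zero]
  intro m _
  by_cases h2 : par i + par m = p
  · rw [entry_eq_zero hb, mul_zero]
    rw [add_comm, h2]; exact hpq
  · rw [entry_eq_zero ha h2, zero_mul]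

/-! ### The SUSY affine Poisson vertex algebra of level 1 -/

/-- The relations between the generators `D^m ā` (`m ∈ ℕ`, `a ∈ osp(2n|2n)`) of the supersymmetric
algebra of `ℂ[D] ⊗ ḡ`: linearity in `a` and supercommutativity, where `D^m ā` has parity
`p(a) + 1 + m`. -/
inductive Rel (n : ℕ) : FreeAlgebra ℂ (ℕ × osp n) → FreeAlgebra ℂ (ℕ × osp n) → Prop
  | add (m : ℕ) (a b : osp n) : Rel n (FreeAlgebra.ι ℂ (m, a + b))
      (FreeAlgebra.ι ℂ (m, a) + FreeAlgebra.ι ℂ (m, b))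
  | smul (m : ℕ) (c : ℂ) (a : osp n) : Rel n (FreeAlgebra.ι ℂ (m, c • a))
      (c • FreeAlgebra.ι ℂ (m, a))
  | comm (m k : ℕ) (p q : ZMod 2) (a b : osp n) (ha : comp p a = a) (hb : comp q b = b) :
      Rel n (FreeAlgebra.ι ℂ (m, a) * FreeAlgebra.ι ℂ (k, b))
        (sgn ((p + 1 + m) * (q + 1 + k)) • (FreeAlgebra.ι ℂ (k, b) * FreeAlgebra.ι ℂ (m, a)))

/-- The underlying superalgebra of the SUSY affine PVA `V(ḡ) = V^1(ḡ)`: the supersymmetric algebra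
`S(ℂ[D] ⊗ ḡ)`. -/
def V (n : ℕ) : Type := RingQuot (Rel n)

instance (n : ℕ) : Ring (V n) := inferInstanceAs (Ring (RingQuot (Rel n)))

instance (n : ℕ) : Algebra ℂ (V n) := inferInstanceAs (Algebra ℂ (RingQuot (Rel n)))

/-- The projection of the free algebra onto `V(ḡ)`. -/
def mkV (n : ℕ) : FreeAlgebra ℂ (ℕ × osp n) →ₐ[ℂ] V n := RingQuot.mkAlgHom ℂ (Rel n)

theorem mkV_rel {n : ℕ} {u v : FreeAlgebra ℂ (ℕ × osp n)} (h : Rel n u v) : mkV n u = mkV n v :=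
  RingQuot.mkAlgHom_rel ℂ h

/-- The generator `D^m ā` of `V(ḡ)`. -/
def gen {n : ℕ} (m : ℕ) : osp n →ₗ[ℂ] V n where
  toFun a := mkV n (FreeAlgebra.ι ℂ (m, a))
  map_add' a b := by rw [mkV_rel (Rel.add m a b), map_add]
  map_smul' c a := by rw [mkV_rel (Rel.smul m c a), map_smul, RingHom.id_apply]

theorem gen_comm {n : ℕ} (m k : ℕ) {p q : ZMod 2} {a b : osp n} (ha : comp p a = a)
    (hb : comp q b = b) :
    gen m a * gen k b = sgn ((p + 1 + m) * (q + 1 + k)) • (gen k b * gen m a) := by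
  have h := mkV_rel (Rel.comm m k p q a b ha hb)
  rwa [map_smul, map_mul, map_mul] at h

/-- The universal property of `V(ḡ)`. -/
def liftV {n : ℕ} {A : Type} [Ring A] [Algebra ℂ A] (φ : ℕ → osp n →ₗ[ℂ] A)
    (hφ : ∀ (m k : ℕ) (p q : ZMod 2) (a b : osp n), comp p a = a → comp q b = b →
      φ m a * φ k b = sgn ((p + 1 + m) * (q + 1 + k)) • (φ k b * φ m a)) : V n →ₐ[ℂ] A :=
  RingQuot.liftAlgHom ℂ ⟨FreeAlgebra.lift ℂ fun z => φ z.1 z.2, by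
    intro u v h
    induction h with
    | add m a b => simp
    | smul m c a => simp
    | comm m k p q a b ha hb => simpa using hφ m k p q a b ha hb⟩

theorem liftV_gen {n : ℕ} {A : Type} [Ring A] [Algebra ℂ A] (φ : ℕ → osp n →ₗ[ℂ] A) (hφ) (m : ℕ)
    (a : osp n) : liftV φ hφ (gen m a) = φ m a := by
  have h : liftV φ hφ (gen m a) = FreeAlgebra.lift ℂ (fun z : ℕ × osp n => φ z.1 z.2)
      (FreeAlgebra.ι ℂ (m, a)) := RingQuot.liftAlgHom_mkAlgHom_apply ..
  rw [h, FreeAlgebra.lift_ι_apply]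

theorem V_induction {n : ℕ} {P : V n → Prop} (h1 : ∀ c : ℂ, P (algebraMap ℂ (V n) c))
    (hgen : ∀ m p a, comp p a = a → P (gen m a)) (hmul : ∀ u v, P u → P v → P (u * v))
    (hadd : ∀ u v, P u → P v → P (u + v)) (v : V n) : P v := by
  obtain ⟨w, rfl⟩ : ∃ w, mkV n w = v := RingQuot.mkAlgHom_surjective ℂ (Rel n) v
  induction w using FreeAlgebra.induction with
  | grade0 c => rw [AlgHom.commutes]; exact h1 c
  | grade1 z =>
    have h := hadd _ _ (hgen z.1 0 (comp 0 z.2) (by simp [comp_comp]))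
      (hgen z.1 1 (comp 1 z.2) (by simp [comp_comp]))
    rw [← map_add, comp_add_comp] at h
    exact h
  | mul u v hu hv => rw [map_mul]; exact hmul _ _ hu hv
  | add u v hu hv => rw [map_add]; exact hadd _ _ hu hv

/-- The linear map `a ↦ (-1)^(p(a) + 1 + m) D^m ā`. -/
def sigGen {n : ℕ} (m : ℕ) : osp n →ₗ[ℂ] V n := sgn (1 + m) • (gen m ∘ₗ comp 0 - gen m ∘ₗ comp 1)

theorem sigGen_apply {n : ℕ} (m : ℕ) {p : ZMod 2} {a : osp n} (ha : comp p a = a) :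
    sigGen m a = sgn (p + 1 + m) • gen m a := by
  have h : ∀ p : ZMod 2, p = 0 ∨ p = 1 := by decide
  rcases h p with rfl | rfl
  · simp [sigGen, comp_self ha, zero_add]
  · have e : sgn (1 + 1 + m) = - sgn (1 + m) := by
      rw [add_assoc, sgn_add 1 (1 + (m : ZMod 2))]; simp [show sgn 1 = -1 by simp [sgn]]
    rw [e, neg_smul]
    simp [sigGen, comp_self ha]

/-- The parity automorphism of `V(ḡ)`: it multiplies `D^m ā` by `(-1)^(p(a) + 1 + m)`. -/
def sig {n : ℕ} : V n →ₐ[ℂ] V n :=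
  liftV sigGen (by
    intro m k p q a b ha hb
    rw [sigGen_apply m ha, sigGen_apply k hb, smul_mul_smul_comm, smul_mul_smul_comm,
      gen_comm m k ha hb, smul_smul, smul_smul, mul_comm (sgn (p + 1 + m)),
      mul_comm (sgn ((p + 1 + m) * (q + 1 + k)))])

theorem sig_gen {n : ℕ} (m : ℕ) {p : ZMod 2} {a : osp n} (ha : comp p a = a) :
    sig (gen m a) = sgn (p + 1 + m) • gen m a := by
  rw [sig, liftV_gen, sigGen_apply m ha]

/-- `sig` or the identity, that is, `v ↦ (-1)^{q p(v)} v`. -/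
def sigPow {n : ℕ} (q : ZMod 2) : V n →ₐ[ℂ] V n := if q = 0 then AlgHom.id ℂ (V n) else sig

theorem sigPow_gen {n : ℕ} (q : ZMod 2) (m : ℕ) {p : ZMod 2} {a : osp n} (ha : comp p a = a) :
    sigPow q (gen m a) = sgn (q * (p + 1 + m)) • gen m a := by
  have h : ∀ p : ZMod 2, p = 0 ∨ p = 1 := by decide
  rcases h q with rfl | rfl
  · simp [sigPow, sgn]
  · simp [sigPow, sig_gen m ha]

theorem gen_mul {n : ℕ} (m : ℕ) {p : ZMod 2} {a : osp n} (ha : comp p a = a) (v : V n) :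
    gen m a * v = sigPow (p + 1 + m) v * gen m a := by
  induction v using V_induction with
  | h1 c => rw [AlgHom.commutes, Algebra.commutes]
  | hgen k q b hb => rw [sigPow_gen _ _ hb, smul_mul_assoc, gen_comm m k ha hb]
  | hmul u v hu hv => rw [← mul_assoc, hu, mul_assoc, hv, map_mul, mul_assoc]
  | hadd u v hu hv => rw [mul_add, hu, hv, map_add, add_mul]

/-- Given a left action `L` of `V(ḡ)` on `M` and a right multiplication `R`, the linear map
`d : V(ḡ) → M` with `d(D^m ā) = φ_m(a)` and `d(uv) = L_u d(v) + d(u) v`. It is read off from the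
representation of `V(ḡ)` on `V(ḡ) × M` by `u ↦ ((c, w) ↦ (u c, L_u w + d(u) c))`. -/
def derHom {n : ℕ} {M : Type} [AddCommGroup M] [Module ℂ M] (L : V n →ₐ[ℂ] Module.End ℂ M)
    (R : M →ₗ[ℂ] V n →ₗ[ℂ] M) (φ : ℕ → osp n →ₗ[ℂ] M)
    (hR : ∀ w c c', R w (c * c') = R (R w c) c')
    (hLR : ∀ u w c, L u (R w c) = R (L u w) c)
    (hφ : ∀ (m k : ℕ) (p q : ZMod 2) (a b : osp n), comp p a = a → comp q b = b →
      L (gen m a) (φ k b) + R (φ m a) (gen k b) =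
        sgn ((p + 1 + m) * (q + 1 + k)) • (L (gen k b) (φ m a) + R (φ k b) (gen m a))) :
    V n →ₐ[ℂ] Module.End ℂ (V n × M) :=
  liftV (fun m =>
    { toFun := fun a =>
        ((LinearMap.mulLeft ℂ (gen m a)).comp (LinearMap.fst ℂ (V n) M)).prod
          ((L (gen m a)).comp (LinearMap.snd ℂ (V n) M)
            + (R (φ m a)).comp (LinearMap.fst ℂ (V n) M))
      map_add' := fun a b => by
        refine LinearMap.ext fun z => Prod.ext ?_ ?_
        · simp [add_mul]
        · simp; abel
      map_smul' := fun c a => by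
        refine LinearMap.ext fun z => Prod.ext ?_ ?_ <;> simp }) (by
    intro m k p q a b ha hb
    have key := gen_comm m k ha hb
    have hLL : ∀ w, L (gen m a) (L (gen k b) w)
        = sgn ((p + 1 + m) * (q + 1 + k)) • L (gen k b) (L (gen m a) w) := by
      intro w
      have h := congrArg (fun t => L t w) key
      simpa using h
    refine LinearMap.ext fun z => Prod.ext ?_ ?_
    · simp [← mul_assoc, key]
    · have h := congrArg (fun w => R w z.1) (hφ m k p q a b ha hb)
      simp only [map_add, map_smul, LinearMap.add_apply, LinearMap.smul_apply] at h
      simp [hR, hLR, hLL, add_assoc, h])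

theorem derHom_fst {n : ℕ} {M : Type} [AddCommGroup M] [Module ℂ M]
    (L : V n →ₐ[ℂ] Module.End ℂ M) (R : M →ₗ[ℂ] V n →ₗ[ℂ] M) (φ : ℕ → osp n →ₗ[ℂ] M)
    (hR hLR hφ) (u : V n) (z : V n × M) : (derHom L R φ hR hLR hφ u z).1 = u * z.1 := by
  induction u using V_induction generalizing z with
  | h1 c => rw [AlgHom.commutes, Module.algebraMap_end_apply, Prod.smul_fst, Algebra.smul_def]
  | hgen k q b hb => simp [derHom, liftV_gen]
  | hmul u v hu hv => rw [map_mul, Module.End.mul_apply, hu, hv, mul_assoc]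
  | hadd u v hu hv => rw [map_add, LinearMap.add_apply, Prod.fst_add, hu, hv, add_mul]

theorem derHom_snd {n : ℕ} {M : Type} [AddCommGroup M] [Module ℂ M]
    (L : V n →ₐ[ℂ] Module.End ℂ M) (R : M →ₗ[ℂ] V n →ₗ[ℂ] M) (φ : ℕ → osp n →ₗ[ℂ] M)
    (hR hLR hφ) (hR1 : ∀ w, R w 1 = w) (u : V n) (z : V n × M) :
    (derHom L R φ hR hLR hφ u z).2 = L u z.2 + R (derHom L R φ hR hLR hφ u (1, 0)).2 z.1 := by
  induction u using V_induction generalizing z with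
  | h1 c =>
    simp only [AlgHom.commutes, Module.algebraMap_end_apply, Prod.smul_snd, smul_zero, map_zero,
      LinearMap.zero_apply, add_zero]
  | hgen k q b hb => simp [derHom, liftV_gen, hR1]
  | hmul u v hu hv =>
    simp only [map_mul, Module.End.mul_apply]
    rw [hu (derHom L R φ hR hLR hφ v z), hv z, derHom_fst,
      hu (derHom L R φ hR hLR hφ v (1, 0)), derHom_fst]
    simp only [map_add, LinearMap.add_apply, hR, hLR, mul_one, add_assoc]
  | hadd u v hu hv =>
    simp only [map_add, LinearMap.add_apply, Prod.snd_add]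
    rw [hu, hv]; abel

/-- The odd derivation `D` of `V(ḡ)`. -/
def D {n : ℕ} : Module.End ℂ (V n) :=
  LinearMap.snd ℂ (V n) (V n) ∘ₗ
    (derHom ((Algebra.lmul ℂ (V n)).comp sig) (LinearMap.mul ℂ (V n)) (fun m => gen (m + 1))
      (fun w c c' => by simp [mul_assoc]) (fun u w c => by simp [mul_assoc])
      (fun m k p q a b ha hb => by
        have h1 := gen_comm m (k + 1) ha hb
        have h2 := gen_comm (m + 1) k ha hb
        simp only [AlgHom.comp_apply, sig_gen m ha, sig_gen k hb, map_smul, LinearMap.smul_apply,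
          Algebra.coe_lmul_eq_mul, LinearMap.mul_apply', smul_add, smul_smul, h1, h2, ← sgn_add]
        push_cast
        rw [add_comm]
        have e : ∀ x y : ZMod 2, (x + 1) * y = x * y + y ∧ x + x * (y + 1) = x * y := by decide
        rw [show p + 1 + ((m : ZMod 2) + 1) = (p + 1 + m) + 1 by ring, (e _ _).1,
          show q + 1 + ((k : ZMod 2) + 1) = (q + 1 + k) + 1 by ring, (e _ _).2])).toLinearMap.flip
      (1, 0)

theorem D_gen {n : ℕ} (m : ℕ) (a : osp n) : D (gen m a) = gen (m + 1) a := by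
  simp [D, derHom, liftV_gen]

theorem D_mul {n : ℕ} (u v : V n) : D (u * v) = D u * v + sig u * D v := by
  simp only [D, LinearMap.comp_apply, LinearMap.flip_apply, AlgHom.toLinearMap_apply,
    LinearMap.snd_apply, map_mul, Module.End.mul_apply]
  rw [derHom_snd (hR1 := fun w => by simp), derHom_fst, add_comm]
  simp

theorem D_algebraMap {n : ℕ} (c : ℂ) : D (algebraMap ℂ (V n) c) = 0 := by
  simp [D, Module.algebraMap_end_apply]

theorem sig_D {n : ℕ} (v : V n) : sig (D v) = - D (sig v) := by
  induction v using V_induction with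
  | h1 c => rw [AlgHom.commutes, D_algebraMap, map_zero, neg_zero]
  | hgen m p a ha =>
    rw [D_gen, sig_gen _ ha, sig_gen _ ha, map_smul, D_gen]
    push_cast
    rw [← add_assoc, sgn_add _ 1, show sgn 1 = -1 by simp [sgn], mul_neg_one, neg_smul]
  | hmul u v hu hv => rw [D_mul, map_add, map_mul, map_mul, hu, hv, map_mul, D_mul]; noncomm_ring
  | hadd u v hu hv => rw [map_add, map_add, hu, hv, map_add, map_add, neg_add]

/-- `ℂ[χ] ⊗ V(ḡ)`: the finitely supported function `w` stands for `∑ χ^k w_k`. -/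
abbrev ChiV (n : ℕ) : Type := ℕ →₀ V n

/-- Multiplication by `χ` on `ℂ[χ] ⊗ V(ḡ)`. -/
def chiMul {n : ℕ} : Module.End ℂ (ChiV n) :=
  Finsupp.lsum ℂ fun k => Finsupp.lsingle (k + 1)

/-- The action of `D` on `ℂ[χ] ⊗ V(ḡ)` determined by `D χ = - χ D - 2 χ^2`, that is,
`D χ^k = χ^k D` for `k` even and `D χ^k = - χ^k D - 2 χ^(k+1)` for `k` odd. -/
def chiD {n : ℕ} : Module.End ℂ (ChiV n) :=
  Finsupp.lsum ℂ fun k => if Even k then Finsupp.lsingle k ∘ₗ D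
    else - (Finsupp.lsingle k ∘ₗ D) - (2 : ℂ) • Finsupp.lsingle (k + 1)

/-- Right multiplication by elements of `V(ḡ)` on `ℂ[χ] ⊗ V(ḡ)`. -/
def chiRight {n : ℕ} : ChiV n →ₗ[ℂ] V n →ₗ[ℂ] ChiV n :=
  Finsupp.lsum ℂ fun k => LinearMap.compr₂ (LinearMap.mul ℂ (V n)) (Finsupp.lsingle k)

/-- The linear map underlying `chiLeft`. -/
def chiLeftLin {n : ℕ} (r : ZMod 2) (u : V n) : Module.End ℂ (ChiV n) :=
  Finsupp.lsum ℂ fun k => Finsupp.lsingle k ∘ₗ LinearMap.mulLeft ℂ (sigPow (r + k) u)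

theorem chiLeftLin_apply {n : ℕ} (r : ZMod 2) (u : V n) (w : ChiV n) (k : ℕ) :
    chiLeftLin r u w k = sigPow (r + k) u * w k := by
  induction w using Finsupp.induction_linear with
  | zero => simp
  | add w w' h h' => simp [h, h', mul_add]
  | single j v =>
    by_cases h : j = k
    · subst h; simp [chiLeftLin]
    · simp [chiLeftLin, h]

theorem chiRight_apply {n : ℕ} (w : ChiV n) (c : V n) (k : ℕ) : chiRight w c k = w k * c := by
  induction w using Finsupp.induction_linear with
  | zero => simp
  | add w w' h h' => simp [h, h', add_mul]
  | single j v =>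
    by_cases h : j = k
    · subst h; simp [chiRight]
    · simp [chiRight, h]

/-- The left action `u ⬝ w = (-1)^{r p(u)} u w` of `V(ḡ)` on `ℂ[χ] ⊗ V(ḡ)`, where
`u χ = (-1)^{p(u)} χ u`. -/
def chiLeft {n : ℕ} (r : ZMod 2) : V n →ₐ[ℂ] Module.End ℂ (ChiV n) :=
  AlgHom.ofLinearMap
    { toFun := chiLeftLin r
      map_add' := fun u v => by
        refine LinearMap.ext fun w => Finsupp.ext fun k => ?_
        simp [chiLeftLin_apply, add_mul]
      map_smul' := fun c u => by
        refine LinearMap.ext fun w => Finsupp.ext fun k => ?_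
        simp [chiLeftLin_apply] }
    (by
      refine LinearMap.ext fun w => Finsupp.ext fun k => ?_
      simp [chiLeftLin_apply])
    (fun u v => by
      refine LinearMap.ext fun w => Finsupp.ext fun k => ?_
      simp [chiLeftLin_apply, mul_assoc])

theorem chiLeft_apply {n : ℕ} (r : ZMod 2) (u : V n) (w : ChiV n) (k : ℕ) :
    chiLeft r u w k = sigPow (r + k) u * w k := chiLeftLin_apply r u w k

theorem chiMul_zero {n : ℕ} (w : ChiV n) : chiMul w 0 = 0 := by
  induction w using Finsupp.induction_linear with
  | zero => simp
  | add w w' h h' => simp [h, h']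
  | single j v => simp [chiMul]

theorem chiMul_succ {n : ℕ} (w : ChiV n) (k : ℕ) : chiMul w (k + 1) = w k := by
  induction w using Finsupp.induction_linear with
  | zero => simp
  | add w w' h h' => simp [h, h']
  | single j v => simp [chiMul, Finsupp.single_apply]

theorem chiD_apply {n : ℕ} (w : ChiV n) (k : ℕ) :
    chiD w k = sgn k • D (w k) - (sgn k + 1) • chiMul w k := by
  have hs : ∀ j : ℕ, sgn j = if Even j then 1 else -1 := by
    intro j
    have : ((j : ZMod 2) = 0) = Even j := by
      rw [ZMod.natCast_eq_zero_iff, even_iff_two_dvd]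
    simp [sgn, this]
  induction w using Finsupp.induction_linear with
  | zero => simp
  | add w w' h h' => simp [h, h']; abel
  | single j v =>
    have h1 : chiMul (Finsupp.single j v) = Finsupp.single (j + 1) v := by simp [chiMul]
    have h2 : j + 1 = k → (sgn k + 1) = if Even j then (0 : ℂ) else 2 := by
      rintro rfl
      rw [hs]
      by_cases hj : Even j <;> simp [hj, Nat.even_add_one]
      norm_num
    rw [h1, hs k]
    by_cases hj : Even j
    · by_cases h : j = k
      · subst h; simp [chiD, hj]
      · by_cases h' : j + 1 = k
        · rw [hs] at h2; simp [chiD, hj, h, h', h2 h']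
        · simp [chiD, hj, h, h']
    · by_cases h : j = k
      · subst h; simp [chiD, hj]
      · by_cases h' : j + 1 = k
        · rw [hs] at h2; simp [chiD, hj, h, h', h2 h']
        · simp [chiD, hj, h, h']

/-- For `a` of parity `p`, the linear maps `b ↦ {ā_χ D^m b̄}`, given by
`{ā_χ b̄} = (-1)^{p(a) p(b̄)} [a,b]‾ + χ (a|b)` and sesquilinearity
`{ā_χ D v} = (-1)^{p(ā) + 1} (D + χ) {ā_χ v}`. -/
def chiGen {n : ℕ} (p : ZMod 2) (a : osp n) : ℕ → osp n →ₗ[ℂ] ChiV n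
  | 0 => ∑ q : ZMod 2, sgn (p * (q + 1)) • (Finsupp.lsingle 0 ∘ₗ gen 0 ∘ₗ bracket a ∘ₗ comp q)
      + Finsupp.lsingle 1 ∘ₗ Algebra.linearMap ℂ (V n) ∘ₗ form a
  | m + 1 => sgn p • ((chiD + chiMul) ∘ₗ chiGen p a m)

theorem sig_chiGen {n : ℕ} {p q : ZMod 2} {a b : osp n} (ha : comp p a = a) (hb : comp q b = b)
    (m k : ℕ) : sig (chiGen p a m b k) = sgn (p + (q + 1 + m) + k) • chiGen p a m b k := by
  have hs1 : sgn 1 = -1 := by simp [sgn]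
  have hq : ∀ q : ZMod 2, q = 0 ∨ q = 1 := by decide
  induction m generalizing k with
  | zero =>
    have e0 : chiGen p a 0 b = Finsupp.single 0 (sgn (p * (q + 1)) • gen 0 (bracket a b))
        + Finsupp.single 1 (algebraMap ℂ (V n) (form a b)) := by
      simp only [chiGen, LinearMap.add_apply, LinearMap.sum_apply, LinearMap.smul_apply,
        LinearMap.comp_apply, comp_self hb]
      rw [Finset.sum_eq_single q (fun q' _ h => by simp [h]) (by simp)]
      simp
    rw [e0]
    by_cases h0 : k = 0
    · subst h0
      simp only [Finsupp.add_apply, Finsupp.single_eq_same, map_add, map_smul,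
        sig_gen 0 (comp_bracket ha hb)]
      simp [smul_smul, mul_comm, add_assoc]
    · by_cases h1 : k = 1
      · subst h1
        by_cases hpq : p = q
        · subst hpq
          have e : ∀ p : ZMod 2, p + (p + 1) + 1 = 0 := by decide
          simp [e, sgn]
        · simp [form_eq_zero ha hb hpq]
      · simp [Ne.symm h0, Ne.symm h1]
  | succ m ih =>
    simp only [chiGen, LinearMap.smul_apply, LinearMap.comp_apply, LinearMap.add_apply,
      Finsupp.smul_apply, Finsupp.add_apply, chiD_apply, map_add, map_sub, map_smul, sig_D, ih]
    have e2 : sgn (p + (q + 1 + (m + 1 : ℕ)) + k) = - sgn (p + (q + 1 + m) + k) := by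
      rw [← neg_one_mul, ← hs1, ← sgn_add]; congr 1; push_cast; ring
    cases k with
    | zero => rw [chiMul_zero, e2]; simp [smul_smul, mul_comm, mul_assoc]
    | succ k =>
      have e3 : sgn (p + (q + 1 + m) + (k + 1 : ℕ)) = - sgn (p + (q + 1 + m) + k) := by
        rw [← neg_one_mul, ← hs1, ← sgn_add]; congr 1; push_cast; ring
      simp only [chiMul_succ, ih, e2, e3, neg_smul]
      module


theorem sigPow_chiGen {n : ℕ} (r : ZMod 2) {p q : ZMod 2} {a b : osp n} (ha : comp p a = a)
    (hb : comp q b = b) (m k : ℕ) :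
    sigPow r (chiGen p a m b k) = sgn (r * (p + (q + 1 + m) + k)) • chiGen p a m b k := by
  have hq : ∀ q : ZMod 2, q = 0 ∨ q = 1 := by decide
  rcases hq r with rfl | rfl
  · simp [sigPow, sgn]
  · simp [sigPow, sig_chiGen ha hb]

/-- For `a` of parity `p`, the map `{ā_χ ·} : V(ḡ) → ℂ[χ] ⊗ V(ḡ)`, characterised by its values on
the generators and by the Leibniz rule
`{ā_χ uv} = (-1)^{(p(ā) + 1) p(u)} u {ā_χ v} + {ā_χ u} v`. -/
def chiBracketHom {n : ℕ} (p : ZMod 2) (a : osp n) (ha : comp p a = a) : V n →ₗ[ℂ] ChiV n :=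
  LinearMap.snd ℂ (V n) (ChiV n) ∘ₗ
    (derHom (chiLeft p) chiRight (chiGen p a)
      (fun w c c' => Finsupp.ext fun k => by simp [chiRight_apply, mul_assoc])
      (fun u w c => Finsupp.ext fun k => by simp [chiRight_apply, chiLeft_apply, mul_assoc])
      (fun m k s q b c hb hc => Finsupp.ext fun j => by
        have h1 : gen m b * chiGen p a k c j = _ := gen_mul m hb _
        have h2 : gen k c * chiGen p a m b j = _ := gen_mul k hc _
        simp only [Finsupp.add_apply, Finsupp.smul_apply, chiLeft_apply, chiRight_apply,
          sigPow_gen _ _ hb, sigPow_gen _ _ hc, smul_mul_assoc, h1, h2, sigPow_chiGen _ ha hc,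
          sigPow_chiGen _ ha hb, smul_smul, smul_add, ← sgn_add]
        have e : ∀ p x y j : ZMod 2, (p + j) * x + x * (p + y + j) = x * y
            ∧ x * y + ((p + j) * y + y * (p + x + j)) = 0 := by decide
        rw [(e _ _ _ _).1, (e _ _ _ _).2, add_comm]
        simp [sgn])).toLinearMap.flip (1, 0)


theorem chiBracketHom_gen {n : ℕ} (p : ZMod 2) (a : osp n) (ha : comp p a = a) (m : ℕ)
    (b : osp n) : chiBracketHom p a ha (gen m b) = chiGen p a m b := by
  refine Finsupp.ext fun k => ?_
  simp [chiBracketHom, derHom, liftV_gen, chiRight_apply]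

theorem chiBracketHom_mul {n : ℕ} (p : ZMod 2) (a : osp n) (ha : comp p a = a) (u v : V n) :
    chiBracketHom p a ha (u * v)
      = chiLeft p u (chiBracketHom p a ha v) + chiRight (chiBracketHom p a ha u) v := by
  simp only [chiBracketHom, LinearMap.comp_apply, LinearMap.flip_apply, AlgHom.toLinearMap_apply,
    LinearMap.snd_apply, map_mul, Module.End.mul_apply]
  rw [derHom_snd (hR1 := fun w => Finsupp.ext fun k => by simp [chiRight_apply]), derHom_fst]
  simp

/-- The `χ`-bracket `{ā_χ w}` of the SUSY affine PVA `V(ḡ)`, for `a ∈ osp(2n|2n)` and `w ∈ V(ḡ)`.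
(The W-algebra only involves brackets whose left entry is a generator `ā`; these are determined by
bilinearity, the Leibniz rule, sesquilinearity and the values on generators.) -/
def chiBracket {n : ℕ} (a : osp n) (w : V n) : ChiV n :=
  ∑ p : ZMod 2, chiBracketHom p (comp p a) (by simp [comp_comp]) w

/-! ### The SUSY classical W-algebra -/

/-- The differential ideal generated by the elements `ā - (f|a)` with `a ∈ n`. (An ideal of `V(ḡ)`
generated by homogeneous elements is two-sided, and the one below is stable under `D`.) -/
def idealJ (n : ℕ) (hn : 0 < n) : Ideal (V n) :=
  Ideal.span {v | ∃ (m : ℕ) (a : osp n), a ∈ nPos n ∧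
    v = (D ^ m) (gen 0 a - algebraMap ℂ (V n) (form (f n hn) a))}

/-- `V(p̄)`, the differential subalgebra of `V(ḡ)` generated by `p̄`. -/
def Vp (n : ℕ) : Subalgebra ℂ (V n) :=
  Algebra.adjoin ℂ {v | ∃ (m : ℕ) (a : osp n), a ∈ pNonpos n ∧ v = gen m a}

/-- The SUSY classical W-algebra `W(ḡ, f) = W(ḡ, f, 1)`. -/
def W (n : ℕ) (hn : 0 < n) : Set (V n) :=
  {w | w ∈ Vp n ∧ ∀ a ∈ nPos n, ∀ k : ℕ, chiBracket a w k ∈ idealJ n hn}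

/-! ### Pseudodifferential operators

An element `P = ∑ p_k D^k` of `V(ḡ)((D⁻¹))` is identified with the operator of left multiplication
by `P`, so that products of series become compositions; the coefficients are recovered from the
series `P ⬝ 1`. -/

/-- The space `V(ḡ)((D⁻¹))`: the function `z` stands for the series `∑ z_k D^k`, where `z_k = 0` for
all large `k`. -/
def Series (n : ℕ) : Submodule ℂ (ℤ → V n) where
  carrier := {z | ∃ N : ℤ, ∀ k, N < k → z k = 0}
  add_mem' := by
    rintro z z' ⟨N, hN⟩ ⟨N', hN'⟩
    refine ⟨max N N', fun k hk => ?_⟩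
    rw [Pi.add_apply, hN k (lt_of_le_of_lt (le_max_left _ _) hk),
      hN' k (lt_of_le_of_lt (le_max_right _ _) hk), add_zero]
  zero_mem' := ⟨0, fun _ _ => rfl⟩
  smul_mem' := by
    rintro c z ⟨N, hN⟩
    exact ⟨N, fun k hk => by rw [Pi.smul_apply, hN k hk, smul_zero]⟩

/-- Left multiplication by `u ∈ V(ḡ)`. -/
def mulOp {n : ℕ} (u : V n) : Module.End ℂ (Series n) where
  toFun z := ⟨fun k => u * z.1 k, by
    obtain ⟨N, hN⟩ := z.2
    exact ⟨N, fun k hk => by simp only [hN k hk, mul_zero]⟩⟩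
  map_add' z z' := by ext k; simp [mul_add]
  map_smul' c z := by ext k; simp

/-- Left multiplication by `D`: `D (a D^k) = a' D^k + (-1)^{p(a)} a D^{k+1}`. -/
def dOp {n : ℕ} : Module.End ℂ (Series n) where
  toFun z := ⟨fun k => D (z.1 k) + sig (z.1 (k - 1)), by
    obtain ⟨N, hN⟩ := z.2
    exact ⟨N + 1, fun k hk => by
      simp only [hN k (by omega), hN (k - 1) (by omega), map_zero, add_zero]⟩⟩
  map_add' z z' := by ext k; simp; abel
  map_smul' c z := by ext k; simp

/-- The coefficient of `D^k` in `D⁻¹ z`, where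
`D⁻¹ (a D^k) = ∑_{m ≥ 0} (-1)^m ((-1)^{p(a)} a^{(2m)} D^{k-1-2m} + a^{(2m+1)} D^{k-2-2m})`. -/
def dInvCoeff {n : ℕ} (z : ℤ → V n) (k : ℤ) : V n :=
  ∑ᶠ m : ℕ, (-1 : ℂ) ^ m •
    (sig ((D ^ (2 * m)) (z (k + 1 + 2 * m))) + (D ^ (2 * m + 1)) (z (k + 2 + 2 * m)))

theorem dInv_support {n : ℕ} (z : Series n) (k : ℤ) :
    (Function.support fun m : ℕ => (-1 : ℂ) ^ m •
      (sig ((D ^ (2 * m)) (z.1 (k + 1 + 2 * m)))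
        + (D ^ (2 * m + 1)) (z.1 (k + 2 + 2 * m)))).Finite := by
  obtain ⟨N, hN⟩ := z.2
  refine (Set.finite_lt_nat ((N - k).toNat + 1)).subset fun m hm => ?_
  by_contra h
  have h' : (N - k).toNat + 1 ≤ m := not_lt.mp h
  refine hm ?_
  change (-1 : ℂ) ^ m • _ = 0
  rw [hN _ (by omega), hN _ (by omega)]
  simp

theorem dInvCoeff_add {n : ℕ} (z z' : Series n) (k : ℤ) :
    dInvCoeff (z.1 + z'.1) k = dInvCoeff z.1 k + dInvCoeff z'.1 k := by
  unfold dInvCoeff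
  rw [← finsum_add_distrib (dInv_support z k) (dInv_support z' k)]
  refine finsum_congr fun m => ?_
  rw [Pi.add_apply, Pi.add_apply, map_add, map_add, map_add, ← smul_add]
  congr 1
  abel

theorem dInvCoeff_smul {n : ℕ} (c : ℂ) (z : Series n) (k : ℤ) :
    dInvCoeff (c • z.1) k = c • dInvCoeff z.1 k := by
  unfold dInvCoeff
  rw [smul_finsum' c (dInv_support z k)]
  refine finsum_congr fun m => ?_
  rw [Pi.smul_apply, Pi.smul_apply, map_smul, map_smul, map_smul, ← smul_add, smul_comm]

/-- Left multiplication by `D⁻¹`. -/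
def dInvOp {n : ℕ} : Module.End ℂ (Series n) where
  toFun z := ⟨dInvCoeff z.1, by
    obtain ⟨N, hN⟩ := z.2
    refine ⟨N, fun k hk => ?_⟩
    refine (finsum_congr fun m => ?_).trans finsum_zero
    rw [hN _ (by omega), hN _ (by omega)]
    simp⟩
  map_add' z z' := Subtype.ext (funext fun k => dInvCoeff_add z z' k)
  map_smul' c z := Subtype.ext (funext fun k => dInvCoeff_smul c z k)

/-- The series `1 = D^0`. -/
def oneSeries (n : ℕ) : Series n :=
  ⟨Pi.single 0 1, 0, fun _ hk => Pi.single_eq_of_ne hk.ne' _⟩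

/-- The coefficient of `D^k` in the series `P`. -/
def coeffD {n : ℕ} (P : Module.End ℂ (Series n)) (k : ℤ) : V n := (P (oneSeries n)).1 k

/-! ### The row determinant -/

/-- The row determinant `∑_σ sgn(σ) M_{1 σ(1)} M_{2 σ(2)} ⋯ M_{N σ(N)}` of a square matrix over a
not necessarily commutative ring. -/
def rowDet {R : Type} [Ring R] {N : ℕ} (M : Matrix (Fin N) (Fin N) R) : R :=
  ∑ σ : Equiv.Perm (Fin N), (Equiv.Perm.sign σ : ℤ) • (List.ofFn fun i => M i (σ i)).prod

/-- The element `Ē_{ij}` of `V(ḡ)`, where `E_{ij} = (-1)^{p(i)} F_{ij} / 2`. -/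
def Ebar {n : ℕ} (i j : Fin (4 * n)) : V n := gen 0 ((1 / 2 * sgn (par i)) • F i j)

/-- The matrix `∑ e_{ii} ⊗ D + ∑_{i ≥ j} e_{ji} ⊗ Ē_{ij} - f ⊗ 1`. -/
def matM (n : ℕ) (hn : 0 < n) : Matrix (Fin (4 * n)) (Fin (4 * n)) (Module.End ℂ (Series n)) :=
  Matrix.of fun i j => (if i = j then dOp else 0) + (if i ≤ j then mulOp (Ebar j i) else 0)
    - (f n hn).1 i j • 1

/-- The `2n`-th index, counted from `1`. -/
def idx0 (n : ℕ) (hn : 0 < n) : Fin (4 * n) := ⟨2 * n - 1, by omega⟩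

/-- The `(2n+1)`-st index, counted from `1`. -/
def idx1 (n : ℕ) (hn : 0 < n) : Fin (4 * n) := ⟨2 * n, by omega⟩

/-- The matrix obtained from `matM` by subtracting the `(2n+1)`-st column from the `2n`-th one. -/
def matN (n : ℕ) (hn : 0 < n) : Matrix (Fin (4 * n)) (Fin (4 * n)) (Module.End ℂ (Series n)) :=
  (matM n hn).updateCol (idx0 n hn) fun i => matM n hn i (idx0 n hn) - matM n hn i (idx1 n hn)

/-- The matrix obtained from `matN` by subtracting the `2n`-th row from the `(2n+1)`-st one. -/
def matTilde (n : ℕ) (hn : 0 < n) :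
    Matrix (Fin (4 * n)) (Fin (4 * n)) (Module.End ℂ (Series n)) :=
  (matN n hn).updateRow (idx1 n hn) fun j => matN n hn (idx1 n hn) j - matN n hn (idx0 n hn) j

/-- The `(4n+1) × (4n+1)` matrix `A_osp^(2n|2n)`: a new `(2n+1)`-st row and column are inserted in
`matTilde`, whose only nonzero entry is the diagonal one, `D⁻¹`. -/
def matA (n : ℕ) (hn : 0 < n) :
    Matrix (Fin (4 * n + 1)) (Fin (4 * n + 1)) (Module.End ℂ (Series n)) :=
  Matrix.of (Fin.insertNth (α := fun _ => Fin (4 * n + 1) → Module.End ℂ (Series n))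
    ⟨2 * n, by omega⟩
    (Fin.insertNth (α := fun _ => Module.End ℂ (Series n)) ⟨2 * n, by omega⟩ dInvOp fun _ => 0)
    fun i => Fin.insertNth (α := fun _ => Module.End ℂ (Series n)) ⟨2 * n, by omega⟩ 0
      fun j => matTilde n hn i j)

/-- `A_{2n}`, the row determinant of the upper left `2n × 2n` block. -/
def detA2n (n : ℕ) (hn : 0 < n) : Module.End ℂ (Series n) :=
  rowDet ((matTilde n hn).submatrix (Fin.castLE (by omega : 2 * n ≤ 4 * n))
    (Fin.castLE (by omega : 2 * n ≤ 4 * n)))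

/-- `w̃_{2n} = a_{2n}`, the constant term of `A_{2n}`. -/
def wTilde (n : ℕ) (hn : 0 < n) : V n := coeffD (detA2n n hn) 0

/-- `w_k`, the coefficient of `D^(4n-1-k)` in the row determinant of `A_osp^(2n|2n)`. -/
def w (n : ℕ) (hn : 0 < n) (k : ℕ) : V n := coeffD (rowDet (matA n hn)) (4 * n - 1 - k)

end SUSYW

end

noncomputable section

namespace SUSYW

/-! Expansion. Below the diagonal `matTilde` has scalars just under the diagonal, except that the
two middle indices give $-2D$, and zeros further down. In the row determinant of `matA` the inserted
$D^{-1}$ stands directly before the factor of the following row; absorbed there it turns $-2D$ into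
$-2$ (`rowDet_matA`). The result is a Hessenberg matrix with scalar subdiagonal. Its row determinant
solves a triangular recursion, i.e. it is a sum over increasing chains of indices
(`rowDet_hessenberg`). Sorting the chains by whether they visit the middle index gives
$A_{2n}D^{-1}B$ plus a differential operator of order at most $4n-2$, where $B$ is the determinant
of the lower right block (`lowSeq_eq_mul_add`). Division by $D$ on the right gives
$A_{2n}=QD+a_{2n}$. Division on the left gives $B=DX+(-1)^na_{2n}$: the reflection $i\mapsto i'$
carries the recursion for the constant terms of the lower right minors of the first block to the
recursion for the left remainders of the second block (`upConst_succ`). Hence the only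
nondifferential part of $A_{2n}D^{-1}B$ is $(-1)^na_{2n}D^{-1}a_{2n}$.

Invariance. Write $M=D+Q$ for `matM`. For $a\in\mathfrak n$ the bracket $\{\bar a_\chi\,\cdot\,\}$
acts on $Q$, modulo $\mathfrak J$, by a supercommutator with the matrix $a$ plus a $\chi$-term
proportional to $a$ (`chiCoeff_zero_qEnt`, `chiCoeff_one_qEnt`). This is an infinitesimal gauge
transformation. The cofactors of the first row form a vector $v$ which, after the row and column
operations, satisfies $Mv=(\mathrm{rdet},0,\dots,0)^T$ (`sum_tildeN_mul_hessVec`). Differentiating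
this system shows that the gauge variation of $v$ solves the system without its first row modulo
$\mathfrak J$. Its last entry vanishes, because the last entry of $v$ is constant and $a$ is
strictly upper triangular. Back substitution then puts the whole variation into the ideal
(`IsStable.mem_of_actOn_mem`), and the first row says that the bracket with the determinant lies in
the ideal (`IsStable.chiOp_mem`).

For $a_{2n}$ the same argument runs with the cofactors of the upper left block, extended by zero.
The entry $-2D$ below the block then leaves a multiple of $D$ on the right-hand side, so only the
coefficients of $D^k$ with $k\le0$ are controlled, which is enough for the constant term. -/

/-! ### Row determinants of Hessenberg matrices -/

/-- The permutation that maps `i` to `j` and agrees with `τ` away from `i`. -/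
def permInsert {N : ℕ} (i j : Fin (N + 1)) (τ : Equiv.Perm (Fin N)) : Equiv.Perm (Fin (N + 1)) :=
  j.cycleRange⁻¹ * Equiv.Perm.decomposeFin.symm (0, τ) * i.cycleRange

theorem permInsert_self {N : ℕ} (i j : Fin (N + 1)) (τ : Equiv.Perm (Fin N)) :
    permInsert i j τ i = j := by
  simp [permInsert, Equiv.Perm.inv_def]

theorem permInsert_succAbove {N : ℕ} (i j : Fin (N + 1)) (τ : Equiv.Perm (Fin N)) (k : Fin N) :
    permInsert i j τ (i.succAbove k) = j.succAbove (τ k) := by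
  simp [permInsert, Equiv.Perm.inv_def, Fin.cycleRange_succAbove, Fin.cycleRange_symm_succ]

theorem sign_permInsert {N : ℕ} (i j : Fin (N + 1)) (τ : Equiv.Perm (Fin N)) :
    (Equiv.Perm.sign (permInsert i j τ) : ℤ)
      = (-1) ^ (i : ℕ) * (-1) ^ (j : ℕ) * Equiv.Perm.sign τ := by
  simp [permInsert, Fin.sign_cycleRange]
  ring

theorem permInsert_bijective {N : ℕ} (j : Fin (N + 1)) :
    Function.Bijective fun z : Fin (N + 1) × Equiv.Perm (Fin N) => permInsert z.1 j z.2 := by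
  rw [Fintype.bijective_iff_injective_and_card]
  constructor
  · rintro ⟨i, τ⟩ ⟨i', τ'⟩ h
    simp only at h
    have hi : i = i' := by
      apply (permInsert i' j τ').injective
      rw [permInsert_self, ← h, permInsert_self]
    subst hi
    have hτ : τ = τ' := by
      ext k
      have := congrArg (fun σ => σ (i.succAbove k)) h
      simp only [permInsert_succAbove, Fin.succAbove_right_inj] at this
      rw [this]
    rw [hτ]
  · simp [Fintype.card_perm, Nat.factorial_succ]

/-- Permutations are sorted by the row that uses column `j`. No commutation of factors is involved,
so this holds over any ring. -/
theorem rowDet_eq_sum_insert {R : Type} [Ring R] {N : ℕ} (M : Matrix (Fin (N + 1)) (Fin (N + 1)) R)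
    (j : Fin (N + 1)) :
    rowDet M = ∑ i : Fin (N + 1), ∑ τ : Equiv.Perm (Fin N),
      ((-1) ^ (i : ℕ) * (-1) ^ (j : ℕ) * (Equiv.Perm.sign τ : ℤ) : ℤ) •
        (List.ofFn fun k => M k (permInsert i j τ k)).prod := by
  rw [rowDet, ← Function.Bijective.sum_comp (permInsert_bijective j), Fintype.sum_prod_type]
  simp only [sign_permInsert]

theorem prod_ofFn_eq_zero {R : Type} [Ring R] {N : ℕ} (g : Fin N → R) (i : Fin N) (h : g i = 0) :
    (List.ofFn g).prod = 0 :=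
  List.prod_eq_zero (by rw [← h]; exact List.mem_ofFn.2 ⟨i, rfl⟩)

/-- A factor of a product of `N + 1` terms may be absorbed into the next one. -/
theorem prod_ofFn_absorb {R : Type} [Ring R] : ∀ {N : ℕ} (g : Fin (N + 1) → R) (i : Fin N),
    (List.ofFn g).prod = (List.ofFn fun k => if k = i
      then g i.castSucc * g (i.castSucc.succAbove k) else g (i.castSucc.succAbove k)).prod
  | 0, _, i => i.elim0
  | N + 1, g, i => by
    refine Fin.cases ?_ (fun i => ?_) i
    · rw [List.ofFn_succ, List.ofFn_succ, List.ofFn_succ]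
      simp [mul_assoc, Fin.succ_ne_zero]
    · rw [List.ofFn_succ, List.prod_cons, prod_ofFn_absorb (fun k => g k.succ) i, List.ofFn_succ,
        List.prod_cons]
      congr 1
      simp [Fin.ext_iff]

/-- Scalars are central and can leave the product from any position. This is what makes a column
expansion possible for a noncommutative row determinant with scalar subdiagonal. -/
theorem prod_ofFn_smul {R : Type} [Ring R] [Algebra ℂ R] : ∀ {N : ℕ} (g : Fin (N + 1) → R)
    (i : Fin (N + 1)) (c : ℂ), g i = algebraMap ℂ R c →
    (List.ofFn g).prod = c • (List.ofFn fun k => g (i.succAbove k)).prod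
  | 0, g, i, c, h => by
    have : i = 0 := Fin.fin_one_eq_zero i
    subst this
    simp [h, Algebra.algebraMap_eq_smul_one]
  | N + 1, g, i, c, h => by
    induction i using Fin.cases with
    | zero =>
      rw [List.ofFn_succ, List.prod_cons, h, Algebra.smul_def]
      simp
    | succ i =>
      rw [List.ofFn_succ, List.prod_cons, prod_ofFn_smul (fun k => g k.succ) i c h, List.ofFn_succ,
        List.prod_cons]
      simp

/-- Expansion of a row determinant along a column with one nonzero entry. -/
theorem rowDet_of_single {R : Type} [Ring R] {N : ℕ} (M : Matrix (Fin (N + 1)) (Fin (N + 1)) R)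
    (i : Fin N) (hc : ∀ k, k ≠ i.castSucc → M k i.castSucc = 0) :
    rowDet M = rowDet (Matrix.of fun k l : Fin N => if k = i
      then M i.castSucc i.castSucc * M (i.castSucc.succAbove k) (i.castSucc.succAbove l)
      else M (i.castSucc.succAbove k) (i.castSucc.succAbove l)) := by
  rw [rowDet_eq_sum_insert M i.castSucc, Finset.sum_eq_single i.castSucc]
  · rw [rowDet]
    refine Finset.sum_congr rfl fun τ _ => ?_
    -- The entry is diagonal, so its cofactor sign is $((-1)(-1))^i=1$. It precedes the factor of
    -- the next row and is absorbed into that factor from the left.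
    rw [← mul_pow, prod_ofFn_absorb _ i]
    simp only [permInsert_self, permInsert_succAbove, Matrix.of_apply]
    norm_num
  · intro k _ hk
    refine Finset.sum_eq_zero fun τ _ => ?_
    rw [prod_ofFn_eq_zero _ k, smul_zero]
    rw [permInsert_self, hc k hk]
  · simp

/-- Expansion of a row determinant along the first column, when the second entry of that column is
a scalar and the further ones vanish. -/
theorem rowDet_succ_succ {R : Type} [Ring R] [Algebra ℂ R] {N : ℕ}
    (M : Matrix (Fin (N + 2)) (Fin (N + 2)) R) (c : ℂ) (h1 : M 1 0 = algebraMap ℂ R c)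
    (h2 : ∀ i : Fin N, M i.succ.succ 0 = 0) :
    rowDet M = M 0 0 * rowDet (Matrix.of fun i j : Fin (N + 1) => M i.succ j.succ)
      - c • rowDet (Matrix.of fun i j : Fin (N + 1) => M ((1 : Fin (N + 2)).succAbove i) j.succ) := by
  rw [rowDet_eq_sum_insert M 0, Fin.sum_univ_succ, Fin.sum_univ_succ, sub_eq_add_neg]
  congr 1
  · rw [rowDet, Finset.mul_sum]
    refine Finset.sum_congr rfl fun τ _ => ?_
    rw [List.ofFn_succ, List.prod_cons, permInsert_self, mul_smul_comm]
    have : ∀ k : Fin (N + 1), permInsert 0 0 τ k.succ = (τ k).succ := by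
      intro k; simpa using permInsert_succAbove 0 0 τ k
    simp [this]
  · rw [Finset.sum_eq_zero (s := Finset.univ) (f := fun i : Fin N => _), add_zero]
    · rw [rowDet, Finset.smul_sum, ← Finset.sum_neg_distrib]
      refine Finset.sum_congr rfl fun τ _ => ?_
      rw [prod_ofFn_smul _ (1 : Fin (N + 2)) c (by
        rw [← h1]; congr 1)]
      have e : ∀ k : Fin (N + 1),
          permInsert (Fin.succ 0) 0 τ ((1 : Fin (N + 2)).succAbove k) = (τ k).succ := by
        intro k; simpa using permInsert_succAbove (1 : Fin (N + 2)) 0 τ k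
      simp only [e]
      rw [smul_comm]
      simp
    · intro i _
      refine Finset.sum_eq_zero fun τ _ => ?_
      rw [prod_ofFn_eq_zero _ i.succ.succ, smul_zero]
      rw [permInsert_self, h2]

theorem rowDet_one {R : Type} [Ring R] (M : Matrix (Fin 1) (Fin 1) R) : rowDet M = M 0 0 := by
  simp [rowDet]

theorem rowDet_congr {R : Type} [Ring R] {N : ℕ} {M M' : Matrix (Fin N) (Fin N) R}
    (h : ∀ i j, M i j = M' i j) : rowDet M = rowDet M' := by
  congr 1; ext i j; exact h i j

/-- The solution of `L_i = ∑_{i < l ≤ N} g(i,l) L_l` with `L_N = 1`. -/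
def lowSeq {R : Type} [Ring R] (g : ℕ → ℕ → R) (N i : ℕ) : R :=
  if _h : i < N then ∑ l : Fin (N - i), g i (i + 1 + l) * lowSeq g N (i + 1 + l) else 1
termination_by N - i
decreasing_by omega

/-- The solution of `U_k = ∑_{s ≤ i < k} U_i g(i,k)` with `U_s = 1`. -/
def upSeq {R : Type} [Ring R] (g : ℕ → ℕ → R) (s k : ℕ) : R :=
  if _h : s < k then ∑ i : Fin (k - s), upSeq g s (s + i) * g (s + i) k else 1
termination_by k - s
decreasing_by omega

theorem lowSeq_self {R : Type} [Ring R] (g : ℕ → ℕ → R) (N : ℕ) : lowSeq g N N = 1 := by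
  rw [lowSeq]; simp

theorem upSeq_self {R : Type} [Ring R] (g : ℕ → ℕ → R) (s : ℕ) : upSeq g s s = 1 := by
  rw [upSeq]; simp

theorem lowSeq_eq {R : Type} [Ring R] (g : ℕ → ℕ → R) {N i : ℕ} (h : i < N) :
    lowSeq g N i = ∑ l ∈ Finset.Ico (i + 1) (N + 1), g i l * lowSeq g N l := by
  rw [lowSeq, dif_pos h, Finset.sum_Ico_eq_sum_range, Finset.sum_range]
  rw [show N + 1 - (i + 1) = N - i by omega]

theorem upSeq_eq {R : Type} [Ring R] (g : ℕ → ℕ → R) {s k : ℕ} (h : s < k) :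
    upSeq g s k = ∑ i ∈ Finset.Ico s k, upSeq g s i * g i k := by
  rw [upSeq, dif_pos h, Finset.sum_Ico_eq_sum_range, Finset.sum_range]

/-- The value of the two recursions cut at any place. -/
theorem lowSeq_eq_cut {R : Type} [Ring R] (g : ℕ → ℕ → R) {s k N : ℕ} (hs : s ≤ k) (hk : k < N) :
    lowSeq g N s = ∑ i ∈ Finset.Ico s (k + 1), ∑ l ∈ Finset.Ico (k + 1) (N + 1),
      upSeq g s i * g i l * lowSeq g N l := by
  induction k, hs using Nat.le_induction with
  | base => simp [upSeq_self, lowSeq_eq g hk]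
  -- Moving the cut past `k + 1`: the terms with `l = k + 1` sum to $U_{k+1}L_{k+1}$, and expanding
  -- $L_{k+1}$ turns them into the steps that leave from `k + 1`.
  | succ k hs ih =>
    rw [ih (by omega), Finset.sum_Ico_succ_top (by omega : s ≤ k + 1)]
    have e1 : ∀ i ∈ Finset.Ico s (k + 1), ∑ l ∈ Finset.Ico (k + 1) (N + 1),
        upSeq g s i * g i l * lowSeq g N l = upSeq g s i * g i (k + 1) * lowSeq g N (k + 1)
          + ∑ l ∈ Finset.Ico (k + 1 + 1) (N + 1), upSeq g s i * g i l * lowSeq g N l :=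
      fun i _ => Finset.sum_eq_sum_Ico_succ_bot (by omega) _
    rw [Finset.sum_congr rfl e1, Finset.sum_add_distrib, ← Finset.sum_mul,
      ← upSeq_eq g (by omega : s < k + 1), lowSeq_eq g hk, Finset.mul_sum, add_comm]
    simp only [mul_assoc]

/-- Both sides are the sum of $g(i_0,i_1)g(i_1,i_2)\cdots$ over all chains $s=i_0<i_1<\dots<N$,
organised once by the first step and once by the last. -/
theorem lowSeq_eq_upSeq {R : Type} [Ring R] (g : ℕ → ℕ → R) {s N : ℕ} (h : s ≤ N) :
    lowSeq g N s = upSeq g s N := by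
  rcases h.eq_or_lt with rfl | h
  · rw [lowSeq_self, upSeq_self]
  · obtain ⟨N, rfl⟩ : ∃ m, N = m + 1 := ⟨N - 1, by omega⟩
    rw [lowSeq_eq_cut g (by omega : s ≤ N) (by omega), upSeq_eq g h]
    refine Finset.sum_congr rfl fun i _ => ?_
    simp [lowSeq_self]

/-- Chains through `k` give the product, chains that jump over `k` give the double sum. With `k = 2
* n` only the product sees $D^{-1}$. -/
theorem lowSeq_eq_mul_add {R : Type} [Ring R] (g : ℕ → ℕ → R) {s k N : ℕ} (hs : s < k)
    (hk : k < N) :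
    lowSeq g N s = upSeq g s k * lowSeq g N k + ∑ i ∈ Finset.Ico s k,
      ∑ l ∈ Finset.Ico (k + 1) (N + 1), upSeq g s i * g i l * lowSeq g N l := by
  rw [lowSeq_eq_cut g hs.le hk, Finset.sum_Ico_succ_top hs.le, add_comm]
  congr 1
  rw [lowSeq_eq g hk, Finset.mul_sum]
  simp only [mul_assoc]

/-- The top row `t` is kept independent of the others to make the induction close: expanding along
the first column either promotes the row `h 0` to the top, or deletes it and leaves `t`, shifted by
one column, above the remaining rows. `L` is the sequence of lower right minors. -/
theorem rowDet_hessenberg_top {R : Type} [Ring R] [Algebra ℂ R] (N : ℕ) (t : ℕ → R)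
    (h : ℕ → ℕ → R) (c : ℕ → ℂ) (L : ℕ → R) (h0 : ∀ i j, j < i → i < N → h i j = 0)
    (h1 : ∀ j, j < N → h j j = algebraMap ℂ R (c j)) (hL : L (N + 1) = 1)
    (hL' : ∀ i, i < N → L (i + 1) = ∑ m ∈ Finset.Ico (i + 1) (N + 1),
      (∏ l ∈ Finset.Ico (i + 1) m, -c l) • (h i m * L (m + 1))) :
    rowDet (Matrix.of fun i j : Fin (N + 1) =>
        Fin.cases (motive := fun _ => R) (t j) (fun i => h i j) i)
      = ∑ m ∈ Finset.range (N + 1), (∏ l ∈ Finset.range m, -c l) • (t m * L (m + 1)) := by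
  induction N generalizing t h c L with
  | zero => rw [rowDet_one]; simp [hL]
  | succ N ih =>
    have hi0 : ∀ i j, j < i → i < N → h (i + 1) (j + 1) = 0 :=
      fun i j hj hi => h0 _ _ (by omega) (by omega)
    have hi1 : ∀ j, j < N → h (j + 1) (j + 1) = algebraMap ℂ R (c (j + 1)) :=
      fun j hj => h1 _ (by omega)
    have hiL : ∀ i, i < N → L (i + 1 + 1) = ∑ m ∈ Finset.Ico (i + 1) (N + 1),
        (∏ l ∈ Finset.Ico (i + 1) m, -c (l + 1)) • (h (i + 1) (m + 1) * L (m + 1 + 1)) := by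
      intro i hi
      rw [hL' (i + 1) (by omega), ← Finset.sum_Ico_add' _ (i + 1) (N + 1) 1]
      refine Finset.sum_congr rfl fun m _ => ?_
      rw [← Finset.prod_Ico_add' (fun l => -c l) (i + 1) m 1]
    rw [rowDet_succ_succ _ (c 0) (by
        rw [← h1 0 (by omega), ← Fin.succ_zero_eq_one]; rfl)
      (fun i => by simpa using h0 (i + 1) 0 (by omega) (by omega))]
    have k1 := ih (fun j => h 0 (j + 1)) (fun i j => h (i + 1) (j + 1)) (fun j => c (j + 1))
      (fun i => L (i + 1)) hi0 hi1 hL hiL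
    have k2 := ih (fun j => t (j + 1)) (fun i j => h (i + 1) (j + 1)) (fun j => c (j + 1))
      (fun i => L (i + 1)) hi0 hi1 hL hiL
    -- The cofactor of the corner entry has top row `h 0`; the hypothesis `hL'` at `0` identifies
    -- its expansion with `L 1`.
    have k1' : rowDet (Matrix.of fun i j : Fin (N + 1) => Matrix.of (fun i j : Fin (N + 1 + 1) =>
        Fin.cases (motive := fun _ => R) (t j) (fun i => h i j) i) i.succ j.succ) = L 1 := by
      rw [hL' 0 (by omega), Finset.sum_Ico_eq_sum_range]
      simp only [Nat.add_sub_cancel]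
      refine Eq.trans (rowDet_congr fun i j => ?_) (k1.trans (Finset.sum_congr rfl fun m _ => ?_))
      · refine Fin.cases ?_ (fun i => ?_) i <;> simp
      · rw [Finset.prod_Ico_eq_prod_range]
        simp [add_comm 1]
    -- Deleting row `1` and column `0` keeps `t` as top row.
    have k2' : rowDet (Matrix.of fun i j : Fin (N + 1) => Matrix.of (fun i j : Fin (N + 1 + 1) =>
        Fin.cases (motive := fun _ => R) (t j) (fun i => h i j) i)
          ((1 : Fin (N + 2)).succAbove i) j.succ) = ∑ m ∈ Finset.range (N + 1),
          (∏ l ∈ Finset.range m, -c (l + 1)) • (t (m + 1) * L (m + 1 + 1)) := by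
      refine Eq.trans (rowDet_congr fun i j => ?_) k2
      refine Fin.cases ?_ (fun i => ?_) i
      · simp
      · have : (1 : Fin (N + 2)).succAbove i.succ = i.succ.succ := by
          rw [← Fin.succ_zero_eq_one, Fin.succ_succAbove_succ, Fin.zero_succAbove]
        simp [this]
    rw [k1', k2']
    refine Eq.trans ?_ (Finset.sum_range_succ' (fun m => (∏ l ∈ Finset.range m, -c l) •
      (t m * L (m + 1))) (N + 1)).symm
    refine Eq.trans ?_ (add_comm _ _)
    rw [sub_eq_add_neg, Finset.smul_sum, ← Finset.sum_neg_distrib]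
    congr 1
    · simp
    · refine Finset.sum_congr rfl fun m _ => ?_
      rw [Finset.prod_range_succ', mul_comm, mul_smul, neg_smul]

/-- The transition coefficients of a Hessenberg matrix with subdiagonal entries `c_j`. -/
def hessG {R : Type} [Ring R] [Algebra ℂ R] (H : ℕ → ℕ → R) (c : ℕ → ℂ) (i l : ℕ) : R :=
  (∏ m ∈ Finset.Ico i (l - 1), -c m) • H i (l - 1)

/-- The shift `l - 1` in `hessG` reconciles two indices: when row `i` uses column `l - 1`, the rows
between contribute their subdiagonal scalars and the block starting at `l` remains. -/
theorem rowDet_hessenberg {R : Type} [Ring R] [Algebra ℂ R] (N : ℕ) (H : ℕ → ℕ → R) (c : ℕ → ℂ)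
    (h0 : ∀ i j, j + 1 < i → i < N → H i j = 0)
    (h1 : ∀ j, j + 1 < N → H (j + 1) j = algebraMap ℂ R (c j)) :
    rowDet (Matrix.of fun i j : Fin N => H i j) = lowSeq (hessG H c) N 0 := by
  rcases N with _ | N
  · rw [lowSeq_self]; simp [rowDet]
  · have key := rowDet_hessenberg_top N (H 0) (fun i => H (i + 1)) c (lowSeq (hessG H c) (N + 1))
      (fun i j hj hi => h0 _ _ (by omega) (by omega)) (fun j hj => h1 j (by omega))
      (lowSeq_self _ _) (fun i hi => by
        rw [lowSeq_eq _ (by omega), ← Finset.sum_Ico_add' _ (i + 1) (N + 1) 1]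
        simp [hessG])
    refine Eq.trans (rowDet_congr fun i j => ?_) (key.trans ?_)
    · refine Fin.cases ?_ (fun i => ?_) i <;> simp
    · rw [lowSeq_eq _ (by omega), Finset.sum_Ico_eq_sum_range]
      simp [hessG, add_comm 1]

/-! ### Differential operators -/

theorem sgn_zero : sgn 0 = 1 := by simp [sgn]

theorem sgn_one : sgn 1 = -1 := by simp [sgn]

theorem sig_sig {n : ℕ} (v : V n) : sig (sig v) = v := by
  induction v using V_induction with
  | h1 c => simp
  | hgen m p a ha => rw [sig_gen _ ha, map_smul, sig_gen _ ha, smul_smul, sgn_mul_self, one_smul]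
  | hmul u v hu hv => rw [map_mul, map_mul, hu, hv]
  | hadd u v hu hv => rw [map_add, map_add, hu, hv]

/-- The multiplication operators as a representation of `V(ḡ)`. -/
def mulHom (n : ℕ) : V n →ₐ[ℂ] Module.End ℂ (Series n) :=
  AlgHom.ofLinearMap
    { toFun := mulOp
      map_add' := fun u v => by ext z k; simp [mulOp, add_mul]
      map_smul' := fun c u => by ext z k; simp [mulOp] }
    (by ext z k; simp [mulOp])
    (fun u v => by ext z k; simp [mulOp, mul_assoc])

theorem mulHom_apply {n : ℕ} (u : V n) : mulHom n u = mulOp u := rfl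

theorem mulOp_apply {n : ℕ} (u : V n) (z : Series n) (k : ℤ) : (mulOp u z).1 k = u * z.1 k := rfl

theorem dOp_apply {n : ℕ} (z : Series n) (k : ℤ) :
    (dOp z).1 k = D (z.1 k) + sig (z.1 (k - 1)) := rfl

theorem dInvOp_apply {n : ℕ} (z : Series n) (k : ℤ) : (dInvOp z).1 k = dInvCoeff z.1 k := rfl

theorem mulOp_add {n : ℕ} (u v : V n) : mulOp (u + v) = mulOp u + mulOp v := map_add (mulHom n) u v

theorem mulOp_neg {n : ℕ} (u : V n) : mulOp (-u) = -mulOp u := map_neg (mulHom n) u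

theorem mulOp_mul {n : ℕ} (u v : V n) : mulOp (u * v) = mulOp u * mulOp v := map_mul (mulHom n) u v

theorem mulOp_smul {n : ℕ} (c : ℂ) (u : V n) : mulOp (c • u) = c • mulOp u :=
  map_smul (mulHom n) c u

theorem mulOp_zero {n : ℕ} : mulOp (0 : V n) = 0 := map_zero (mulHom n)

theorem mulOp_one {n : ℕ} : mulOp (1 : V n) = 1 := map_one (mulHom n)

theorem mulOp_sum {n : ℕ} {ι : Type} (s : Finset ι) (u : ι → V n) :
    mulOp (∑ i ∈ s, u i) = ∑ i ∈ s, mulOp (u i) := map_sum (mulHom n) u s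

theorem mulOp_algebraMap {n : ℕ} (c : ℂ) : mulOp (algebraMap ℂ (V n) c) = c • 1 := by
  rw [← mulHom_apply, AlgHom.commutes, Algebra.algebraMap_eq_smul_one]

theorem dOp_mul_mulOp {n : ℕ} (u : V n) :
    dOp * mulOp u = mulOp (D u) + mulOp (sig u) * dOp := by
  ext z k
  simp only [Module.End.mul_apply, LinearMap.add_apply, dOp_apply, mulOp_apply, Submodule.coe_add,
    Pi.add_apply, D_mul, map_mul, mul_add, add_assoc]

theorem mulOp_mul_dOp {n : ℕ} (u : V n) :
    mulOp u * dOp = dOp * mulOp (sig u) + mulOp (sig (D u)) := by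
  rw [dOp_mul_mulOp, sig_sig, sig_D, mulOp_neg]
  abel

/-- The coefficient of $D^k$ in $D(D^{-1}z)$ telescopes: the `m`-th summand is $t_m-t_{m+1}$ with
$t_m=(-1)^mD^{2m}(z_{k+2m})$, and $t_0=z_k$. -/
theorem dOp_mul_dInvOp {n : ℕ} : dOp * dInvOp = (1 : Module.End ℂ (Series n)) := by
  ext z k
  obtain ⟨N, hN⟩ := z.2
  have hz : ∀ j, N < j → z.1 j = 0 := hN
  -- From `M` on, all summands vanish both at `k` and at `k - 1`, so the two infinite sums can be
  -- taken over the same finite range.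
  obtain ⟨M, hM⟩ : ∃ M : ℕ, N - k + 1 < M := ⟨(N - k + 1).toNat + 1, by omega⟩
  have hfin : ∀ j : ℤ, k - 1 ≤ j → dInvCoeff z.1 j = ∑ m ∈ Finset.range M, (-1 : ℂ) ^ m •
      (sig ((D ^ (2 * m)) (z.1 (j + 1 + 2 * m))) + (D ^ (2 * m + 1)) (z.1 (j + 2 + 2 * m))) := by
    intro j hj
    refine finsum_eq_finsetSum_of_support_subset _ fun m hm => ?_
    by_contra h
    simp only [Finset.coe_range, Set.mem_Iio, not_lt] at h
    refine hm ?_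
    change (-1 : ℂ) ^ m • _ = 0
    rw [hz _ (by omega), hz _ (by omega)]
    simp
  have step : ∀ m : ℕ, D ((-1 : ℂ) ^ m • (sig ((D ^ (2 * m)) (z.1 (k + 1 + 2 * m)))
        + (D ^ (2 * m + 1)) (z.1 (k + 2 + 2 * m))))
      + sig ((-1 : ℂ) ^ m • (sig ((D ^ (2 * m)) (z.1 (k - 1 + 1 + 2 * m)))
        + (D ^ (2 * m + 1)) (z.1 (k - 1 + 2 + 2 * m))))
      = (-1 : ℂ) ^ m • (D ^ (2 * m)) (z.1 (k + 2 * m))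
        - (-1 : ℂ) ^ (m + 1) • (D ^ (2 * (m + 1))) (z.1 (k + 2 * (m + 1 : ℕ))) := by
    intro m
    have e1 : k - 1 + 1 + 2 * m = k + 2 * m := by ring
    have e2 : k - 1 + 2 + 2 * (m : ℤ) = k + 1 + 2 * m := by ring
    have e3 : k + 2 * ((m + 1 : ℕ) : ℤ) = k + 2 + 2 * m := by push_cast; ring
    rw [e1, e2, e3]
    simp only [map_smul, map_add, sig_sig, show 2 * (m + 1) = 2 * m + 1 + 1 by ring,
      pow_succ' D, Module.End.mul_apply, sig_D, smul_add, smul_neg, pow_succ (-1 : ℂ)]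
    have e4 : ∀ v : V n, D (sig v) = - sig (D v) := fun v => by rw [sig_D, neg_neg]
    simp only [e4, mul_neg_one, neg_smul, smul_neg]
    rw [sub_neg_eq_add]
    abel
  rw [Module.End.mul_apply, dOp_apply, dInvOp_apply, dInvOp_apply, hfin k (by omega),
    hfin (k - 1) le_rfl, map_sum, map_sum, ← Finset.sum_add_distrib,
    Finset.sum_congr rfl fun m _ => step m, Finset.sum_range_sub', hz (k + 2 * (M : ℤ)) (by omega)]
  simp

/-- Descent from the top degree: the coefficient of $D^{k+1}$ in $Dz$ is $D(z_{k+1})$ plus the image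
of $z_k$ under the parity automorphism. -/
theorem dOp_injective {n : ℕ} : Function.Injective (dOp : Module.End ℂ (Series n)) := by
  rw [injective_iff_map_eq_zero]
  intro z hz
  obtain ⟨N, hN⟩ := z.2
  have h : ∀ (m : ℕ) (k : ℤ), N - m < k → z.1 k = 0 := by
    intro m
    induction m with
    | zero => intro k hk; exact hN k (by simpa using hk)
    | succ m ih =>
      intro k hk
      have h1 := dOp_apply z (k + 1)
      rw [hz, ih (k + 1) (by push_cast at hk; omega), map_zero, zero_add, add_sub_cancel_right] at h1
      rw [← sig_sig (z.1 k), ← h1]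
      simp
  ext k
  exact h (N - k + 1).toNat k (by omega)

theorem dInvOp_mul_dOp {n : ℕ} : dInvOp * dOp = (1 : Module.End ℂ (Series n)) := by
  refine LinearMap.ext fun z => dOp_injective ?_
  rw [← Module.End.mul_apply, ← mul_assoc, dOp_mul_dInvOp, one_mul, Module.End.one_apply]

/-- The differential operators `∑_{k < m} u_k D^k`. -/
def degLT (n m : ℕ) : Submodule ℂ (Module.End ℂ (Series n)) :=
  Submodule.span ℂ {P | ∃ (u : V n) (k : ℕ), k < m ∧ P = mulOp u * dOp ^ k}

theorem mulOp_mul_pow_mem {n m k : ℕ} (u : V n) (h : k < m) : mulOp u * dOp ^ k ∈ degLT n m :=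
  Submodule.subset_span ⟨u, k, h, rfl⟩

theorem mulOp_mem {n m : ℕ} (u : V n) : mulOp u ∈ degLT n (m + 1) := by
  simpa using mulOp_mul_pow_mem u (Nat.succ_pos m)

theorem dOp_pow_mem {n m k : ℕ} (h : k < m) : dOp ^ k ∈ degLT n m := by
  simpa [mulOp_one] using mulOp_mul_pow_mem (1 : V n) h

theorem degLT_mono {n m l : ℕ} (h : m ≤ l) : degLT n m ≤ degLT n l :=
  Submodule.span_mono fun _ ⟨u, k, hk, e⟩ => ⟨u, k, lt_of_lt_of_le hk h, e⟩

theorem mulOp_mul_mem {n m : ℕ} (u : V n) {P : Module.End ℂ (Series n)} (h : P ∈ degLT n m) :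
    mulOp u * P ∈ degLT n m := by
  induction h using Submodule.span_induction with
  | mem P hP =>
    obtain ⟨v, k, hk, rfl⟩ := hP
    rw [← mul_assoc, ← mulOp_mul]
    exact mulOp_mul_pow_mem _ hk
  | zero => rw [mul_zero]; exact zero_mem _
  | add P Q _ _ hP hQ => rw [mul_add]; exact add_mem hP hQ
  | smul c P _ hP => rw [mul_smul_comm]; exact Submodule.smul_mem _ _ hP

theorem dOp_mul_mem {n m : ℕ} {P : Module.End ℂ (Series n)} (h : P ∈ degLT n m) :
    dOp * P ∈ degLT n (m + 1) := by
  induction h using Submodule.span_induction with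
  | mem P hP =>
    obtain ⟨v, k, hk, rfl⟩ := hP
    rw [← mul_assoc, dOp_mul_mulOp, add_mul, mul_assoc, ← pow_succ']
    exact add_mem (mulOp_mul_pow_mem _ (by omega)) (mulOp_mul_pow_mem _ (by omega))
  | zero => rw [mul_zero]; exact zero_mem _
  | add P Q _ _ hP hQ => rw [mul_add]; exact add_mem hP hQ
  | smul c P _ hP => rw [mul_smul_comm]; exact Submodule.smul_mem _ _ hP

theorem dOp_pow_mul_mem {n m : ℕ} (k : ℕ) {P : Module.End ℂ (Series n)} (h : P ∈ degLT n m) :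
    dOp ^ k * P ∈ degLT n (k + m) := by
  induction k with
  | zero => simpa using h
  | succ k ih =>
    rw [pow_succ', mul_assoc, show k + 1 + m = k + m + 1 by ring]
    exact dOp_mul_mem ih

/-- The bounds are strict: orders at most `m - 1` and `l` add up to an order below `m + l`. -/
theorem mul_mem_degLT {n m l : ℕ} {P Q : Module.End ℂ (Series n)} (hP : P ∈ degLT n m)
    (hQ : Q ∈ degLT n (l + 1)) : P * Q ∈ degLT n (m + l) := by
  induction hP using Submodule.span_induction with
  | mem P hP =>
    obtain ⟨v, k, hk, rfl⟩ := hP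
    rw [mul_assoc]
    exact mulOp_mul_mem _ (degLT_mono (by omega) (dOp_pow_mul_mem k hQ))
  | zero => rw [zero_mul]; exact zero_mem _
  | add P P' _ _ hP hP' => rw [add_mul]; exact add_mem hP hP'
  | smul c P _ hP => rw [smul_mul_assoc]; exact Submodule.smul_mem _ _ hP

theorem exists_of_mem_degLT {n m : ℕ} {P : Module.End ℂ (Series n)} (h : P ∈ degLT n m) :
    ∃ u : ℕ → V n, P = ∑ k ∈ Finset.range m, mulOp (u k) * dOp ^ k := by
  induction h using Submodule.span_induction with
  | mem P hP =>
    obtain ⟨v, k, hk, rfl⟩ := hP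
    refine ⟨Pi.single k v, ?_⟩
    rw [Finset.sum_eq_single k]
    · simp
    · intro j _ hj; simp [hj, mulOp_zero]
    · intro h; simp at h; omega
  | zero => exact ⟨0, by simp [mulOp_zero]⟩
  | add P P' _ _ hP hP' =>
    obtain ⟨u, rfl⟩ := hP
    obtain ⟨u', rfl⟩ := hP'
    exact ⟨u + u', by simp [mulOp_add, add_mul, Finset.sum_add_distrib]⟩
  | smul c P _ hP =>
    obtain ⟨u, rfl⟩ := hP
    exact ⟨c • u, by simp [mulOp_smul, Finset.smul_sum]⟩

/-- The differential operators `D^m + ∑_{k < m} u_k D^k`. -/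
def IsMonicOp {n : ℕ} (P : Module.End ℂ (Series n)) (m : ℕ) : Prop :=
  ∃ Q ∈ degLT n m, P = dOp ^ m + Q

theorem IsMonicOp.mem {n m : ℕ} {P : Module.End ℂ (Series n)} (h : IsMonicOp P m) :
    P ∈ degLT n (m + 1) := by
  obtain ⟨Q, hQ, rfl⟩ := h
  exact add_mem (dOp_pow_mem (by omega)) (degLT_mono (by omega) hQ)

theorem isMonicOp_one {n : ℕ} : IsMonicOp (1 : Module.End ℂ (Series n)) 0 :=
  ⟨0, zero_mem _, by simp⟩

theorem isMonicOp_dOp {n : ℕ} : IsMonicOp (dOp : Module.End ℂ (Series n)) 1 :=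
  ⟨0, zero_mem _, by simp⟩

theorem IsMonicOp.add {n m : ℕ} {P Q : Module.End ℂ (Series n)} (hP : IsMonicOp P m)
    (hQ : Q ∈ degLT n m) : IsMonicOp (P + Q) m := by
  obtain ⟨P', hP', rfl⟩ := hP
  exact ⟨P' + Q, add_mem hP' hQ, add_assoc _ _ _⟩

theorem IsMonicOp.mul {n m l : ℕ} {P Q : Module.End ℂ (Series n)} (hP : IsMonicOp P m)
    (hQ : IsMonicOp Q l) : IsMonicOp (P * Q) (m + l) := by
  have hQ' := hQ.mem
  obtain ⟨P', hP', rfl⟩ := hP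
  obtain ⟨Q', h, e⟩ := hQ
  refine ⟨dOp ^ m * Q' + P' * Q, add_mem (dOp_pow_mul_mem m h) (mul_mem_degLT hP' hQ'), ?_⟩
  rw [pow_add, add_mul, e, mul_add, add_assoc]

/-- Coefficients already stand to the left of the powers of $D$, so right division by $D$ just
splits off the constant term. -/
theorem IsMonicOp.exists_right {n m : ℕ} {P : Module.End ℂ (Series n)}
    (h : IsMonicOp P (m + 1)) : ∃ (Q : Module.End ℂ (Series n)) (u : V n), IsMonicOp Q m ∧
      P = Q * dOp + mulOp u := by
  obtain ⟨P', hP', rfl⟩ := h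
  obtain ⟨u, rfl⟩ := exists_of_mem_degLT hP'
  refine ⟨dOp ^ m + ∑ k ∈ Finset.range m, mulOp (u (k + 1)) * dOp ^ k, u 0, ⟨_, ?_, rfl⟩, ?_⟩
  · exact sum_mem fun k hk => mulOp_mul_pow_mem _ (Finset.mem_range.1 hk)
  · rw [Finset.sum_range_succ', add_mul, ← pow_succ, Finset.sum_mul, add_assoc]
    simp only [mul_assoc, ← pow_succ]
    simp

/-! ### Reading off coefficients by applying operators to the series 1. -/

theorem dOp_pow_one {n : ℕ} (k : ℕ) (j : ℤ) :
    ((dOp ^ k : Module.End ℂ (Series n)) (oneSeries n)).1 j = if j = k then 1 else 0 := by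
  induction k generalizing j with
  | zero =>
    simp [oneSeries, Pi.single_apply]
  | succ k ih =>
    have hD : D (1 : V n) = 0 := by simpa using D_algebraMap (n := n) 1
    rw [pow_succ', Module.End.mul_apply, dOp_apply, ih, ih]
    have e : (j - 1 = k) = (j = ((k + 1 : ℕ) : ℤ)) := by push_cast; rw [eq_iff_iff]; omega
    simp only [e]
    split_ifs <;> simp [hD]

theorem coeffD_add {n : ℕ} (P Q : Module.End ℂ (Series n)) (k : ℤ) :
    coeffD (P + Q) k = coeffD P k + coeffD Q k := rfl

theorem coeffD_smul {n : ℕ} (c : ℂ) (P : Module.End ℂ (Series n)) (k : ℤ) :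
    coeffD (c • P) k = c • coeffD P k := rfl

theorem coeffD_sum {n : ℕ} (m : ℕ) (u : ℕ → V n) (j : ℕ) :
    coeffD (∑ k ∈ Finset.range m, mulOp (u k) * dOp ^ k) j = if j < m then u j else 0 := by
  rw [coeffD, LinearMap.sum_apply, Submodule.coe_sum, Finset.sum_apply]
  simp only [Module.End.mul_apply, mulOp_apply, dOp_pow_one, Nat.cast_inj]
  simp

theorem coeffD_dOp_pow {n : ℕ} (m j : ℕ) :
    coeffD (dOp ^ m : Module.End ℂ (Series n)) j = if j = m then 1 else 0 := by
  rw [coeffD, dOp_pow_one]; simp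

/-- $D^{-1}v$ contains only negative powers of $D$, hence the nondifferential summand of the
determinant does not disturb the coefficients $w_k$. -/
theorem coeffD_mul_dInvOp_mul {n : ℕ} (u v : V n) (j : ℕ) :
    coeffD (mulOp u * dInvOp * mulOp v) j = 0 := by
  have h : dInvCoeff (mulOp v (oneSeries n)).1 j = 0 := by
    refine (finsum_congr fun m => ?_).trans finsum_zero
    have e : ∀ k : ℤ, 0 < k → (mulOp v (oneSeries n)).1 k = 0 := by
      intro k hk
      have h : (oneSeries n).1 k = 0 := Pi.single_eq_of_ne hk.ne' _
      rw [mulOp_apply, h, mul_zero]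
    rw [e _ (by omega), e _ (by omega)]
    simp
  rw [coeffD, Module.End.mul_apply, Module.End.mul_apply, mulOp_apply, dInvOp_apply, h, mul_zero]

/-! ### The entries of the matrices -/

theorem par_eq {n : ℕ} (i : Fin (4 * n)) :
    par i = if (i : ℕ) < 2 * n then ((i : ℕ) : ZMod 2) + 1 else ((i : ℕ) : ZMod 2) := by
  have h1 : ((i : ℕ) : ZMod 2) = if Even (i : ℕ) then 0 else 1 := by
    split_ifs with h
    · exact (ZMod.natCast_eq_zero_iff_even).2 h
    · exact (ZMod.natCast_eq_one_iff_odd).2 (Nat.not_even_iff_odd.1 h)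
  rw [h1]
  unfold par
  simp only [Nat.even_iff, Nat.odd_iff]
  split_ifs <;> first | rfl | omega

theorem del_eq {n : ℕ} (i : Fin (4 * n)) : del i = if (i : ℕ) < 2 * n then par i else 0 := by
  unfold del par
  simp only [Nat.even_iff, Nat.odd_iff]
  split_ifs <;> first | rfl | omega

theorem sgn_natCast (m : ℕ) : sgn (m : ZMod 2) = (-1) ^ m := by
  induction m with
  | zero => simp [sgn]
  | succ m ih => rw [Nat.cast_succ, sgn_add, ih, sgn_one, pow_succ]

theorem F_apply {n : ℕ} (a b i j : Fin (4 * n)) : (F a b).1 i j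
    = (if a = i ∧ b = j then 1 else 0) + (if b.rev = i ∧ a.rev = j then tau a b else 0) := by
  simp only [F, Matrix.add_apply, Matrix.smul_apply, Matrix.single_apply, smul_eq_mul]
  split_ifs <;> simp

theorem F_rev {n : ℕ} (i j : Fin (4 * n)) : F i.rev j.rev = tau i.rev j.rev • F j i := by
  ext k l
  have h := tau_rev j i
  simp only [Submodule.coe_smul, Matrix.smul_apply, F_apply, smul_eq_mul, Fin.rev_rev]
  split_ifs <;> first | ring1 | linear_combination -h

theorem tau_succ {n : ℕ} (i j : Fin (4 * n)) (h : (i : ℕ) = j + 1) (hi : (i : ℕ) < 2 * n) :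
    tau i j = (-1) ^ ((j : ℕ) + 1) := by
  rw [← sgn_natCast, tau, del_eq, del_eq, par_eq, par_eq, if_pos hi, if_pos hi,
    if_pos (by omega : (j : ℕ) < 2 * n), if_pos (by omega : (j : ℕ) < 2 * n), h]
  congr 1
  push_cast
  generalize ((j : ℕ) : ZMod 2) = x
  revert x
  decide

theorem tau_branch {n : ℕ} (hn : 0 < n) :
    tau (⟨2 * n, by omega⟩ : Fin (4 * n)) ⟨2 * n - 2, by omega⟩ = -1 := by
  have h0 : ((2 * n : ℕ) : ZMod 2) = 0 := (ZMod.natCast_eq_zero_iff_even).2 (by simp)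
  have h1 : ((2 * n - 2 : ℕ) : ZMod 2) = 0 :=
    (ZMod.natCast_eq_zero_iff_even).2 (by rw [Nat.even_iff]; omega)
  rw [tau, del_eq, del_eq, par_eq, par_eq]
  simp only [h0, h1, lt_irrefl, if_false]
  rw [if_pos (by omega), if_pos (by omega), ← sgn_one]
  rfl

/-- The entries of `f`. -/
theorem f_apply {n : ℕ} (hn : 0 < n) (i j : Fin (4 * n)) : (f n hn).1 i j =
    if (i : ℕ) = j + 1 then
      (if (j : ℕ) + 1 < 2 * n then 1 else if (j : ℕ) < 2 * n then 0 else (-1) ^ ((j : ℕ) + 1))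
    else if (i : ℕ) = j + 2 then
      (if (j : ℕ) + 2 = 2 * n then 1 else if (j : ℕ) + 1 = 2 * n then -1 else 0)
    else 0 := by
  have hi := i.isLt
  have hj := j.isLt
  have e : (f n hn).1 i j = (F ⟨2 * n, by omega⟩ ⟨2 * n - 2, by omega⟩ : osp n).1 i j
      + ∑ k : Fin (2 * n - 1), (F ⟨k + 1, by omega⟩ ⟨k, by omega⟩ : osp n).1 i j := by
    rw [f, Submodule.coe_add, Matrix.add_apply, Submodule.coe_sum, Matrix.sum_apply]
  rw [e, F_apply, tau_branch hn]
  simp only [F_apply, Finset.sum_add_distrib, Fin.ext_iff, Fin.val_rev]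
  have e1 : ∑ k : Fin (2 * n - 1), (if (k : ℕ) + 1 = i ∧ (k : ℕ) = j then (1 : ℂ) else 0)
      = if (i : ℕ) = j + 1 ∧ (j : ℕ) + 1 < 2 * n then 1 else 0 := by
    split_ifs with h
    · rw [Finset.sum_eq_single ⟨j, by omega⟩]
      · simp; omega
      · intro k _ hk
        rw [if_neg]
        rintro ⟨-, h2⟩
        exact hk (Fin.ext h2)
      · simp
    · refine Finset.sum_eq_zero fun k _ => ?_
      rw [if_neg]
      have := k.isLt
      omega
  have e2 : ∑ k : Fin (2 * n - 1), (if 4 * n - ((k : ℕ) + 1) = i ∧ 4 * n - ((k : ℕ) + 1 + 1) = j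
      then tau (⟨k + 1, by omega⟩ : Fin (4 * n)) ⟨k, by omega⟩ else 0)
      = if (i : ℕ) = j + 1 ∧ 2 * n ≤ (j : ℕ) then (-1) ^ ((j : ℕ) + 1) else 0 := by
    split_ifs with h
    · rw [Finset.sum_eq_single ⟨4 * n - 2 - j, by omega⟩]
      · rw [if_pos (by simp; omega), tau_succ _ _ rfl (by simp; omega)]
        simp only
        rw [← sgn_natCast, ← sgn_natCast]
        congr 1
        rw [ZMod.natCast_eq_natCast_iff']
        omega
      · intro k _ hk
        rw [if_neg]
        rintro ⟨-, h2⟩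
        refine hk (Fin.ext ?_)
        simp only
        have := k.isLt
        omega
      · simp
    · refine Finset.sum_eq_zero fun k _ => ?_
      rw [if_neg]
      have := k.isLt
      omega
  rw [e1, e2]
  by_cases c1 : (i : ℕ) = j + 1
  · by_cases c2 : (j : ℕ) + 1 < 2 * n
    · rw [if_neg (by omega), if_neg (by omega), if_pos ⟨c1, c2⟩, if_neg (by omega), if_pos c1,
        if_pos c2]; simp
    · by_cases c3 : (j : ℕ) < 2 * n
      · rw [if_neg (by omega), if_neg (by omega), if_neg (by omega), if_neg (by omega), if_pos c1,
          if_neg c2, if_pos c3]; simp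
      · rw [if_neg (by omega), if_neg (by omega), if_neg (by omega), if_pos ⟨c1, by omega⟩,
          if_pos c1, if_neg c2, if_neg c3]; simp
  · rw [if_neg (fun h => c1 h.1 : ¬ ((i : ℕ) = j + 1 ∧ (j : ℕ) + 1 < 2 * n)),
      if_neg (fun h => c1 h.1 : ¬ ((i : ℕ) = j + 1 ∧ 2 * n ≤ (j : ℕ))), if_neg c1]
    by_cases c2 : (i : ℕ) = j + 2
    · rw [if_pos c2]
      by_cases c3 : (j : ℕ) + 2 = 2 * n
      · rw [if_pos (by omega), if_neg (by omega), if_pos c3]; simp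
      · by_cases c4 : (j : ℕ) + 1 = 2 * n
        · rw [if_neg (by omega), if_pos (by omega), if_neg c3, if_pos c4]; simp
        · rw [if_neg (by omega), if_neg (by omega), if_neg c3, if_neg c4]; simp
    · rw [if_neg c2, if_neg (by omega), if_neg (by omega)]; simp

theorem f_apply_succ {n : ℕ} (hn : 0 < n) {i j : Fin (4 * n)} (h : (i : ℕ) = j + 1)
    (hj : (j : ℕ) + 1 < 2 * n) : (f n hn).1 i j = 1 := by
  rw [f_apply, if_pos h, if_pos hj]

theorem f_apply_succ' {n : ℕ} (hn : 0 < n) {i j : Fin (4 * n)} (h : (i : ℕ) = j + 1)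
    (hj : 2 * n ≤ (j : ℕ)) : (f n hn).1 i j = (-1) ^ ((j : ℕ) + 1) := by
  rw [f_apply, if_pos h, if_neg (by omega), if_neg (by omega)]

theorem f_apply_branch {n : ℕ} (hn : 0 < n) {i j : Fin (4 * n)} (h : (i : ℕ) = j + 2)
    (hj : (j : ℕ) + 2 = 2 * n) : (f n hn).1 i j = 1 := by
  rw [f_apply, if_neg (by omega), if_pos h, if_pos hj]

theorem f_apply_branch' {n : ℕ} (hn : 0 < n) {i j : Fin (4 * n)} (h : (i : ℕ) = j + 2)
    (hj : (j : ℕ) + 1 = 2 * n) : (f n hn).1 i j = -1 := by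
  rw [f_apply, if_neg (by omega), if_pos h, if_neg (by omega), if_pos hj]

theorem f_apply_eq_zero {n : ℕ} (hn : 0 < n) {i j : Fin (4 * n)}
    (h : (i : ℕ) = j + 1 → (j : ℕ) + 1 = 2 * n)
    (h' : (i : ℕ) = j + 2 → (j : ℕ) + 2 ≠ 2 * n ∧ (j : ℕ) + 1 ≠ 2 * n) :
    (f n hn).1 i j = 0 := by
  rw [f_apply]
  split_ifs <;> first | omega | rfl

theorem f_apply_of_le {n : ℕ} (hn : 0 < n) {i j : Fin (4 * n)} (h : i ≤ j) :
    (f n hn).1 i j = 0 := by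
  have h' : (i : ℕ) ≤ j := h
  exact f_apply_eq_zero hn (by omega) (by omega)

/-- The non-differential part of the entries of `matM`. -/
def qEnt (n : ℕ) (hn : 0 < n) (i j : Fin (4 * n)) : V n :=
  (if i ≤ j then Ebar j i else 0) - algebraMap ℂ (V n) ((f n hn).1 i j)

theorem qEnt_of_le {n : ℕ} (hn : 0 < n) {i j : Fin (4 * n)} (h : i ≤ j) :
    qEnt n hn i j = Ebar j i := by
  rw [qEnt, if_pos h, f_apply_of_le hn h, map_zero, sub_zero]

theorem qEnt_of_lt {n : ℕ} (hn : 0 < n) {i j : Fin (4 * n)} (h : j < i) :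
    qEnt n hn i j = -algebraMap ℂ (V n) ((f n hn).1 i j) := by
  rw [qEnt, if_neg (not_le.2 h), zero_sub]

theorem end_sub_eq {n : ℕ} {P Q R : Module.End ℂ (Series n)} (h : P = R + Q) : P - Q = R := by
  rw [h]
  exact add_sub_cancel_right R Q

theorem matM_apply {n : ℕ} (hn : 0 < n) (i j : Fin (4 * n)) :
    matM n hn i j = (if i = j then dOp else 0) + mulOp (qEnt n hn i j) := by
  refine end_sub_eq ?_
  rw [add_assoc, ← mulOp_algebraMap, ← mulOp_add, qEnt, sub_add_cancel]
  congr 1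
  split_ifs
  · rfl
  · exact mulOp_zero.symm

theorem idx0_rev {n : ℕ} (hn : 0 < n) : (idx0 n hn).rev = idx1 n hn := by
  ext; simp [idx0, idx1, Fin.val_rev]; omega

theorem idx1_rev {n : ℕ} (hn : 0 < n) : (idx1 n hn).rev = idx0 n hn := by
  rw [← idx0_rev, Fin.rev_rev]

theorem par_idx1 {n : ℕ} (hn : 0 < n) : par (idx1 n hn) = 0 := by
  rw [par_eq, if_neg (by simp [idx1])]
  exact (ZMod.natCast_eq_zero_iff_even).2 (by simp [idx1])

theorem par_idx0 {n : ℕ} (hn : 0 < n) : par (idx0 n hn) = 0 := by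
  rw [← par_rev, idx0_rev, par_idx1]

theorem del_idx1 {n : ℕ} (hn : 0 < n) : del (idx1 n hn) = 0 := by
  rw [del_eq, if_neg (by simp [idx1])]

theorem del_idx0 {n : ℕ} (hn : 0 < n) : del (idx0 n hn) = 0 := by
  rw [← idx1_rev, del_rev, del_idx1, par_idx1, add_zero]

theorem idx0_lt_idx1 {n : ℕ} (hn : 0 < n) : idx0 n hn < idx1 n hn := by
  rw [Fin.lt_def]; simp [idx0, idx1]; omega

theorem idx0_val {n : ℕ} (hn : 0 < n) : (idx0 n hn : ℕ) = 2 * n - 1 := rfl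

theorem idx1_val {n : ℕ} (hn : 0 < n) : (idx1 n hn : ℕ) = 2 * n := rfl

/-- The two middle indices are exchanged by $i\mapsto i'$, so $\mathbf e_{j'i'}=\mathbf e_{ij}$
here, and the sign `tau` is $-1$. -/
theorem Ebar_idx1_idx0 {n : ℕ} (hn : 0 < n) : Ebar (idx1 n hn) (idx0 n hn) = 0 := by
  have h : F (idx1 n hn) (idx0 n hn) = 0 := by
    ext k l
    rw [F_apply, idx0_rev, idx1_rev, tau, par_idx0, par_idx1, del_idx0, del_idx1,
      show (0 * 0 + 0 + 1 + 0 + 0 : ZMod 2) = 1 from rfl, sgn_one]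
    split_ifs <;> simp
  rw [Ebar, h, smul_zero, map_zero]

/-- The symmetry of the entries of `matM`. -/
theorem Ebar_rev {n : ℕ} (i j : Fin (4 * n)) : Ebar i.rev j.rev = tau i j • Ebar j i := by
  rw [Ebar, Ebar, F_rev, map_smul, map_smul, map_smul, smul_smul, smul_smul, par_rev]
  congr 1
  have : sgn (par i) * tau i.rev j.rev = tau i j * sgn (par j) := by
    rw [tau, tau, ← sgn_add, ← sgn_add, par_rev, par_rev, del_rev, del_rev]
    congr 1
    generalize par i = a, par j = b, del i = c, del j = d
    revert a b c d
    decide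
  linear_combination (1 / 2 : ℂ) * this

/-- With `Ebar_idx1_idx0` this removes the order zero part of the middle subdiagonal entry of
`matTilde`. -/
theorem Ebar_idx1_add {n : ℕ} (hn : 0 < n) :
    Ebar (idx1 n hn) (idx1 n hn) + Ebar (idx0 n hn) (idx0 n hn) = 0 := by
  have h := Ebar_rev (idx0 n hn) (idx0 n hn)
  have ht : tau (idx0 n hn) (idx0 n hn) = -1 := by
    rw [tau, par_idx0, del_idx0, show (0 * 0 + 0 + 1 + 0 + 0 : ZMod 2) = 1 from rfl, sgn_one]
  rw [idx0_rev, ht] at h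
  rw [h]; simp

/-- The non-differential part of the entries of `matTilde`. -/
def bEnt (n : ℕ) (hn : 0 < n) (i j : Fin (4 * n)) : V n :=
  qEnt n hn i j - (if j = idx0 n hn then qEnt n hn i (idx1 n hn) else 0)
    - (if i = idx1 n hn then qEnt n hn (idx0 n hn) j else 0)
    + (if i = idx1 n hn ∧ j = idx0 n hn then qEnt n hn (idx0 n hn) (idx1 n hn) else 0)

theorem matN_apply {n : ℕ} (hn : 0 < n) (i j : Fin (4 * n)) : matN n hn i j
    = if j = idx0 n hn then matM n hn i (idx0 n hn) - matM n hn i (idx1 n hn)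
      else matM n hn i j := by
  simp only [matN, Matrix.updateCol_apply]

theorem matTilde_apply' {n : ℕ} (hn : 0 < n) (i j : Fin (4 * n)) : matTilde n hn i j
    = if i = idx1 n hn then matN n hn (idx1 n hn) j - matN n hn (idx0 n hn) j
      else matN n hn i j := by
  simp only [matTilde, Matrix.updateRow_apply]

theorem sub_sub_sub_eq_of_add_eq {G : Type} [AddCommGroup G] {a b c d e : G}
    (h : a + d = e + b + c) : a - b - (c - d) = e := by
  rw [eq_sub_of_add_eq h]
  abel

/-- The middle entry is $M_{10}-M_{11}-M_{00}+M_{01}$ in the two middle indices; its $-2D$ comes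
from the two diagonal entries of `matM`. -/
theorem matTilde_apply {n : ℕ} (hn : 0 < n) (i j : Fin (4 * n)) : matTilde n hn i j
    = (if i = j then dOp else 0)
      + (if i = idx1 n hn ∧ j = idx0 n hn then (-2 : ℂ) • dOp else 0)
      + mulOp (bEnt n hn i j) := by
  have h01 := (idx0_lt_idx1 hn).ne
  have h10 := h01.symm
  rw [matTilde_apply', matN_apply, matN_apply, matN_apply, bEnt]
  by_cases hi : i = idx1 n hn <;> by_cases hj : j = idx0 n hn
  · subst hi hj
    simp only [if_true, and_self, h10, if_false, zero_add]
    refine sub_sub_sub_eq_of_add_eq (G := Module.End ℂ (Series n)) ?_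
    rw [matM_apply, matM_apply, matM_apply, matM_apply]
    simp only [if_true, h10, h01, if_false, zero_add]
    have e : (-2 : ℂ) • (dOp : Module.End ℂ (Series n)) + dOp + dOp = 0 := by
      rw [add_assoc, ← two_smul ℂ dOp, ← add_smul]; simp
    have e2 : ∀ x y a b c d u : Module.End ℂ (Series n), x + y + y = 0 →
        u + b + c = a + d → a + d = x + u + (y + b) + (y + c) := by
      intro x y a b c d u h1 h2
      rw [← h2, ← zero_add (u + b + c), ← h1]
      abel
    refine e2 _ _ _ _ _ _ _ e ?_
    rw [← mulOp_add, ← mulOp_add, ← mulOp_add]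
    congr 1
    abel
  · subst hi
    simp only [if_true, hj, and_false, if_false, sub_zero, add_zero]
    refine end_sub_eq ?_
    rw [matM_apply, matM_apply, if_neg (Ne.symm hj), zero_add, add_assoc, ← mulOp_add,
      sub_add_cancel]
  · subst hj
    simp only [if_true, hi, false_and, if_false, sub_zero, add_zero]
    refine end_sub_eq ?_
    rw [matM_apply, matM_apply, if_neg hi, zero_add, add_assoc, ← mulOp_add,
      sub_add_cancel]
  · simp only [hi, hj, if_false, false_and, sub_zero, add_zero]
    rw [matM_apply]

/-- The subdiagonal entries of `matTilde`, after the row that follows the inserted one has been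
multiplied by `D⁻¹`. -/
def subC (n j : ℕ) : ℂ := if j + 1 < 2 * n then -1 else if j < 2 * n then -2 else (-1) ^ j

/-- This is the purpose of the row and column operations. The element $f$ has two entries two places
below the diagonal; the row operation cancels the one in the row of `idx1`, and the column operation
cancels the one in the column of `idx0`. What remains is an almost Hessenberg matrix. -/
theorem bEnt_of_lt {n : ℕ} (hn : 0 < n) {i j : Fin (4 * n)} (h : j < i) : bEnt n hn i j =
    if (i : ℕ) = j + 1 ∧ (j : ℕ) ≠ 2 * n - 1 then algebraMap ℂ (V n) (subC n j) else 0 := by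
  have h' : (j : ℕ) < i := h
  have h01 := idx0_lt_idx1 hn
  have v0 := idx0_val hn
  have v1 := idx1_val hn
  rw [bEnt, qEnt_of_lt hn h]
  by_cases hj : j = idx0 n hn
  · have hj' : (j : ℕ) = 2 * n - 1 := by rw [hj]; exact v0
    rw [if_neg (fun e => e.2 hj' : ¬ ((i : ℕ) = j + 1 ∧ (j : ℕ) ≠ 2 * n - 1))]
    by_cases hi : i = idx1 n hn
    · have hi' : (i : ℕ) = 2 * n := by rw [hi]; exact v1
      rw [f_apply_eq_zero hn (by omega) (by omega)]
      subst hi hj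
      simp only [if_true, and_self]
      rw [qEnt_of_le hn le_rfl, qEnt_of_le hn le_rfl, qEnt_of_le hn h01.le, Ebar_idx1_idx0,
        map_zero, add_zero, neg_zero, zero_sub, ← neg_add', Ebar_idx1_add, neg_zero]
    · have hi' : (i : ℕ) ≠ 2 * n := fun h => hi (Fin.ext h)
      rw [if_pos hj, if_neg hi, if_neg (fun e => hi e.1), sub_zero, add_zero,
        qEnt_of_lt hn (by rw [Fin.lt_def]; omega)]
      -- Both entries of $f$ in this row, in the two middle columns, equal $-1$ and cancel under the
      -- column operation.
      by_cases h1 : (i : ℕ) = 2 * n + 1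
      · rw [f_apply_branch' hn (by omega) (by omega), f_apply_succ' hn (by omega) (by omega), v1]
        simp [pow_succ, pow_mul]
      · rw [f_apply_eq_zero hn (by omega) (by omega), f_apply_eq_zero hn (by omega) (by omega),
          sub_self]
  · have hj' : (j : ℕ) ≠ 2 * n - 1 := fun h => hj (Fin.ext h)
    rw [if_neg hj, if_neg (fun e => hj e.2 : ¬ (i = idx1 n hn ∧ j = idx0 n hn)), sub_zero,
      add_zero]
    by_cases hi : i = idx1 n hn
    · have hi' : (i : ℕ) = 2 * n := by rw [hi]; exact v1
      rw [if_pos hi, qEnt_of_lt hn (by rw [Fin.lt_def]; omega), if_neg (by omega)]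
      -- Both entries of $f$ in this column, in the two middle rows, equal $1$ and cancel under the
      -- row operation.
      by_cases h1 : (j : ℕ) + 2 = 2 * n
      · rw [f_apply_branch hn (by omega) (by omega), f_apply_succ hn (by omega) (by omega),
          sub_self]
      · rw [f_apply_eq_zero hn (by omega) (by omega), f_apply_eq_zero hn (by omega) (by omega),
          sub_self]
    · have hi' : (i : ℕ) ≠ 2 * n := fun h => hi (Fin.ext h)
      rw [if_neg hi, sub_zero]
      by_cases h1 : (i : ℕ) = j + 1
      · rw [if_pos (And.intro h1 hj'), subC]
        by_cases h2 : (j : ℕ) + 1 < 2 * n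
        · rw [if_pos h2, f_apply_succ hn h1 h2]; simp
        · rw [if_neg h2, if_neg (by omega), f_apply_succ' hn h1 (by omega), ← map_neg]
          congr 1; rw [pow_succ]; ring
      · rw [if_neg (fun e => h1 e.1 : ¬ ((i : ℕ) = j + 1 ∧ (j : ℕ) ≠ 2 * n - 1)),
          f_apply_eq_zero hn (by omega) (by omega), map_zero, neg_zero]

theorem comp_F {n : ℕ} (i j : Fin (4 * n)) : comp (par i + par j) (F i j) = F i j := by
  ext k l
  change (if par k + par l = par i + par j then (F i j).1 k l else 0) = (F i j).1 k l
  split_ifs with h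
  · rfl
  · rw [F_apply, if_neg, if_neg, add_zero]
    · rintro ⟨rfl, rfl⟩; exact h (by rw [par_rev, par_rev, add_comm])
    · rintro ⟨rfl, rfl⟩; exact h rfl

theorem sig_Ebar {n : ℕ} (i j : Fin (4 * n)) :
    sig (Ebar j i) = sgn (par i + par j + 1) • Ebar j i := by
  rw [Ebar, map_smul, map_smul, sig_gen 0 (comp_F j i), smul_comm, add_comm (par j)]
  simp

theorem f_par {n : ℕ} (hn : 0 < n) {i j : Fin (4 * n)} (h : (f n hn).1 i j ≠ 0) :
    par i + par j = 1 := by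
  have e : ∀ x : ZMod 2, x + 1 + 1 + (x + 1) = 1 ∧ x + 1 + x = 1 ∧ x + 1 + 1 + x = 0 := by decide
  rw [f_apply] at h
  rw [par_eq, par_eq]
  split_ifs at h with h1 h2 h3 h4 h5 h6
  · rw [if_pos (by omega), if_pos (by omega), h1]; push_cast; exact (e _).1
  · exact absurd rfl h
  · rw [if_neg (by omega), if_neg (by omega), h1]; push_cast; exact (e _).2.1
  · rw [if_neg (by omega), if_pos (by omega), h4]; push_cast
    generalize ((j : ℕ) : ZMod 2) = x
    revert x; decide
  · rw [if_neg (by omega), if_pos (by omega), h4]; push_cast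
    generalize ((j : ℕ) : ZMod 2) = x
    revert x; decide
  · exact absurd rfl h
  · exact absurd rfl h

theorem sig_qEnt {n : ℕ} (hn : 0 < n) (i j : Fin (4 * n)) :
    sig (qEnt n hn i j) = sgn (par i + par j + 1) • qEnt n hn i j := by
  rcases le_or_gt i j with h | h
  · rw [qEnt_of_le hn h, sig_Ebar]
  · rw [qEnt_of_lt hn h, map_neg, AlgHom.commutes]
    by_cases h0 : (f n hn).1 i j = 0
    · simp [h0]
    · rw [f_par hn h0, show (1 + 1 : ZMod 2) = 0 from rfl, sgn_zero, one_smul]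

theorem sig_bEnt {n : ℕ} (hn : 0 < n) (i j : Fin (4 * n)) :
    sig (bEnt n hn i j) = sgn (par i + par j + 1) • bEnt n hn i j := by
  rw [bEnt, map_add, map_sub, map_sub, smul_add, smul_sub, smul_sub, sig_qEnt]
  congr 2
  · congr 1
    split_ifs with h
    · rw [sig_qEnt, h, par_idx0, par_idx1]
    · simp
  · split_ifs with h
    · rw [sig_qEnt, h, par_idx0, par_idx1]
    · simp
  · split_ifs with h
    · rw [sig_qEnt, h.1, h.2, par_idx0, par_idx1]
    · simp

/-- The reflection exchanges the two middle indices and reverses rows and columns, so it carries the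
column operation to the row operation. The symmetry `Ebar_rev` therefore survives in `matTilde`,
between its upper left and lower right blocks. -/
theorem bEnt_rev {n : ℕ} (hn : 0 < n) {j l : Fin (4 * n)} (h : j ≤ l) (hl : (l : ℕ) < 2 * n) :
    bEnt n hn l.rev j.rev = tau j l • bEnt n hn j l := by
  have h' : (j : ℕ) ≤ l := h
  have hq : ∀ a b : Fin (4 * n), a ≤ b → qEnt n hn b.rev a.rev = tau a b • qEnt n hn a b := by
    intro a b hab
    rw [qEnt_of_le hn hab, qEnt_of_le hn (Fin.rev_le_rev.2 hab), Ebar_rev]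
  have hj1 : j ≠ idx1 n hn := by
    intro e; rw [e] at h'; have := idx1_val hn; omega
  have hj0 : j.rev ≠ idx0 n hn := by
    intro e; rw [← idx1_rev] at e; exact hj1 (Fin.rev_injective e)
  have hl1 : (l.rev = idx1 n hn) = (l = idx0 n hn) := by
    rw [eq_iff_iff, ← idx0_rev, Fin.rev_inj]
  simp only [bEnt, hl1, hj1, hj0, if_false, and_false, false_and, sub_zero, add_zero]
  rw [hq j l h, smul_sub]
  congr 1
  split_ifs with h0
  · have hj : j ≤ idx1 n hn := by rw [Fin.le_def, idx1_val]; omega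
    rw [← idx1_rev, hq j _ hj, h0, tau, tau, par_idx0, par_idx1, del_idx0, del_idx1]
  · simp

/-! ### Recursions for differential operators -/

theorem upSeq_congr {R : Type} [Ring R] {g g' : ℕ → ℕ → R} {s K : ℕ}
    (h : ∀ i k, s ≤ i → i < k → k ≤ K → g i k = g' i k) :
    ∀ k, k ≤ K → upSeq g s k = upSeq g' s k := by
  intro k
  induction k using Nat.strong_induction_on with
  | _ k ih =>
    intro hk
    by_cases hs : s < k
    · rw [upSeq_eq _ hs, upSeq_eq _ hs]
      refine Finset.sum_congr rfl fun i hi => ?_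
      rw [Finset.mem_Ico] at hi
      rw [ih i hi.2 (by omega), h i k hi.1 hi.2 hk]
    · rw [upSeq, upSeq, dif_neg hs, dif_neg hs]

theorem lowSeq_congr {R : Type} [Ring R] {g g' : ℕ → ℕ → R} {s N : ℕ}
    (h : ∀ i l, s ≤ i → i < l → l ≤ N → g i l = g' i l) :
    ∀ i, s ≤ i → lowSeq g N i = lowSeq g' N i := by
  have key : ∀ m i, s ≤ i → N ≤ i + m → lowSeq g N i = lowSeq g' N i := by
    intro m
    induction m with
    | zero =>
      intro i _ hi
      rw [lowSeq, lowSeq, dif_neg (by omega), dif_neg (by omega)]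
    | succ m ih =>
      intro i hs hi
      by_cases hN : i < N
      · rw [lowSeq_eq _ hN, lowSeq_eq _ hN]
        refine Finset.sum_congr rfl fun l hl => ?_
        rw [Finset.mem_Ico] at hl
        rw [ih l (by omega) (by omega), h i l hs (by omega) (by omega)]
      · rw [lowSeq, lowSeq, dif_neg hN, dif_neg hN]
  intro i hi
  exact key N i hi (by omega)

/-- The coefficients `g(i,l)` with `i < l` in the given range are operators of order zero, up to a
summand `D` for `l = i + 1`. -/
def IsFirstOrder {n : ℕ} (g : ℕ → ℕ → Module.End ℂ (Series n)) (β : ℕ → ℕ → V n) (s N : ℕ) : Prop :=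
  ∀ i l, s ≤ i → i < l → l ≤ N → g i l = (if l = i + 1 then dOp else 0) + mulOp (β i l)

theorem IsFirstOrder.succ {n s N : ℕ} {g : ℕ → ℕ → Module.End ℂ (Series n)} {β : ℕ → ℕ → V n}
    (h : IsFirstOrder g β s N) {i : ℕ} (hs : s ≤ i) (hN : i + 1 ≤ N) :
    IsMonicOp (g i (i + 1)) 1 := by
  rw [h i (i + 1) hs (by omega) hN, if_pos rfl]
  exact isMonicOp_dOp.add (mulOp_mem _)

theorem IsFirstOrder.of_ne {n s N : ℕ} {g : ℕ → ℕ → Module.End ℂ (Series n)} {β : ℕ → ℕ → V n}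
    (h : IsFirstOrder g β s N) {i l : ℕ} (hs : s ≤ i) (hl : i + 1 < l) (hN : l ≤ N) :
    g i l = mulOp (β i l) := by
  rw [h i l hs (by omega) hN, if_neg (by omega), zero_add]

/-- Only the step to `i + 1` contains $D$. A longer step has order zero and lands on a term of order
at most `N - i - 2`. -/
theorem IsFirstOrder.isMonicOp_lowSeq {n s N : ℕ} {g : ℕ → ℕ → Module.End ℂ (Series n)}
    {β : ℕ → ℕ → V n} (h : IsFirstOrder g β s N) :
    ∀ m i, s ≤ i → i + m = N → IsMonicOp (lowSeq g N i) m := by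
  intro m
  induction m using Nat.strong_induction_on with
  | _ m ih =>
    intro i hs hi
    rcases m with _ | m
    · rw [← hi, add_zero, lowSeq_self]
      exact isMonicOp_one
    · rw [lowSeq_eq _ (by omega), Finset.sum_eq_sum_Ico_succ_bot (by omega)]
      refine IsMonicOp.add ?_ (sum_mem fun l hl => ?_)
      · rw [add_comm m 1]
        exact (h.succ hs (by omega)).mul (ih m (by omega) (i + 1) (by omega) (by omega))
      · rw [Finset.mem_Ico] at hl
        rw [h.of_ne hs (by omega) (by omega)]
        exact mulOp_mul_mem _ (degLT_mono (by omega) (ih (N - l) (by omega) l (by omega)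
          (by omega)).mem)

theorem IsFirstOrder.isMonicOp_upSeq {n s N : ℕ} {g : ℕ → ℕ → Module.End ℂ (Series n)}
    {β : ℕ → ℕ → V n} (h : IsFirstOrder g β s N) {k : ℕ} (hs : s ≤ k) (hk : k ≤ N) :
    IsMonicOp (upSeq g s k) (k - s) := by
  rw [← lowSeq_eq_upSeq g hs]
  have h' : IsFirstOrder g β s k := fun i l hi hl hlk => h i l hi hl (by omega)
  exact h'.isMonicOp_lowSeq (k - s) s le_rfl (by omega)

theorem coeffD_mulOp_mul {n : ℕ} (u : V n) (P : Module.End ℂ (Series n)) (k : ℤ) :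
    coeffD (mulOp u * P) k = u * coeffD P k := rfl

theorem coeffD_dOp_mul {n : ℕ} (P : Module.End ℂ (Series n)) (k : ℤ) :
    coeffD (dOp * P) k = D (coeffD P k) + sig (coeffD P (k - 1)) := rfl

theorem coeffD_sum' {n : ℕ} {ι : Type} (s : Finset ι) (P : ι → Module.End ℂ (Series n)) (k : ℤ) :
    coeffD (∑ i ∈ s, P i) k = ∑ i ∈ s, coeffD (P i) k := by
  rw [coeffD, LinearMap.sum_apply, Submodule.coe_sum, Finset.sum_apply]
  rfl

theorem coeffD_one {n : ℕ} : coeffD (1 : Module.End ℂ (Series n)) 0 = 1 := by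
  simpa using coeffD_dOp_pow (n := n) 0 0

theorem coeffD_eq_zero_of_mem {n m : ℕ} {P : Module.End ℂ (Series n)} (h : P ∈ degLT n m) {k : ℤ}
    (hk : k < 0) : coeffD P k = 0 := by
  obtain ⟨u, rfl⟩ := exists_of_mem_degLT h
  rw [coeffD_sum']
  refine Finset.sum_eq_zero fun j _ => ?_
  rw [coeffD_mulOp_mul, coeffD, dOp_pow_one, if_neg (by omega), mul_zero]

/-- The recursion for the constant terms of a sequence of differential operators. -/
theorem IsFirstOrder.coeffD_lowSeq {n s N : ℕ} {g : ℕ → ℕ → Module.End ℂ (Series n)}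
    {β : ℕ → ℕ → V n} (h : IsFirstOrder g β s N) {i : ℕ} (hs : s ≤ i) (hi : i < N) :
    coeffD (lowSeq g N i) 0 = D (coeffD (lowSeq g N (i + 1)) 0)
      + ∑ l ∈ Finset.Ico (i + 1) (N + 1), β i l * coeffD (lowSeq g N l) 0 := by
  -- In $D\cdot L$ the coefficient of $D^0$ also involves the coefficient of $D^{-1}$ in $L$, which
  -- vanishes for a differential operator.
  have hneg : coeffD (lowSeq g N (i + 1)) (0 - 1) = 0 :=
    coeffD_eq_zero_of_mem (h.isMonicOp_lowSeq (N - (i + 1)) (i + 1) (by omega) (by omega)).mem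
      (by omega)
  have e : ∀ l ∈ Finset.Ico (i + 1) (N + 1), g i l * lowSeq g N l
      = (if l = i + 1 then dOp * lowSeq g N (i + 1) else 0) + mulOp (β i l) * lowSeq g N l := by
    intro l hl
    rw [Finset.mem_Ico] at hl
    rw [h i l hs (by omega) (by omega), add_mul]
    split_ifs with e
    · rw [e]
    · rw [zero_mul]
  rw [lowSeq_eq _ hi, Finset.sum_congr rfl e, Finset.sum_add_distrib, Finset.sum_ite_eq',
    if_pos (by rw [Finset.mem_Ico]; omega), coeffD_add, coeffD_dOp_mul, hneg, map_zero, add_zero,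
    coeffD_sum']
  rfl

/-- The remainders after division by `D` from the left. -/
theorem IsFirstOrder.exists_upSeq_eq {n s N : ℕ} {g : ℕ → ℕ → Module.End ℂ (Series n)}
    {β : ℕ → ℕ → V n} (h : IsFirstOrder g β s N) (y : ℕ → V n) (y0 : y s = 1)
    (y1 : ∀ k, s ≤ k → k < N → y (k + 1) = sig (D (y k))
      + ∑ i ∈ Finset.Ico s (k + 1), y i * β i (k + 1)) :
    ∀ k, s ≤ k → k ≤ N → ∃ X, upSeq g s k = dOp * X + mulOp (y k) ∧
      (k = s ∧ X = 0 ∨ s < k ∧ IsMonicOp X (k - s - 1)) := by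
  intro k
  induction k using Nat.strong_induction_on with
  | _ k ih =>
    intro hs hk
    rcases hs.eq_or_lt with rfl | hs'
    · exact ⟨0, by simp [upSeq_self, y0, mulOp_one], Or.inl ⟨rfl, rfl⟩⟩
    · obtain ⟨k, rfl⟩ : ∃ m, k = m + 1 := ⟨k - 1, by omega⟩
      choose! X hX hX' using fun i (hi : s ≤ i ∧ i < k + 1) => ih i hi.2 hi.1 (by omega)
      -- In $\sum_i(DX_i+y_i)\,g(i,k+1)$ the only term not already in the required form is $y_kD$.
      -- By `mulOp_mul_dOp` it is $D$ times the parity image of $y_k$, plus the remainder `sig (D (y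
      -- k))`.
      refine ⟨∑ i ∈ Finset.Ico s (k + 1), X i * g i (k + 1) + mulOp (sig (y k)), ?_,
        Or.inr ⟨hs', ?_⟩⟩
      · have e : ∀ i ∈ Finset.Ico s (k + 1), upSeq g s i * g i (k + 1)
            = dOp * (X i * g i (k + 1)) + ((if i = k then mulOp (y k) * dOp else 0)
              + mulOp (y i * β i (k + 1))) := by
          intro i hi
          rw [Finset.mem_Ico] at hi
          rw [hX i hi, add_mul, mul_assoc, mulOp_mul]
          congr 1
          rw [h i (k + 1) hi.1 hi.2 hk, mul_add]
          congr 1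
          by_cases e : i = k
          · rw [if_pos (by omega), if_pos e, e]
          · rw [if_neg (by omega), if_neg e, mul_zero]
        rw [upSeq_eq _ hs', Finset.sum_congr rfl e, Finset.sum_add_distrib, Finset.sum_add_distrib,
          Finset.sum_ite_eq', if_pos (by rw [Finset.mem_Ico]; omega), mulOp_mul_dOp,
          y1 k (by omega) (by omega), mulOp_add, mulOp_sum, mul_add, Finset.mul_sum]
        abel
      · have hk' : s ≤ k ∧ k < k + 1 := by omega
        rw [Finset.sum_Ico_succ_top (by omega)]
        rcases hX' k hk' with ⟨rfl, h0⟩ | ⟨hlt, hm⟩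
        · rw [h0, y0]
          simp only [Finset.Ico_self, Finset.sum_empty, zero_mul, zero_add, map_one, mulOp_one]
          rw [show k + 1 - k - 1 = 0 by omega]
          exact isMonicOp_one
        · rw [add_comm (∑ i ∈ Finset.Ico s k, X i * g i (k + 1)), add_assoc]
          refine IsMonicOp.add ?_ (add_mem (sum_mem fun i hi => ?_) ?_)
          · rw [show k + 1 - s - 1 = k - s - 1 + 1 by omega]
            exact hm.mul (h.succ (by omega) hk)
          · rw [Finset.mem_Ico] at hi
            rw [h.of_ne hi.1 (by omega) hk]
            rcases hX' i (by omega) with ⟨-, h0⟩ | ⟨hlt, hm⟩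
            · rw [h0, zero_mul]; exact zero_mem _
            · exact degLT_mono (by omega) (mul_mem_degLT hm.mem (mulOp_mem (m := 0) _))
          · exact degLT_mono (by omega) (mulOp_mem (m := 0) _)

/-! ### The row determinant of `matA` -/

/-- The entries of `matTilde`, indexed by natural numbers. -/
def tildeN (n : ℕ) (hn : 0 < n) (i j : ℕ) : Module.End ℂ (Series n) :=
  if h : i < 4 * n ∧ j < 4 * n then matTilde n hn ⟨i, h.1⟩ ⟨j, h.2⟩ else 0

/-- The entries of the Hessenberg matrix obtained from `matTilde` by multiplying the row after the
inserted one by `D⁻¹`. -/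
def scaledN (n : ℕ) (hn : 0 < n) (i j : ℕ) : Module.End ℂ (Series n) :=
  if i = 2 * n then dInvOp * tildeN n hn i j else tildeN n hn i j

/-- The elements `bEnt`, indexed by natural numbers. -/
def bN (n : ℕ) (hn : 0 < n) (i j : ℕ) : V n :=
  if h : i < 4 * n ∧ j < 4 * n then bEnt n hn ⟨i, h.1⟩ ⟨j, h.2⟩ else 0

theorem tildeN_val {n : ℕ} (hn : 0 < n) (i j : Fin (4 * n)) :
    tildeN n hn i j = matTilde n hn i j := by
  rw [tildeN, dif_pos ⟨i.isLt, j.isLt⟩]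

theorem tildeN_of_le {n : ℕ} (hn : 0 < n) {i j : ℕ} (h : i ≤ j) (hj : j < 4 * n) :
    tildeN n hn i j = (if i = j then dOp else 0) + mulOp (bN n hn i j) := by
  have h' : i < 4 * n ∧ j < 4 * n := ⟨by omega, hj⟩
  rw [tildeN, bN, dif_pos h', dif_pos h', matTilde_apply,
    if_neg (c := (⟨i, h'.1⟩ : Fin (4 * n)) = idx1 n hn ∧ (⟨j, h'.2⟩ : Fin (4 * n)) = idx0 n hn),
    add_zero]
  · simp only [Fin.mk.injEq]
  · rintro ⟨h1, h2⟩
    rw [Fin.ext_iff] at h1 h2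
    rw [idx1_val] at h1
    rw [idx0_val] at h2
    simp only at h1 h2
    omega

theorem tildeN_of_lt {n : ℕ} (hn : 0 < n) {i j : ℕ} (h : j < i) :
    tildeN n hn i j = if i < 4 * n then
      (if i = 2 * n ∧ j = 2 * n - 1 then (-2 : ℂ) • dOp
        else if i = j + 1 then algebraMap ℂ _ (subC n j) else 0) else 0 := by
  by_cases hi : i < 4 * n
  · have h' : i < 4 * n ∧ j < 4 * n := ⟨by omega, by omega⟩
    have hlt : (⟨j, h'.2⟩ : Fin (4 * n)) < ⟨i, h'.1⟩ := h
    rw [tildeN, dif_pos h', matTilde_apply, bEnt_of_lt hn hlt, if_neg hlt.ne', if_pos hi, zero_add]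
    simp only [Fin.ext_iff, idx0_val, idx1_val]
    by_cases h1 : i = 2 * n ∧ j = 2 * n - 1
    · rw [if_pos h1, if_pos h1, if_neg (fun e => e.2 h1.2), mulOp_zero, add_zero]
    · rw [if_neg h1, if_neg h1, zero_add]
      by_cases h2 : i = j + 1
      · rw [if_pos ⟨h2, by omega⟩, if_pos h2, mulOp_algebraMap, Algebra.algebraMap_eq_smul_one]
      · rw [if_neg (fun e => h2 e.1), if_neg h2, mulOp_zero]
  · rw [tildeN, dif_neg (fun e => hi e.1), if_neg hi]

/-- Absorbed into the row that follows it, $D^{-1}$ makes the subdiagonal entry $-2D$ a scalar, and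
the Hessenberg formula applies. -/
theorem rowDet_matA {n : ℕ} (hn : 0 < n) :
    rowDet (matA n hn) = lowSeq (hessG (scaledN n hn) (subC n)) (4 * n) 0 := by
  rw [rowDet_of_single _ (⟨2 * n, by omega⟩ : Fin (4 * n)), ← rowDet_hessenberg]
  · refine rowDet_congr fun i j => ?_
    have h1 : (matA n hn) ((⟨2 * n, by omega⟩ : Fin (4 * n)).castSucc)
        ((⟨2 * n, by omega⟩ : Fin (4 * n)).castSucc) = dInvOp := by
      simp [matA]
    have h2 : ∀ i j, (matA n hn) ((⟨2 * n, by omega⟩ : Fin (4 * n)).castSucc.succAbove i)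
        ((⟨2 * n, by omega⟩ : Fin (4 * n)).castSucc.succAbove j) = matTilde n hn i j := by
      intro i j
      simp [matA]
    simp only [Matrix.of_apply, h1, h2, scaledN, tildeN_val, Fin.ext_iff]
  · intro i j hj hi
    have : tildeN n hn i j = 0 := by
      rw [tildeN_of_lt hn (by omega), if_pos hi, if_neg (by omega), if_neg (by omega)]
    rw [scaledN, this, mul_zero, ite_self]
  · intro j hj
    rw [scaledN, tildeN_of_lt hn (by omega), if_pos hj, if_pos rfl]
    by_cases h : j + 1 = 2 * n
    · rw [if_pos h, if_pos ⟨h, by omega⟩, mul_smul_comm, dInvOp_mul_dOp, subC, if_neg (by omega),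
        if_pos (by omega), Algebra.algebraMap_eq_smul_one]
    · rw [if_neg h, if_neg (fun e => h e.1)]
  · intro k hk
    obtain ⟨k, rfl⟩ := Fin.exists_succAbove_eq hk
    simp [matA]

/-- The transition coefficients of `matTilde`. -/
abbrev tildeG (n : ℕ) (hn : 0 < n) : ℕ → ℕ → Module.End ℂ (Series n) :=
  hessG (tildeN n hn) (subC n)

theorem detA2n_eq {n : ℕ} (hn : 0 < n) : detA2n n hn = lowSeq (tildeG n hn) (2 * n) 0 := by
  rw [← rowDet_hessenberg]
  · refine rowDet_congr fun i j => ?_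
    exact (tildeN_val hn (Fin.castLE (by omega) i) (Fin.castLE (by omega) j)).symm
  · intro i j hj hi
    rw [tildeN_of_lt hn (by omega), if_pos (by omega), if_neg (by omega), if_neg (by omega)]
  · intro j hj
    rw [tildeN_of_lt hn (by omega), if_pos (by omega), if_neg (by omega), if_pos rfl]

/-- The order zero parts of `tildeG`. -/
def tildeBeta (n : ℕ) (hn : 0 < n) (i l : ℕ) : V n :=
  (∏ m ∈ Finset.Ico i (l - 1), -subC n m) • bN n hn i (l - 1)

theorem isFirstOrder_tildeG {n : ℕ} (hn : 0 < n) :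
    IsFirstOrder (tildeG n hn) (tildeBeta n hn) 0 (4 * n) := by
  intro i l _ hl hN
  rw [tildeG, hessG, tildeBeta, tildeN_of_le hn (by omega) (by omega), smul_add, mulOp_smul]
  congr 1
  by_cases h : l = i + 1
  · subst h; simp
  · rw [if_neg h, if_neg (by omega), smul_zero]

theorem IsFirstOrder.mono {n s N s' N' : ℕ} {g : ℕ → ℕ → Module.End ℂ (Series n)}
    {β : ℕ → ℕ → V n} (h : IsFirstOrder g β s N) (hs : s ≤ s') (hN : N' ≤ N) :
    IsFirstOrder g β s' N' := fun i l h1 h2 h3 => h i l (hs.trans h1) h2 (h3.trans hN)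

theorem sigPow_sgn_smul {n : ℕ} (r q : ZMod 2) {v : V n} (h : sig v = sgn q • v) :
    sigPow r v = sgn (r * q) • v := by
  have hr : ∀ q : ZMod 2, q = 0 ∨ q = 1 := by decide
  rcases hr r with rfl | rfl
  · simp [sigPow, sgn_zero]
  · simp [sigPow, h]

theorem Ebar_mul {n : ℕ} (i j : Fin (4 * n)) (v : V n) :
    Ebar j i * v = sigPow (par i + par j + 1) v * Ebar j i := by
  rw [Ebar, map_smul, smul_mul_assoc, gen_mul 0 (comp_F j i), mul_smul_comm, add_comm (par j)]
  simp

theorem bEnt_mul {n : ℕ} (hn : 0 < n) {i j : Fin (4 * n)} (h : i ≤ j) (v : V n) :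
    bEnt n hn i j * v = sigPow (par i + par j + 1) v * bEnt n hn i j := by
  have h' : (i : ℕ) ≤ j := h
  have v0 := idx0_val hn
  have v1 := idx1_val hn
  have h01 := idx0_lt_idx1 hn
  have e1 : ¬ (i = idx1 n hn ∧ j = idx0 n hn) := by
    rintro ⟨rfl, rfl⟩; exact absurd h (not_le.2 h01)
  rw [bEnt, if_neg e1, add_zero, sub_mul, sub_mul, mul_sub, mul_sub, qEnt_of_le hn h, Ebar_mul]
  congr 1
  · congr 1
    split_ifs with hj
    · rw [qEnt_of_le hn (h.trans (hj ▸ h01.le)), Ebar_mul, hj, par_idx0, par_idx1]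
    · rw [zero_mul, mul_zero]
  · split_ifs with hi
    · rw [qEnt_of_le hn (le_trans h01.le (hi ▸ h)), Ebar_mul, hi, par_idx0, par_idx1]
    · rw [zero_mul, mul_zero]

/-- The constant terms of the lower right minors of the upper left block. -/
def lowConst (n : ℕ) (hn : 0 < n) (i : ℕ) : V n := coeffD (lowSeq (tildeG n hn) (2 * n) i) 0

theorem tildeBeta_of_le {n : ℕ} (hn : 0 < n) {i l : ℕ} (hl : l ≤ 2 * n) :
    tildeBeta n hn i l = bN n hn i (l - 1) := by
  rw [tildeBeta, Finset.prod_eq_one, one_smul]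
  intro m hm
  rw [Finset.mem_Ico] at hm
  rw [subC, if_pos (by omega), neg_neg]

theorem lowConst_self {n : ℕ} (hn : 0 < n) : lowConst n hn (2 * n) = 1 := by
  rw [lowConst, lowSeq_self, coeffD_one]

theorem lowConst_eq {n : ℕ} (hn : 0 < n) {i : ℕ} (hi : i < 2 * n) :
    lowConst n hn i = D (lowConst n hn (i + 1))
      + ∑ l ∈ Finset.Ico i (2 * n), bN n hn i l * lowConst n hn (l + 1) := by
  rw [lowConst, ((isFirstOrder_tildeG hn).mono le_rfl (by omega)).coeffD_lowSeq (Nat.zero_le _) hi,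
    ← Finset.sum_Ico_add' _ i (2 * n) 1]
  congr 1
  refine Finset.sum_congr rfl fun l hl => ?_
  rw [Finset.mem_Ico] at hl
  rw [tildeBeta_of_le hn (by omega)]
  rfl

theorem par_mk_of_lt {n i : ℕ} (h : i < 4 * n) (hi : i < 2 * n) :
    par (⟨i, h⟩ : Fin (4 * n)) = (i : ZMod 2) + 1 := by
  rw [par_eq, if_pos hi]

theorem sig_bN {n : ℕ} (hn : 0 < n) {i j : ℕ} (hi : i < 2 * n) (hj : j < 2 * n) :
    sig (bN n hn i j) = sgn ((i : ZMod 2) + j + 1) • bN n hn i j := by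
  rw [bN, dif_pos ⟨by omega, by omega⟩, sig_bEnt, par_mk_of_lt _ hi, par_mk_of_lt _ hj]
  congr 2
  generalize (i : ZMod 2) = x, (j : ZMod 2) = y
  revert x y; decide

/-- In the upper left block the entry $(i,l)$ has parity $i+l+1$, and $D$ is odd, so the constant
term of the minor starting at `i` has parity $i$. -/
theorem sig_lowConst {n : ℕ} (hn : 0 < n) : ∀ m i, i + m = 2 * n →
    sig (lowConst n hn i) = sgn (i : ZMod 2) • lowConst n hn i := by
  intro m
  induction m using Nat.strong_induction_on with
  | _ m ih =>
    intro i hi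
    rcases m with _ | m
    · rw [show i = 2 * n by omega, lowConst_self, map_one,
        (ZMod.natCast_eq_zero_iff_even).2 (by simp), sgn_zero, one_smul]
    · rw [lowConst_eq hn (by omega), map_add, sig_D, ih m (by omega) _ (by omega), map_smul,
        map_sum, smul_add, Finset.smul_sum]
      congr 1
      · rw [← neg_smul]
        congr 1
        push_cast
        rw [sgn_add, sgn_one]; ring
      · refine Finset.sum_congr rfl fun l hl => ?_
        rw [Finset.mem_Ico] at hl
        rw [map_mul, sig_bN hn (by omega) (by omega),
          ih (2 * n - (l + 1)) (by omega) (l + 1) (by omega), smul_mul_smul_comm, ← sgn_add]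
        congr 2
        push_cast
        generalize (i : ZMod 2) = x, (l : ZMod 2) = y
        revert x y; decide

/-- The remainders, after division by `D` from the left, of the upper left minors of the lower right
block. -/
def upConst (n : ℕ) (hn : 0 < n) (k : ℕ) : V n :=
  (∏ m ∈ Finset.Ico (2 * n) k, -subC n m) • lowConst n hn (4 * n - k)

/-- Two signs meet: `tau` from the reflection, and the sign of moving the entry past the minor.
Their dependence on the parity of `l` cancels, which allows the sign to leave the sum in
`upConst_succ`. -/
theorem lowConst_mul_bN {n : ℕ} (hn : 0 < n) {j l : ℕ} (h : j ≤ l) (hl : l < 2 * n) :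
    lowConst n hn (l + 1) * bN n hn (4 * n - 1 - l) (4 * n - 1 - j)
      = (-1 : ℂ) ^ j • (bN n hn j l * lowConst n hn (l + 1)) := by
  have e : ∀ i (hi : i < 4 * n), (⟨4 * n - 1 - i, by omega⟩ : Fin (4 * n))
      = Fin.rev ⟨i, hi⟩ := by
    intro i hi; ext; simp [Fin.val_rev]; omega
  have e1 : bN n hn (4 * n - 1 - l) (4 * n - 1 - j)
      = tau (⟨j, by omega⟩ : Fin (4 * n)) ⟨l, by omega⟩ • bN n hn j l := by
    rw [bN, bN, dif_pos ⟨by omega, by omega⟩, dif_pos ⟨by omega, by omega⟩, e l (by omega),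
      e j (by omega), bEnt_rev hn h hl]
  have e2 : bN n hn j l * lowConst n hn (l + 1)
      = sgn ((par (⟨j, by omega⟩ : Fin (4 * n)) + par (⟨l, by omega⟩ : Fin (4 * n)) + 1)
          * ((l + 1 : ℕ) : ZMod 2)) • lowConst n hn (l + 1)
        * bEnt n hn ⟨j, by omega⟩ ⟨l, by omega⟩ := by
    rw [bN, dif_pos ⟨by omega, by omega⟩, bEnt_mul hn h,
      sigPow_sgn_smul _ _ (sig_lowConst hn (2 * n - (l + 1)) (l + 1) (by omega))]
  have e3 : bEnt n hn ⟨j, by omega⟩ ⟨l, by omega⟩ = bN n hn j l := by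
    rw [bN, dif_pos ⟨by omega, by omega⟩]
  rw [e1, e2, e3, smul_mul_assoc, smul_smul, mul_smul_comm, tau, del_eq, del_eq, if_pos (by simp; omega),
    if_pos (by simp; omega), ← sgn_natCast, ← sgn_add, par_mk_of_lt, par_mk_of_lt]
  · congr 2
    push_cast
    generalize (j : ZMod 2) = x, (l : ZMod 2) = y
    revert x y; decide
  · exact hl
  · omega

theorem subC_of_ge {n k : ℕ} (h : 2 * n ≤ k) : subC n k = (-1) ^ k := by
  rw [subC, if_neg (by omega), if_neg (by omega)]

/-- This is the recursion of left remainders required by `IsFirstOrder.exists_upSeq_eq`. It is the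
recursion `lowConst_eq` read backwards: the reflection turns $b_{jl}\,a_{l+1}$ into a product with
the minor on the left. -/
theorem upConst_succ {n : ℕ} (hn : 0 < n) {k : ℕ} (hs : 2 * n ≤ k) (hk : k < 4 * n) :
    upConst n hn (k + 1) = sig (D (upConst n hn k))
      + ∑ i ∈ Finset.Ico (2 * n) (k + 1), upConst n hn i * tildeBeta n hn i (k + 1) := by
  obtain ⟨j, hj⟩ : ∃ j, j + 1 + k = 4 * n := ⟨4 * n - 1 - k, by omega⟩
  -- Since `k + 1 = 4 * n - j`, the new subdiagonal sign $-(-1)^k$ equals the sign $(-1)^j$ of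
  -- `lowConst_mul_bN`.
  have hpow : (-1 : ℂ) ^ (k + 1) = (-1) ^ j := by
    rw [← sgn_natCast, ← sgn_natCast]
    congr 1
    rw [ZMod.natCast_eq_natCast_iff']
    omega
  have hmain : upConst n hn (k + 1) = (∏ m ∈ Finset.Ico (2 * n) k, -subC n m) •
      (-1 : ℂ) ^ j • lowConst n hn j := by
    rw [upConst, Finset.prod_Ico_succ_top hs, subC_of_ge hs, mul_smul, ← hpow, pow_succ,
      show 4 * n - (k + 1) = j by omega]
    simp
  rw [hmain, lowConst_eq hn (by omega), smul_add, smul_add]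
  congr 1
  · rw [upConst, map_smul, map_smul, show 4 * n - k = j + 1 by omega, sig_D,
      sig_lowConst hn (2 * n - (j + 1)) (j + 1) (by omega), map_smul, sgn_natCast]
    congr 1
    rw [← neg_smul, pow_succ]; simp
  · rw [Finset.smul_sum, Finset.smul_sum]
    -- The reflection of zero-based indices is $l\mapsto 4n-1-l$; it exchanges the intervals
    -- $[j,2n)$ and $[2n,k+1)$.
    refine Finset.sum_bij' (fun l _ => 4 * n - 1 - l) (fun i _ => 4 * n - 1 - i) ?_ ?_ ?_ ?_ ?_
    · intro l hl; rw [Finset.mem_Ico] at *; omega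
    · intro l hl; rw [Finset.mem_Ico] at *; omega
    · intro l hl; rw [Finset.mem_Ico] at *; omega
    · intro l hl; rw [Finset.mem_Ico] at *; omega
    · intro l hl
      rw [Finset.mem_Ico] at hl
      rw [upConst, tildeBeta, smul_mul_smul_comm, Nat.add_sub_cancel,
        Finset.prod_Ico_consecutive _ (by omega) (by omega),
        show 4 * n - (4 * n - 1 - l) = l + 1 by omega, show k = 4 * n - 1 - j by omega,
        lowConst_mul_bN hn hl.1 hl.2]

theorem prod_neg_subC (n m : ℕ) :
    ∏ k ∈ Finset.Ico (2 * n) (2 * n + 2 * m), -subC n k = (-1) ^ m := by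
  induction m with
  | zero => simp
  | succ m ih =>
    rw [show 2 * n + 2 * (m + 1) = 2 * n + 2 * m + 1 + 1 by ring, Finset.prod_Ico_succ_top (by omega),
      Finset.prod_Ico_succ_top (by omega), ih, subC_of_ge (by omega), subC_of_ge (by omega)]
    simp [pow_succ, pow_add, pow_mul]

/-- The origin of the factor $(-1)^n$: the signs $-(-1)^k$ for $2n\le k<4n$ multiply to $-1$ in each
consecutive pair. -/
theorem upConst_top {n : ℕ} (hn : 0 < n) : upConst n hn (4 * n) = (-1 : ℂ) ^ n • wTilde n hn := by
  rw [upConst, Nat.sub_self, wTilde, detA2n_eq, lowConst]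
  congr 1
  rw [← prod_neg_subC n n, show 2 * n + 2 * n = 4 * n by ring]

/-- The row determinant of `matA` up to differential operators of lower order. -/
theorem rowDet_matA_eq {n : ℕ} (hn : 0 < n) : ∃ P : Module.End ℂ (Series n),
    IsMonicOp P (4 * n - 1) ∧ rowDet (matA n hn) = P + (-1 : ℂ) ^ n •
      (mulOp (wTilde n hn) * dInvOp * mulOp (wTilde n hn)) := by
  have hF := isFirstOrder_tildeG hn
  have g_ne : ∀ i l, i ≠ 2 * n → hessG (scaledN n hn) (subC n) i l = tildeG n hn i l := by
    intro i l hi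
    rw [tildeG, hessG, hessG, scaledN, if_neg hi]
  have g_eq : ∀ l, hessG (scaledN n hn) (subC n) (2 * n) l = dInvOp * tildeG n hn (2 * n) l := by
    intro l
    rw [tildeG, hessG, hessG, scaledN, if_pos rfl, mul_smul_comm]
  have hL : ∀ l, 2 * n + 1 ≤ l →
      lowSeq (hessG (scaledN n hn) (subC n)) (4 * n) l = lowSeq (tildeG n hn) (4 * n) l :=
    lowSeq_congr fun i l hi _ _ => g_ne i l (by omega)
  have hU : ∀ k, k ≤ 2 * n →
      upSeq (hessG (scaledN n hn) (subC n)) 0 k = upSeq (tildeG n hn) 0 k :=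
    upSeq_congr fun i k _ hk hk' => g_ne i k (by omega)
  -- The factor $D^{-1}$ is common to the whole middle row and is pulled out on the left of the
  -- lower right determinant.
  have hmid : lowSeq (hessG (scaledN n hn) (subC n)) (4 * n) (2 * n)
      = dInvOp * lowSeq (tildeG n hn) (4 * n) (2 * n) := by
    rw [lowSeq_eq _ (by omega), lowSeq_eq _ (by omega), Finset.mul_sum]
    refine Finset.sum_congr rfl fun l hl => ?_
    rw [Finset.mem_Ico] at hl
    rw [g_eq, hL l hl.1, mul_assoc]
  -- Right division: $A_{2n}=QD+a$.
  obtain ⟨Q, a, hQ, hQ'⟩ := IsMonicOp.exists_right (m := 2 * n - 1) (by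
    rw [show 2 * n - 1 + 1 = 2 * n - 0 by omega]
    exact hF.isMonicOp_upSeq (Nat.zero_le (2 * n)) (by omega))
  -- $QD$ has no coefficient at $D^0$, so the right remainder is the constant term.
  have ha : a = wTilde n hn := by
    rw [wTilde, detA2n_eq, lowSeq_eq_upSeq _ (Nat.zero_le _), hQ', coeffD_add, ← mul_one (mulOp a),
      coeffD_mulOp_mul, coeffD_one, mul_one, eq_comm, add_eq_right]
    obtain ⟨Q', hQ1, rfl⟩ := hQ
    obtain ⟨u, rfl⟩ := exists_of_mem_degLT hQ1
    rw [add_mul, ← pow_succ, coeffD_add, Finset.sum_mul, coeffD_sum']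
    have h0 : ∀ k : ℕ, coeffD (dOp ^ (k + 1) : Module.End ℂ (Series n)) 0 = 0 := by
      intro k
      simpa using coeffD_dOp_pow (n := n) (k + 1) 0
    simp only [mul_assoc, ← pow_succ, coeffD_mulOp_mul, h0, mul_zero, Finset.sum_const_zero,
      add_zero]
  -- Left division of the lower right determinant, with remainder `upConst n hn (4 * n)`.
  obtain ⟨X, hX, hX'⟩ := (hF.mono (Nat.zero_le (2 * n)) le_rfl).exists_upSeq_eq (upConst n hn)
    (by rw [upConst, show 4 * n - 2 * n = 2 * n by omega, lowConst_self]; simp)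
    (fun k h1 h2 => upConst_succ hn h1 h2) (4 * n) (by omega) le_rfl
  have hXm : IsMonicOp X (2 * n - 1) := by
    rcases hX' with ⟨h, -⟩ | ⟨-, h⟩
    · omega
    · rwa [show 4 * n - 2 * n - 1 = 2 * n - 1 by omega] at h
  -- With remainder $c$ this is $(QD+a)D^{-1}(DX+c)=QDX+Qc+aX+aD^{-1}c$.
  have e1 : upSeq (tildeG n hn) 0 (2 * n) * (dInvOp * lowSeq (tildeG n hn) (4 * n) (2 * n))
      = Q * dOp * X + (Q * mulOp (upConst n hn (4 * n)) + mulOp a * X)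
        + mulOp a * dInvOp * mulOp (upConst n hn (4 * n)) := by
    rw [lowSeq_eq_upSeq _ (by omega), hX, hQ', add_mul, mul_assoc Q, ← mul_assoc dOp dInvOp,
      dOp_mul_dInvOp, one_mul, mul_add, mul_add dInvOp, ← mul_assoc dInvOp dOp, dInvOp_mul_dOp,
      one_mul, mul_add (mulOp a)]
    simp only [mul_assoc]
    abel
  refine ⟨Q * dOp * X + (Q * mulOp (upConst n hn (4 * n)) + mulOp a * X)
    + ∑ i ∈ Finset.Ico 0 (2 * n), ∑ l ∈ Finset.Ico (2 * n + 1) (4 * n + 1),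
      upSeq (hessG (scaledN n hn) (subC n)) 0 i * hessG (scaledN n hn) (subC n) i l
        * lowSeq (hessG (scaledN n hn) (subC n)) (4 * n) l, ?_, ?_⟩
  · refine (IsMonicOp.add ?_ (add_mem ?_ ?_)).add (sum_mem fun i hi => sum_mem fun l hl => ?_)
    · have := (hQ.mul isMonicOp_dOp).mul hXm
      rwa [show 2 * n - 1 + 1 + (2 * n - 1) = 4 * n - 1 by omega] at this
    · exact degLT_mono (by omega) (mul_mem_degLT hQ.mem (mulOp_mem (m := 0) _))
    · exact degLT_mono (by omega) (mulOp_mul_mem _ hXm.mem)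
    -- A step over the middle index is not a unit step, so it has order zero; the term has order at
    -- most $i+(4n-l)\le4n-2$.
    · rw [Finset.mem_Ico] at hi hl
      rw [hU i (by omega), hL l (by omega), g_ne i l (by omega),
        hF.of_ne (Nat.zero_le _) (by omega) (by omega), mul_assoc]
      exact degLT_mono (by omega) (mul_mem_degLT (hF.isMonicOp_upSeq (Nat.zero_le i) (by omega)).mem
        (mulOp_mul_mem _ (hF.isMonicOp_lowSeq (4 * n - l) l (by omega) (by omega)).mem))
  · rw [rowDet_matA, lowSeq_eq_mul_add _ (by omega : 0 < 2 * n) (by omega), hmid, hU _ le_rfl, e1,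
      upConst_top, mulOp_smul, ha]
    simp only [mul_smul_comm]
    exact add_right_comm _ _ _

theorem rowDet_matA_expansion {n : ℕ} (hn : 0 < n) : rowDet (matA n hn) =
    dOp ^ (4 * n - 1)
      + ∑ k ∈ Finset.range (4 * n - 1), mulOp (w n hn (4 * n - 1 - k)) * dOp ^ k
      + (-1 : ℂ) ^ n • (mulOp (wTilde n hn) * dInvOp * mulOp (wTilde n hn)) := by
  obtain ⟨P, hP, e⟩ := rowDet_matA_eq hn
  obtain ⟨Q, hQ, rfl⟩ := hP
  obtain ⟨u, rfl⟩ := exists_of_mem_degLT hQ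
  have hw : ∀ k ∈ Finset.range (4 * n - 1), mulOp (w n hn (4 * n - 1 - k)) * dOp ^ k
      = mulOp (u k) * dOp ^ k := by
    intro k hk
    rw [Finset.mem_range] at hk
    have hi : (4 * (n : ℤ) - 1 - ((4 * n - 1 - k : ℕ) : ℤ)) = (k : ℤ) := by omega
    rw [w, hi, e, coeffD_add, coeffD_add, coeffD_smul, coeffD_mul_dInvOp_mul, coeffD_dOp_pow,
      coeffD_sum, if_neg (by omega), if_pos hk]
    simp
  rw [Finset.sum_congr rfl hw, e]

/-! ### The grading of `osp(2n|2n)` -/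

/-- Twice the eigenvalues of `x`. -/
def xw {n : ℕ} (i : Fin (4 * n)) : ℤ :=
  if (i : ℕ) < 2 * n then 2 * n - 1 - (i : ℕ) else 2 * n - (i : ℕ)

theorem xw_rev {n : ℕ} (i : Fin (4 * n)) : xw i.rev = - xw i := by
  have := i.isLt
  unfold xw
  rw [Fin.val_rev]
  split_ifs <;> omega

theorem xw_anti {n : ℕ} {i j : Fin (4 * n)} (h : i ≤ j) : xw j ≤ xw i := by
  have h' : (i : ℕ) ≤ j := h
  unfold xw
  split_ifs <;> omega

theorem x_apply {n : ℕ} (i j : Fin (4 * n)) :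
    (x n).1 i j = if i = j then ((xw i : ℤ) : ℂ) / 2 else 0 := by
  simp only [x, Matrix.diagonal_apply, xw]
  split_ifs <;> push_cast <;> ring

theorem bracket_apply {n : ℕ} (a b : osp n) (i l : Fin (4 * n)) : (bracket a b).1 i l
    = ∑ m, (a.1 i m * b.1 m l
      - sgn ((par i + par m) * (par m + par l)) * (b.1 i m * a.1 m l)) := rfl

/-- `x` is diagonal, so `ad x` multiplies the entry $(i,l)$ by half the difference of the integers
`xw`; membership in a graded piece becomes a condition on the support. -/
theorem mem_gPiece {n : ℕ} {j : ℤ} {a : osp n} :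
    a ∈ gPiece n j ↔ ∀ i l, a.1 i l ≠ 0 → xw i - xw l = j := by
  have e : ∀ i l, (bracket (x n) a).1 i l = ((xw i : ℂ) / 2 - (xw l : ℂ) / 2) * a.1 i l := by
    intro i l
    have hz : ∀ p q : ZMod 2, (p + q) * (q + q) = 0 := by decide
    rw [bracket_apply, Finset.sum_sub_distrib, Finset.sum_eq_single i, Finset.sum_eq_single l]
    · rw [x_apply, x_apply, if_pos rfl, if_pos rfl, hz, sgn_zero]; ring
    · intro m _ hm; rw [x_apply, if_neg hm]; ring
    · simp
    · intro m _ hm; rw [x_apply, if_neg (Ne.symm hm)]; ring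
    · simp
  rw [gPiece, Module.End.mem_eigenspace_iff]
  constructor
  · intro h i l hil
    have h1 := e i l
    rw [h] at h1
    have h2 : ((j : ℂ) / 2) * a.1 i l = ((xw i : ℂ) / 2 - (xw l : ℂ) / 2) * a.1 i l := h1
    have h3 := mul_right_cancel₀ hil h2
    have h4 : ((xw i - xw l : ℤ) : ℂ) = (j : ℂ) := by push_cast; linear_combination -2 * h3
    exact_mod_cast h4
  · intro h
    ext i l
    rw [e]
    change _ = ((j : ℂ) / 2) * a.1 i l
    by_cases hil : a.1 i l = 0
    · rw [hil]; ring
    · rw [← h i l hil]; push_cast; ring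

theorem F_mem_gPiece {n : ℕ} (i j : Fin (4 * n)) : F i j ∈ gPiece n (xw i - xw j) := by
  rw [mem_gPiece]
  intro k l h
  rw [F_apply] at h
  by_cases h1 : i = k ∧ j = l
  · rw [h1.1, h1.2]
  · by_cases h2 : j.rev = k ∧ i.rev = l
    · rw [← h2.1, ← h2.2, xw_rev, xw_rev]; ring
    · rw [if_neg h1, if_neg h2, add_zero] at h
      exact absurd rfl h

theorem comp_apply {n : ℕ} (q : ZMod 2) (a : osp n) (i j : Fin (4 * n)) :
    (comp q a).1 i j = if par i + par j = q then a.1 i j else 0 := rfl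

theorem comp_mem_gPiece {n : ℕ} (q : ZMod 2) {j : ℤ} {a : osp n} (ha : a ∈ gPiece n j) :
    comp q a ∈ gPiece n j := by
  rw [mem_gPiece] at *
  intro i l h
  rw [comp_apply] at h
  split_ifs at h
  · exact ha i l h
  · exact absurd rfl h

theorem mem_nPos {n : ℕ} {j : ℤ} (hj : 0 < j) {a : osp n} (ha : a ∈ gPiece n j) : a ∈ nPos n :=
  Submodule.mem_iSup_of_mem j (Submodule.mem_iSup_of_mem hj ha)

theorem mem_pNonpos {n : ℕ} {j : ℤ} (hj : j ≤ 0) {a : osp n} (ha : a ∈ gPiece n j) :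
    a ∈ pNonpos n :=
  Submodule.mem_iSup_of_mem j (Submodule.mem_iSup_of_mem hj ha)

theorem comp_mem_nPos {n : ℕ} (q : ZMod 2) {a : osp n} (ha : a ∈ nPos n) : comp q a ∈ nPos n := by
  have h : nPos n ≤ (nPos n).comap (comp q) :=
    iSup₂_le fun j hj a ha => mem_nPos hj (comp_mem_gPiece q ha)
  exact h ha

theorem comp_mem_pNonpos {n : ℕ} (q : ZMod 2) {a : osp n} (ha : a ∈ pNonpos n) :
    comp q a ∈ pNonpos n := by
  have h : pNonpos n ≤ (pNonpos n).comap (comp q) :=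
    iSup₂_le fun j hj a ha => mem_pNonpos hj (comp_mem_gPiece q ha)
  exact h ha

/-- The matrices of `n` have nonzero entries only in places of positive degree. -/
theorem apply_eq_zero_of_mem_nPos {n : ℕ} {a : osp n} (ha : a ∈ nPos n) {i l : Fin (4 * n)}
    (h : xw i ≤ xw l) : a.1 i l = 0 := by
  let T : Submodule ℂ (osp n) :=
    { carrier := {a | a.1 i l = 0}
      add_mem' := fun {a b} ha hb => by
        change a.1 i l + b.1 i l = 0
        rw [show a.1 i l = 0 from ha, show b.1 i l = 0 from hb, add_zero]
      zero_mem' := rfl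
      smul_mem' := fun c a ha => by
        change c * a.1 i l = 0
        rw [show a.1 i l = 0 from ha, mul_zero] }
  have hT : nPos n ≤ T := iSup₂_le fun j hj a ha => by
    change a.1 i l = 0
    by_contra h0
    have := mem_gPiece.1 ha i l h0
    omega
  exact hT ha

theorem bracket_mem_gPiece {n : ℕ} {j k : ℤ} {a b : osp n} (ha : a ∈ gPiece n j)
    (hb : b ∈ gPiece n k) : bracket a b ∈ gPiece n (j + k) := by
  rw [mem_gPiece] at *
  intro i l h
  rw [bracket_apply] at h
  obtain ⟨m, -, hm⟩ := Finset.exists_ne_zero_of_sum_ne_zero h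
  by_cases h1 : a.1 i m * b.1 m l = 0
  · rw [h1, zero_sub, neg_ne_zero] at hm
    have h2 := right_ne_zero_of_mul hm
    have h3 := hb i m (left_ne_zero_of_mul h2)
    have h4 := ha m l (right_ne_zero_of_mul h2)
    omega
  · have h3 := ha i m (left_ne_zero_of_mul h1)
    have h4 := hb m l (right_ne_zero_of_mul h1)
    omega

theorem form_apply {n : ℕ} (a b : osp n) :
    form a b = ∑ i, sgn (par i) * ∑ m, a.1 i m * b.1 m i := rfl

theorem form_eq_zero_of_gPiece {n : ℕ} {j k : ℤ} {a b : osp n} (ha : a ∈ gPiece n j)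
    (hb : b ∈ gPiece n k) (h : j + k ≠ 0) : form a b = 0 := by
  rw [mem_gPiece] at *
  rw [form_apply]
  refine Finset.sum_eq_zero fun i _ => ?_
  rw [Finset.sum_eq_zero, mul_zero]
  intro m _
  by_contra h0
  have h1 := ha i m (left_ne_zero_of_mul h0)
  have h2 := hb m i (right_ne_zero_of_mul h0)
  omega

theorem f_mem_gPiece {n : ℕ} (hn : 0 < n) : f n hn ∈ gPiece n (-1) := by
  rw [mem_gPiece]
  intro i j h
  rw [f_apply] at h
  unfold xw
  split_ifs at h ⊢ <;> first | exact absurd rfl h | omega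

theorem comp_f {n : ℕ} (hn : 0 < n) : comp 1 (f n hn) = f n hn := by
  ext i j
  rw [comp_apply]
  split_ifs with h
  · rfl
  · by_contra h0
    exact h (f_par hn (Ne.symm h0))

/-- In units of $\frac12$, elements of $\mathfrak n$ have degree at least $1$, so their brackets
have degree at least $2$ and are orthogonal to $f$, which has degree $-1$. This makes the constants
in the generators of the ideal compatible with the bracket. -/
theorem bracket_mem_nPos {n : ℕ} (hn : 0 < n) {a b : osp n} (ha : a ∈ nPos n) (hb : b ∈ nPos n) :
    bracket a b ∈ nPos n ⊓ LinearMap.ker (form (f n hn)) := by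
  have h1 : ∀ j, 0 < j → ∀ a ∈ gPiece n j,
      nPos n ≤ (nPos n ⊓ LinearMap.ker (form (f n hn))).comap (bracket a) := by
    intro j hj a ha
    refine iSup₂_le fun k hk b hb => ?_
    exact ⟨mem_nPos (by omega) (bracket_mem_gPiece ha hb),
      form_eq_zero_of_gPiece (f_mem_gPiece hn) (bracket_mem_gPiece ha hb) (by omega)⟩
  have h2 : nPos n ≤ (nPos n ⊓ LinearMap.ker (form (f n hn))).comap (bracket.flip b) :=
    iSup₂_le fun j hj a ha => h1 j hj a ha hb
  exact h2 ha

/-- The two summands of $F_{ji}$ contribute equally, by the symmetry of the entries of $b$; this is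
the origin of the factor $2$, which the $\frac12$ in $E_{ij}$ compensates. -/
theorem form_F {n : ℕ} (b : osp n) (i j : Fin (4 * n)) :
    form b (F j i) = 2 * sgn (par i) * b.1 i j := by
  have hb := (mem_osp_iff b.1).1 b.2 i j
  have e : ∀ k m, b.1 k m * (F j i).1 m k = (if m = j then (if k = i then b.1 i j else 0) else 0)
      + (if m = i.rev then (if k = j.rev then b.1 j.rev i.rev * tau j i else 0) else 0) := by
    intro k m
    rw [F_apply, mul_add]
    congr 1
    · by_cases h1 : m = j <;> by_cases h2 : k = i
      · subst h1 h2; simp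
      · rw [if_neg (fun e => h2 e.2.symm), if_pos h1, if_neg h2, mul_zero]
      · rw [if_neg (fun e => h1 e.1.symm), if_neg h1, mul_zero]
      · rw [if_neg (fun e => h1 e.1.symm), if_neg h1, mul_zero]
    · by_cases h1 : m = i.rev <;> by_cases h2 : k = j.rev
      · subst h1 h2; simp
      · rw [if_neg (fun e => h2 e.2.symm), if_pos h1, if_neg h2, mul_zero]
      · rw [if_neg (fun e => h1 e.1.symm), if_neg h1, mul_zero]
      · rw [if_neg (fun e => h1 e.1.symm), if_neg h1, mul_zero]
  rw [form_apply]
  simp only [e, Finset.sum_add_distrib, Finset.sum_ite_eq', Finset.mem_univ, if_true, mul_add,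
    mul_ite, mul_zero]
  rw [hb, par_rev]
  have h2 : sgn (par j) * tau i j * tau j i = sgn (par i) := by
    rw [tau, tau, ← sgn_add, ← sgn_add]
    congr 1
    generalize par i = a, par j = b, del i = c, del j = d
    revert a b c d; decide
  linear_combination b.1 i j * h2

/-- The summands that come from $\mathbf e_{ji}$ are those of the supercommutator in
$\mathfrak{gl}$. The reflected ones match crosswise: what $a$ does from the left to $\mathbf
e_{i'j'}$ is what it does from the right to $\mathbf e_{ji}$, because $a\in\mathfrak{osp}$ and `tau`
satisfies `tau_mul`. -/
theorem bracket_F {n : ℕ} {p : ZMod 2} {a : osp n} (ha : comp p a = a) (i j : Fin (4 * n)) :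
    bracket a (F j i) = ∑ k, (a.1 k j • F k i
      - (sgn (p * (par i + par j)) * a.1 i k) • F j k) := by
  have hsym : ∀ k l, a.1 l.rev k.rev = tau k l * a.1 k l := (mem_osp_iff a.1).1 a.2
  ext r s
  have e1 : (bracket a (F j i)).1 r s = (if i = s then a.1 r j else 0)
      + (if j.rev = s then a.1 r i.rev * tau j i else 0)
      - ((if j = r then sgn ((par r + par i) * (par i + par s)) * a.1 i s else 0)
        + (if i.rev = r then sgn ((par r + par j) * (par j + par s)) *
            (tau j i * a.1 j.rev s) else 0)) := by
    rw [bracket_apply, Finset.sum_sub_distrib]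
    congr 1
    · simp only [F_apply, mul_add, Finset.sum_add_distrib, mul_ite, mul_one, mul_zero, ite_and,
        Finset.sum_ite_eq, Finset.mem_univ, if_true]
    · simp only [F_apply, add_mul, mul_add, Finset.sum_add_distrib, ite_mul, mul_ite, zero_mul,
        one_mul, mul_zero, ite_and]
      congr 1
      · by_cases h : j = r
        · simp [h]
        · simp [h]
      · by_cases h : i.rev = r
        · simp [h, par_rev]
        · simp [h]
  have e2 : (∑ k, (a.1 k j • F k i - (sgn (p * (par i + par j)) * a.1 i k) • F j k) : osp n).1 r s
      = (if i = s then a.1 r j else 0) + (if i.rev = r then a.1 s.rev j * tau s.rev i else 0)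
      - ((if j = r then sgn (p * (par i + par j)) * a.1 i s else 0)
        + (if j.rev = s then sgn (p * (par i + par j)) * a.1 i r.rev * tau j r.rev else 0)) := by
    have hr : ∀ (x y : Fin (4 * n)), (x.rev = y) = (x = y.rev) := by
      intro x y; rw [eq_iff_iff]; exact ⟨fun h => by simp [← h], fun h => by simp [h]⟩
    rw [Submodule.coe_sum, Matrix.sum_apply]
    simp only [Submodule.coe_sub, Submodule.coe_smul, Matrix.sub_apply, Matrix.smul_apply,
      F_apply, smul_eq_mul, Finset.sum_sub_distrib, mul_add, Finset.sum_add_distrib]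
    congr 1
    · congr 1
      · by_cases h : i = s
        · simp [h]
        · simp [h]
      · by_cases h : i.rev = r
        · simp [h, hr]
        · simp [h]
    · congr 1
      · by_cases h : j = r
        · simp [h]
        · simp [h]
      · by_cases h : j.rev = s
        · simp [h, hr]
        · simp [h]
  rw [e1, e2]
  -- Signs need comparing only where the entry of $a$ is nonzero; there the parities of its indices
  -- add up to `p`.
  have t1 : j.rev = s → a.1 r i.rev * tau j i = -(sgn (p * (par i + par j)) * a.1 i r.rev
      * tau j r.rev) := by
    intro _
    have h1 := hsym i r.rev
    rw [Fin.rev_rev] at h1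
    rw [h1]
    by_cases h0 : a.1 i r.rev = 0
    · rw [h0]; ring
    · have hp : par i + par r.rev = p := by
        by_contra hne; exact h0 (entry_eq_zero ha hne)
      have h2 := tau_mul j i r.rev
      have h3 : sgn (p * (par i + par j)) = sgn ((par j + par i) * (par i + par r.rev)) := by
        rw [hp, add_comm (par j), mul_comm]
      rw [h3]
      linear_combination a.1 i r.rev * h2
  have t2 : i.rev = r → sgn ((par r + par j) * (par j + par s)) * (tau j i * a.1 j.rev s)
      = -(a.1 s.rev j * tau s.rev i) := by
    rintro rfl
    have h1 := hsym s.rev j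
    rw [Fin.rev_rev] at h1
    rw [h1]
    have h2 := tau_mul s.rev j i
    have h3 := sgn_mul_self ((par s.rev + par j) * (par j + par i))
    have h4 : (par i.rev + par j) * (par j + par s) = (par s.rev + par j) * (par j + par i) := by
      rw [par_rev, par_rev]; ring
    rw [h4]
    linear_combination (sgn ((par s.rev + par j) * (par j + par i)) * a.1 s.rev j) * h2
      - a.1 s.rev j * tau s.rev i * h3
  have t3 : j = r → sgn ((par r + par i) * (par i + par s)) * a.1 i s
      = sgn (p * (par i + par j)) * a.1 i s := by
    rintro rfl
    by_cases h0 : a.1 i s = 0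
    · rw [h0]; ring
    · have hp : par i + par s = p := by
        by_contra hne; exact h0 (entry_eq_zero ha hne)
      rw [hp, add_comm (par j), mul_comm p]
  have k1 : (if j.rev = s then a.1 r i.rev * tau j i else 0)
      = -(if j.rev = s then sgn (p * (par i + par j)) * a.1 i r.rev * tau j r.rev else 0) := by
    split_ifs with h
    · exact t1 h
    · simp
  have k2 : (if i.rev = r then sgn ((par r + par j) * (par j + par s)) * (tau j i * a.1 j.rev s)
      else 0) = -(if i.rev = r then a.1 s.rev j * tau s.rev i else 0) := by
    split_ifs with h
    · exact t2 h
    · simp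
  have k3 : (if j = r then sgn ((par r + par i) * (par i + par s)) * a.1 i s else 0)
      = (if j = r then sgn (p * (par i + par j)) * a.1 i s else 0) := by
    split_ifs with h
    · exact t3 h
    · rfl
  rw [k1, k2, k3]
  ring

/-! ### The subalgebra `V(p̄)` and the ideal -/

theorem sigGen_eq {n : ℕ} (m : ℕ) (a : osp n) :
    sig (gen m a) = sgn (1 + m) • (gen m (comp 0 a) - gen m (comp 1 a)) := by
  rw [sig, liftV_gen]; rfl

theorem gen_mem_Vp {n : ℕ} (m : ℕ) {a : osp n} (ha : a ∈ pNonpos n) : gen m a ∈ Vp n :=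
  Algebra.subset_adjoin ⟨m, a, ha, rfl⟩

theorem sig_mem_Vp {n : ℕ} {v : V n} (hv : v ∈ Vp n) : sig v ∈ Vp n := by
  induction hv using Algebra.adjoin_induction with
  | mem v hv =>
    obtain ⟨m, a, ha, rfl⟩ := hv
    rw [sigGen_eq]
    exact Subalgebra.smul_mem _ (sub_mem (gen_mem_Vp m (comp_mem_pNonpos 0 ha))
      (gen_mem_Vp m (comp_mem_pNonpos 1 ha))) _
  | algebraMap c => rw [AlgHom.commutes]; exact Subalgebra.algebraMap_mem _ c
  | add u v _ _ hu hv => rw [map_add]; exact add_mem hu hv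
  | mul u v _ _ hu hv => rw [map_mul]; exact mul_mem hu hv

theorem D_mem_Vp {n : ℕ} {v : V n} (hv : v ∈ Vp n) : D v ∈ Vp n := by
  induction hv using Algebra.adjoin_induction with
  | mem v hv =>
    obtain ⟨m, a, ha, rfl⟩ := hv
    rw [D_gen]
    exact gen_mem_Vp _ ha
  | algebraMap c => rw [D_algebraMap]; exact zero_mem _
  | add u v _ _ hu hv => rw [map_add]; exact add_mem hu hv
  | mul u v hu' hv' hu hv =>
    rw [D_mul]
    exact add_mem (mul_mem hu hv') (mul_mem (sig_mem_Vp hu') hv)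

theorem D_pow_mem_Vp {n : ℕ} (m : ℕ) {v : V n} (hv : v ∈ Vp n) :
    (D ^ m : Module.End ℂ (V n)) v ∈ Vp n := by
  induction m with
  | zero => simpa using hv
  | succ m ih => rw [pow_succ', Module.End.mul_apply]; exact D_mem_Vp ih

/-- The operator `P` preserves the series with coefficients in `V(p̄)`. -/
def PreservesVp {n : ℕ} (P : Module.End ℂ (Series n)) : Prop :=
  ∀ z : Series n, (∀ k, z.1 k ∈ Vp n) → ∀ k, (P z).1 k ∈ Vp n

theorem PreservesVp.add {n : ℕ} {P Q : Module.End ℂ (Series n)} (hP : PreservesVp P)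
    (hQ : PreservesVp Q) : PreservesVp (P + Q) :=
  fun z hz k => add_mem (hP z hz k) (hQ z hz k)

theorem PreservesVp.neg {n : ℕ} {P : Module.End ℂ (Series n)} (hP : PreservesVp P) :
    PreservesVp (-P) :=
  fun z hz k => neg_mem (hP z hz k)

theorem PreservesVp.mul {n : ℕ} {P Q : Module.End ℂ (Series n)} (hP : PreservesVp P)
    (hQ : PreservesVp Q) : PreservesVp (P * Q) :=
  fun z hz => hP _ (hQ z hz)

theorem PreservesVp.zero {n : ℕ} : PreservesVp (0 : Module.End ℂ (Series n)) :=
  fun _ _ _ => zero_mem _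

theorem PreservesVp.one {n : ℕ} : PreservesVp (1 : Module.End ℂ (Series n)) :=
  fun _ hz => hz

theorem PreservesVp.smul {n : ℕ} (c : ℂ) {P : Module.End ℂ (Series n)} (hP : PreservesVp P) :
    PreservesVp (c • P) :=
  fun z hz k => Subalgebra.smul_mem _ (hP z hz k) c

theorem preservesVp_mulOp {n : ℕ} {v : V n} (hv : v ∈ Vp n) : PreservesVp (mulOp v) :=
  fun _ hz k => mul_mem hv (hz k)

theorem preservesVp_dOp {n : ℕ} : PreservesVp (dOp : Module.End ℂ (Series n)) :=
  fun _ hz k => add_mem (D_mem_Vp (hz k)) (sig_mem_Vp (hz (k - 1)))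

theorem preservesVp_dInvOp {n : ℕ} : PreservesVp (dInvOp : Module.End ℂ (Series n)) := by
  intro z hz k
  rw [dInvOp_apply, dInvCoeff]
  refine finsum_induction (· ∈ Vp n) (zero_mem _) (fun _ _ => add_mem) fun m => ?_
  exact Subalgebra.smul_mem _ (add_mem (sig_mem_Vp (D_pow_mem_Vp _ (hz _)))
    (D_pow_mem_Vp _ (hz _))) _

theorem oneSeries_apply {n : ℕ} (j : ℤ) : (oneSeries n).1 j = if j = 0 then 1 else 0 := by
  simpa using dOp_pow_one (n := n) 0 j

theorem coeffD_mem_Vp {n : ℕ} {P : Module.End ℂ (Series n)} (hP : PreservesVp P) (k : ℤ) :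
    coeffD P k ∈ Vp n := by
  refine hP _ (fun j => ?_) k
  rw [oneSeries_apply]
  split_ifs
  · exact one_mem _
  · exact zero_mem _

/-! ### Entries and determinant coefficients lie in $\mathcal V(\bar{\mathfrak p})$. -/

theorem rowDet_induction {R : Type} [Ring R] {p : R → Prop} (h0 : p 0) (h1 : p 1)
    (hadd : ∀ a b, p a → p b → p (a + b)) (hneg : ∀ a, p a → p (-a))
    (hmul : ∀ a b, p a → p b → p (a * b)) {N : ℕ} {M : Matrix (Fin N) (Fin N) R}
    (h : ∀ i j, p (M i j)) : p (rowDet M) := by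
  refine Finset.sum_induction _ p hadd h0 fun σ _ => ?_
  have hprod : p (List.ofFn fun i => M i (σ i)).prod := by
    refine List.prod_induction p hmul h1 fun r hr => ?_
    obtain ⟨i, rfl⟩ := List.mem_ofFn.1 hr
    exact h _ _
  rcases Int.units_eq_one_or (Equiv.Perm.sign σ) with hs | hs <;> rw [hs]
  · simpa using hprod
  · simpa using hneg _ hprod

theorem preservesVp_rowDet {n N : ℕ} {M : Matrix (Fin N) (Fin N) (Module.End ℂ (Series n))}
    (h : ∀ i j, PreservesVp (M i j)) : PreservesVp (rowDet M) :=
  rowDet_induction (p := PreservesVp) PreservesVp.zero PreservesVp.one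
    (fun _ _ => PreservesVp.add) (fun _ => PreservesVp.neg) (fun _ _ => PreservesVp.mul) h

theorem Ebar_mem_Vp {n : ℕ} {i j : Fin (4 * n)} (h : i ≤ j) : Ebar j i ∈ Vp n := by
  refine gen_mem_Vp 0 (Submodule.smul_mem _ _ ?_)
  have := xw_anti h
  exact mem_pNonpos (by omega) (F_mem_gPiece j i)

theorem qEnt_mem_Vp {n : ℕ} (hn : 0 < n) (i j : Fin (4 * n)) : qEnt n hn i j ∈ Vp n := by
  rw [qEnt]
  refine sub_mem ?_ (Subalgebra.algebraMap_mem _ _)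
  split_ifs with h
  · exact Ebar_mem_Vp h
  · exact zero_mem _

theorem bEnt_mem_Vp {n : ℕ} (hn : 0 < n) (i j : Fin (4 * n)) : bEnt n hn i j ∈ Vp n := by
  rw [bEnt]
  refine add_mem (sub_mem (sub_mem (qEnt_mem_Vp hn i j) ?_) ?_) ?_ <;> split_ifs <;>
    first | exact qEnt_mem_Vp hn _ _ | exact zero_mem _

theorem preservesVp_matTilde {n : ℕ} (hn : 0 < n) (i j : Fin (4 * n)) :
    PreservesVp (matTilde n hn i j) := by
  rw [matTilde_apply]
  refine (PreservesVp.add ?_ ?_).add (preservesVp_mulOp (bEnt_mem_Vp hn i j))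
  · split_ifs
    · exact preservesVp_dOp
    · exact PreservesVp.zero
  · split_ifs
    · exact preservesVp_dOp.smul _
    · exact PreservesVp.zero

theorem preservesVp_matA {n : ℕ} (hn : 0 < n) (i j : Fin (4 * n + 1)) : PreservesVp (matA n hn i j) := by
  have h : ∀ i : Fin (4 * n + 1), i = ⟨2 * n, by omega⟩ ∨
      ∃ k : Fin (4 * n), (⟨2 * n, by omega⟩ : Fin (4 * n + 1)).succAbove k = i := by
    intro i
    by_cases hi : i = ⟨2 * n, by omega⟩
    · exact Or.inl hi
    · exact Or.inr (Fin.exists_succAbove_eq hi)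
  rcases h i with rfl | ⟨i, rfl⟩ <;> rcases h j with rfl | ⟨j, rfl⟩ <;> simp only [matA,
    Matrix.of_apply, Fin.insertNth_apply_same, Fin.insertNth_apply_succAbove]
  · exact preservesVp_dInvOp
  · exact PreservesVp.zero
  · exact PreservesVp.zero
  · exact preservesVp_matTilde hn i j

theorem w_mem_Vp {n : ℕ} (hn : 0 < n) (k : ℕ) : w n hn k ∈ Vp n :=
  coeffD_mem_Vp (preservesVp_rowDet (preservesVp_matA hn)) _

theorem wTilde_mem_Vp {n : ℕ} (hn : 0 < n) : wTilde n hn ∈ Vp n :=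
  coeffD_mem_Vp (preservesVp_rowDet fun _ _ => preservesVp_matTilde hn _ _) _

/-! ### The ideal `J` -/

theorem idealJ_gen {n : ℕ} (hn : 0 < n) (m : ℕ) {a : osp n} (ha : a ∈ nPos n) :
    (D ^ m : Module.End ℂ (V n)) (gen 0 a - algebraMap ℂ (V n) (form (f n hn) a)) ∈ idealJ n hn := by
  unfold idealJ
  apply Ideal.subset_span
  rw [Set.mem_ofPred_eq]
  exact ⟨m, a, ha, rfl⟩

theorem idealJ_gen_zero {n : ℕ} (hn : 0 < n) {a : osp n} (ha : a ∈ nPos n) :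
    gen 0 a - algebraMap ℂ (V n) (form (f n hn) a) ∈ idealJ n hn := by
  have h := idealJ_gen hn 0 ha
  rwa [pow_zero, Module.End.one_apply] at h

theorem D_pow_gen {n : ℕ} (m : ℕ) (a : osp n) :
    (D ^ m : Module.End ℂ (V n)) (gen 0 a) = gen m a := by
  induction m with
  | zero => rfl
  | succ m ih => rw [pow_succ', Module.End.mul_apply, ih, D_gen]

/-- The generators of the ideal with homogeneous `a` are homogeneous and supercommute. -/
theorem idealJ_gen_homogeneous {n : ℕ} (hn : 0 < n) (m : ℕ) {q : ZMod 2} {a : osp n}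
    (ha : comp q a = a) (v : V n) :
    sig ((D ^ m : Module.End ℂ (V n)) (gen 0 a - algebraMap ℂ (V n) (form (f n hn) a)))
        = sgn (q + 1 + m) •
          (D ^ m : Module.End ℂ (V n)) (gen 0 a - algebraMap ℂ (V n) (form (f n hn) a)) ∧
      (D ^ m : Module.End ℂ (V n)) (gen 0 a - algebraMap ℂ (V n) (form (f n hn) a)) * v
        = sigPow (q + 1 + m) v *
          (D ^ m : Module.End ℂ (V n)) (gen 0 a - algebraMap ℂ (V n) (form (f n hn) a)) := by
  by_cases hc : (D ^ m : Module.End ℂ (V n)) (algebraMap ℂ (V n) (form (f n hn) a)) = 0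
  · rw [map_sub, hc, sub_zero, D_pow_gen]
    exact ⟨sig_gen m ha, gen_mul m ha v⟩
  -- If the constant survives, no derivative was taken and $a$ is odd like $f$. Then $\bar a$ is
  -- even, and subtracting a scalar keeps the generator homogeneous.
  · have hm : m = 0 := by
      rcases m with _ | m
      · rfl
      · rw [pow_succ, Module.End.mul_apply, D_algebraMap, map_zero] at hc
        exact absurd rfl hc
    have hq : q = 1 := by
      by_contra hq
      rw [form_eq_zero (comp_f hn) ha (Ne.symm hq), map_zero, map_zero] at hc
      exact hc rfl
    subst hm hq
    have e : (1 + 1 + ((0 : ℕ) : ZMod 2)) = 0 := by simp; rfl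
    rw [e, sgn_zero, one_smul]
    have h1 := sig_gen 0 ha
    have h2 := gen_mul 0 ha v
    rw [e, sgn_zero, one_smul] at h1
    rw [e] at h2
    have hs : sigPow 0 v = v := by simp [sigPow]
    rw [hs] at h2 ⊢
    simp only [pow_zero, Module.End.one_apply]
    exact ⟨by rw [map_sub, h1, AlgHom.commutes],
      by rw [sub_mul, mul_sub, h2, Algebra.commutes]⟩

/-- An induction principle in which only homogeneous `a` must be treated: the even and odd parts of
an element of $\mathfrak n$ are again in $\mathfrak n$. -/
theorem idealJ_le {n : ℕ} (hn : 0 < n) {P : V n → Prop} (h0 : P 0)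
    (hadd : ∀ u v, P u → P v → P (u + v)) (hmul : ∀ u v, v ∈ idealJ n hn → P v → P (u * v))
    (hgen : ∀ (m : ℕ) (q : ZMod 2) (a : osp n), a ∈ nPos n → comp q a = a →
      P ((D ^ m : Module.End ℂ (V n)) (gen 0 a - algebraMap ℂ (V n) (form (f n hn) a))))
    {v : V n} (hv : v ∈ idealJ n hn) : P v := by
  refine Submodule.span_induction ?_ h0 (fun u v _ _ => hadd u v) (fun u v hv => hmul u v hv) hv
  rintro v ⟨m, a, ha, rfl⟩
  have h := hadd _ _ (hgen m 0 (comp 0 a) (comp_mem_nPos 0 ha) (by simp [comp_comp]))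
    (hgen m 1 (comp 1 a) (comp_mem_nPos 1 ha) (by simp [comp_comp]))
  rw [← map_add] at h
  have e : gen 0 (comp 0 a) - algebraMap ℂ (V n) (form (f n hn) (comp 0 a))
      + (gen 0 (comp 1 a) - algebraMap ℂ (V n) (form (f n hn) (comp 1 a)))
      = gen 0 a - algebraMap ℂ (V n) (form (f n hn) a) := by
    conv_rhs => rw [← comp_add_comp a]
    rw [map_add, map_add, map_add]; abel
  rwa [e] at h

theorem idealJ_mul_left {n : ℕ} (hn : 0 < n) (u : V n) {v : V n} (hv : v ∈ idealJ n hn) :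
    u * v ∈ idealJ n hn := Ideal.mul_mem_left _ u hv

theorem idealJ_smul {n : ℕ} (hn : 0 < n) (c : ℂ) {v : V n} (hv : v ∈ idealJ n hn) :
    c • v ∈ idealJ n hn := by
  rw [Algebra.smul_def]; exact idealJ_mul_left hn _ hv

theorem idealJ_sig {n : ℕ} (hn : 0 < n) {v : V n} (hv : v ∈ idealJ n hn) :
    sig v ∈ idealJ n hn := by
  refine idealJ_le hn (P := fun v => sig v ∈ idealJ n hn) ?_ ?_ ?_ ?_ hv
  · rw [map_zero]; exact zero_mem _
  · intro u v hu hv; rw [map_add]; exact add_mem hu hv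
  · intro u v _ hv; rw [map_mul]; exact idealJ_mul_left hn _ hv
  · intro m q a ha hq
    rw [(idealJ_gen_homogeneous hn m hq 1).1]
    exact idealJ_smul hn _ (idealJ_gen hn m ha)

theorem idealJ_D {n : ℕ} (hn : 0 < n) {v : V n} (hv : v ∈ idealJ n hn) : D v ∈ idealJ n hn := by
  refine idealJ_le hn (P := fun v => D v ∈ idealJ n hn) ?_ ?_ ?_ ?_ hv
  · rw [map_zero]; exact zero_mem _
  · intro u v hu hv; rw [map_add]; exact add_mem hu hv
  · intro u v hv hv'
    rw [D_mul]
    exact add_mem (idealJ_mul_left hn _ hv) (idealJ_mul_left hn _ hv')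
  · intro m q a ha _
    rw [← Module.End.mul_apply, ← pow_succ']
    exact idealJ_gen hn (m + 1) ha

theorem idealJ_mul_right {n : ℕ} (hn : 0 < n) {v : V n} (hv : v ∈ idealJ n hn) (u : V n) :
    v * u ∈ idealJ n hn := by
  refine idealJ_le hn (P := fun v => ∀ u, v * u ∈ idealJ n hn) ?_ ?_ ?_ ?_ hv u
  · intro u; rw [zero_mul]; exact zero_mem _
  · intro v v' hv hv' u; rw [add_mul]; exact add_mem (hv u) (hv' u)
  · intro v v' _ hv' u; rw [mul_assoc]; exact idealJ_mul_left hn _ (hv' u)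
  · intro m q a ha hq u
    rw [(idealJ_gen_homogeneous hn m hq u).2]
    exact idealJ_mul_left hn _ (idealJ_gen hn m ha)

/-! ### The matrix entries modulo the ideal. -/

theorem F_idx0_idx1 {n : ℕ} (hn : 0 < n) : F (idx0 n hn) (idx1 n hn) = 0 := by
  ext k l
  rw [F_apply, idx0_rev, idx1_rev, tau, par_idx0, par_idx1, del_idx0, del_idx1,
    show (0 * 0 + 0 + 1 + 0 + 0 : ZMod 2) = 1 from rfl, sgn_one]
  split_ifs <;> simp

/-- The weights decrease strictly, except for the two middle ones. -/
theorem xw_lt_or_eq {n : ℕ} (hn : 0 < n) {i j : Fin (4 * n)} (h : j < i) :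
    xw i < xw j ∨ j = idx0 n hn ∧ i = idx1 n hn := by
  have h' : (j : ℕ) < i := h
  by_cases h1 : (j : ℕ) = 2 * n - 1 ∧ (i : ℕ) = 2 * n
  · exact Or.inr ⟨Fin.ext h1.1, Fin.ext h1.2⟩
  · left
    unfold xw
    split_ifs <;> omega

theorem F_mem_nPos {n : ℕ} (hn : 0 < n) {i j : Fin (4 * n)} (h : j < i) : F j i ∈ nPos n := by
  rcases xw_lt_or_eq hn h with h | ⟨rfl, rfl⟩
  · exact mem_nPos (by omega) (F_mem_gPiece j i)
  · rw [F_idx0_idx1]; exact zero_mem _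

/-- Modulo the ideal, the entries $-f_{ij}$ below the diagonal may be replaced by $\bar E_{ji}$ with
$F_{ji}\in\mathfrak n$, so $Q$ becomes the full matrix of generators. The sign is right because $f$
is odd, which gives $(-1)^{p(i)+p(j)}=-1$ where $f_{ij}\ne0$. -/
theorem qEnt_sub_Ebar_mem {n : ℕ} (hn : 0 < n) (i j : Fin (4 * n)) :
    qEnt n hn i j - Ebar j i ∈ idealJ n hn := by
  rcases le_or_gt i j with h | h
  · rw [qEnt_of_le hn h, sub_self]; exact zero_mem _
  · have h1 := idealJ_gen_zero hn (Submodule.smul_mem (nPos n) (1 / 2 * sgn (par j))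
      (F_mem_nPos hn h))
    have h2 : form (f n hn) ((1 / 2 * sgn (par j)) • F j i) = -(f n hn).1 i j := by
      rw [map_smul, form_F, smul_eq_mul]
      by_cases h0 : (f n hn).1 i j = 0
      · rw [h0]; ring
      · have h3 := f_par hn h0
        have h4 : sgn (par i) * sgn (par j) = -1 := by rw [← sgn_add, h3, sgn_one]
        linear_combination (f n hn).1 i j * h4
    rw [h2, map_neg, sub_neg_eq_add] at h1
    rw [qEnt_of_lt hn h, ← neg_add', add_comm]
    exact neg_mem h1

/-! ### The coefficients of the bracket with a generator -/

theorem sigPow_add_one {n : ℕ} (r : ZMod 2) (v : V n) : sigPow (r + 1) v = sig (sigPow r v) := by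
  have hr : ∀ q : ZMod 2, q = 0 ∨ q = 1 := by decide
  rcases hr r with rfl | rfl
  · simp [sigPow]
  · simp [sigPow, sig_sig, show (1 + 1 : ZMod 2) = 0 from rfl]

theorem sigPow_sig {n : ℕ} (r : ZMod 2) (v : V n) : sigPow r (sig v) = sig (sigPow r v) := by
  have hr : ∀ q : ZMod 2, q = 0 ∨ q = 1 := by decide
  rcases hr r with rfl | rfl <;> simp [sigPow]

theorem sigPow_D {n : ℕ} (r : ZMod 2) (v : V n) : sigPow r (D v) = sgn r • D (sigPow r v) := by
  have hr : ∀ q : ZMod 2, q = 0 ∨ q = 1 := by decide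
  rcases hr r with rfl | rfl
  · simp [sigPow, sgn_zero]
  · simp [sigPow, sgn_one, sig_D]

/-- The coefficient of `χ^k` in `{ā_χ v}`, for `a` of parity `p`. -/
def chiCoeff {n : ℕ} (p : ZMod 2) (a : osp n) (ha : comp p a = a) (k : ℕ) : Module.End ℂ (V n) :=
  Finsupp.lapply k ∘ₗ chiBracketHom p a ha

theorem chiCoeff_apply {n : ℕ} (p : ZMod 2) (a : osp n) (ha : comp p a = a) (k : ℕ) (v : V n) :
    chiCoeff p a ha k v = chiBracketHom p a ha v k := rfl

theorem chiCoeff_gen {n : ℕ} (p : ZMod 2) (a : osp n) (ha : comp p a = a) (k m : ℕ) (b : osp n) :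
    chiCoeff p a ha k (gen m b) = chiGen p a m b k := by
  rw [chiCoeff_apply, chiBracketHom_gen]

theorem chiCoeff_mul {n : ℕ} (p : ZMod 2) (a : osp n) (ha : comp p a = a) (k : ℕ) (u v : V n) :
    chiCoeff p a ha k (u * v)
      = sigPow (p + k) u * chiCoeff p a ha k v + chiCoeff p a ha k u * v := by
  rw [chiCoeff_apply, chiBracketHom_mul, Finsupp.add_apply, chiLeft_apply, chiRight_apply]
  rfl

theorem chiCoeff_algebraMap {n : ℕ} (p : ZMod 2) (a : osp n) (ha : comp p a = a) (k : ℕ) (c : ℂ) :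
    chiCoeff p a ha k (algebraMap ℂ (V n) c) = 0 := by
  have h := chiCoeff_mul p a ha k 1 1
  rw [map_one, one_mul, one_mul, mul_one, left_eq_add] at h
  rw [Algebra.algebraMap_eq_smul_one, map_smul, h, smul_zero]

theorem chiCoeff_sig {n : ℕ} (p : ZMod 2) (a : osp n) (ha : comp p a = a) (k : ℕ) (v : V n) :
    chiCoeff p a ha k (sig v) = sgn (p + k) • sig (chiCoeff p a ha k v) := by
  induction v using V_induction with
  | h1 c => rw [AlgHom.commutes, chiCoeff_algebraMap, map_zero, smul_zero]
  | hgen m q b hb =>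
    rw [sig_gen m hb, map_smul, chiCoeff_gen, sig_chiGen ha hb, smul_smul, ← sgn_add]
    congr 2
    generalize p = r, q = s, (m : ZMod 2) = x, (k : ZMod 2) = y
    revert r s x y; decide
  | hmul u v hu hv =>
    rw [map_mul, chiCoeff_mul, hu, hv, chiCoeff_mul, map_add, map_mul, map_mul, sigPow_sig,
      smul_add, mul_smul_comm, smul_mul_assoc]
  | hadd u v hu hv => rw [map_add, map_add, hu, hv, map_add, map_add, smul_add]

/-- Sesquilinearity of the bracket, in terms of coefficients. -/
theorem chiCoeff_D {n : ℕ} (p : ZMod 2) (a : osp n) (ha : comp p a = a) (k : ℕ) (v : V n) :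
    chiCoeff p a ha k (D v)
      = sgn (p + k) • (D (chiCoeff p a ha k v) - chiMul (chiBracketHom p a ha v) k) := by
  induction v using V_induction with
  | h1 c =>
    have h0 : chiBracketHom p a ha (algebraMap ℂ (V n) c) = 0 :=
      Finsupp.ext fun k => chiCoeff_algebraMap p a ha k c
    rw [D_algebraMap, chiCoeff_algebraMap, h0, map_zero, map_zero, map_zero]
    simp
  | hgen m q b hb =>
    rw [D_gen, chiCoeff_gen, chiCoeff_gen, chiBracketHom_gen]
    simp only [chiGen, LinearMap.smul_apply, LinearMap.comp_apply, LinearMap.add_apply,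
      Finsupp.smul_apply, Finsupp.add_apply, chiD_apply]
    rw [sgn_add, mul_smul]
    congr 1
    module
  | hmul u v hu hv =>
    have hm : chiMul (chiBracketHom p a ha (u * v)) k
        = sigPow (p + k + 1) u * chiMul (chiBracketHom p a ha v) k
          + chiMul (chiBracketHom p a ha u) k * v := by
      rcases k with _ | k
      · simp only [chiMul_zero, mul_zero, zero_mul, add_zero]
      · have e : p + ((k + 1 : ℕ) : ZMod 2) + 1 = p + k := by
          push_cast
          generalize p = r, (k : ZMod 2) = x
          revert r x; decide
        rw [chiMul_succ, chiMul_succ, chiMul_succ, e]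
        exact chiCoeff_mul p a ha k u v
    rw [hm, D_mul, map_add, chiCoeff_mul, chiCoeff_mul, chiCoeff_mul, hu, hv, chiCoeff_sig,
      map_add, D_mul, D_mul, sigPow_D, sigPow_sig, sigPow_add_one]
    simp only [smul_sub, smul_add, mul_sub, sub_mul, smul_mul_assoc, mul_smul_comm]
    abel
  | hadd u v hu hv =>
    simp only [map_add, hu, hv, smul_sub, smul_add, Finsupp.add_apply]
    abel

theorem chiCoeff_zero_D {n : ℕ} (p : ZMod 2) (a : osp n) (ha : comp p a = a) (v : V n) :
    chiCoeff p a ha 0 (D v) = sgn p • D (chiCoeff p a ha 0 v) := by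
  rw [chiCoeff_D, chiMul_zero, sub_zero, Nat.cast_zero, add_zero]

theorem chiCoeff_succ_D {n : ℕ} (p : ZMod 2) (a : osp n) (ha : comp p a = a) (k : ℕ) (v : V n) :
    chiCoeff p a ha (k + 1) (D v) = sgn (p + (k + 1 : ℕ)) • D (chiCoeff p a ha (k + 1) v)
      + sgn (p + k) • chiCoeff p a ha k v := by
  rw [chiCoeff_D, chiMul_succ, smul_sub, sub_eq_add_neg, ← neg_smul]
  congr 2
  push_cast
  rw [← add_assoc, sgn_add _ 1, sgn_one]
  ring

theorem chiCoeff_gen_zero {n : ℕ} {p q : ZMod 2} {a b : osp n} (ha : comp p a = a)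
    (hb : comp q b = b) (k : ℕ) : chiCoeff p a ha k (gen 0 b)
      = if k = 0 then sgn (p * (q + 1)) • gen 0 (bracket a b)
        else if k = 1 then algebraMap ℂ (V n) (form a b) else 0 := by
  have e0 : chiGen p a 0 b = Finsupp.single 0 (sgn (p * (q + 1)) • gen 0 (bracket a b))
      + Finsupp.single 1 (algebraMap ℂ (V n) (form a b)) := by
    simp only [chiGen, LinearMap.add_apply, LinearMap.sum_apply, LinearMap.smul_apply,
      LinearMap.comp_apply, comp_self hb]
    rw [Finset.sum_eq_single q (fun q' _ h => by simp [h]) (by simp)]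
    simp
  rw [chiCoeff_gen, e0, Finsupp.add_apply, Finsupp.single_apply, Finsupp.single_apply]
  rcases k with _ | _ | k <;> simp

/-- The normalisation $\frac12(-1)^{p(j)}$ of $E_{ji}$ absorbs the sign between $F_{ki}$ and
$F_{ji}$, so that the matrix of all $\bar E_{ji}$ transforms by a supercommutator with $a$. -/
theorem chiCoeff_zero_Ebar {n : ℕ} {p : ZMod 2} {a : osp n} (ha : comp p a = a)
    (i j : Fin (4 * n)) : chiCoeff p a ha 0 (Ebar j i) = ∑ k,
      ((sgn (p * (par i + par j)) * a.1 k j) • Ebar k i - (sgn p * a.1 i k) • Ebar j k) := by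
  rw [Ebar, map_smul, map_smul, chiCoeff_gen_zero ha (comp_F j i), if_pos rfl, bracket_F ha,
    map_sum, Finset.smul_sum, Finset.smul_sum]
  refine Finset.sum_congr rfl fun k _ => ?_
  rw [map_sub, map_smul, map_smul, Ebar, Ebar, map_smul, map_smul, smul_sub, smul_sub,
    smul_smul, smul_smul, smul_smul, smul_smul, smul_smul, smul_smul]
  congr 2
  · by_cases h0 : a.1 k j = 0
    · rw [h0]; ring
    · have hp : par k + par j = p := by
        by_contra hne; exact h0 (entry_eq_zero ha hne)
      have h1 : sgn (par j) * sgn (p * (par j + par i + 1))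
          = sgn (p * (par i + par j)) * sgn (par k) := by
        rw [← sgn_add, ← sgn_add, ← hp]
        congr 1
        generalize par i = x, par j = y, par k = z
        revert x y z; decide
      linear_combination (1 / 2 * a.1 k j) * h1
  · have h1 : sgn (p * (par j + par i + 1)) * sgn (p * (par i + par j)) = sgn p := by
      rw [← sgn_add]
      congr 1
      generalize p = r, par i = x, par j = y
      revert r x y; decide
    linear_combination (1 / 2 * sgn (par j) * a.1 i k) * h1

/-- The central term is, up to a sign, the matrix $a$ itself: it plays the part of the derivative
term of a gauge transformation. -/
theorem chiCoeff_one_Ebar {n : ℕ} {p : ZMod 2} {a : osp n} (ha : comp p a = a)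
    (i j : Fin (4 * n)) :
    chiCoeff p a ha 1 (Ebar j i) = (sgn p * a.1 i j) • (1 : V n) := by
  rw [Ebar, map_smul, map_smul, chiCoeff_gen_zero ha (comp_F j i), if_neg one_ne_zero, if_pos rfl,
    form_F, Algebra.algebraMap_eq_smul_one, smul_smul]
  congr 1
  by_cases h0 : a.1 i j = 0
  · rw [h0]; ring
  · have hp : par i + par j = p := by
      by_contra hne; exact h0 (entry_eq_zero ha hne)
    rw [← hp, sgn_add]; ring

theorem chiCoeff_add_two_Ebar {n : ℕ} {p : ZMod 2} {a : osp n} (ha : comp p a = a)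
    (i j : Fin (4 * n)) (k : ℕ) : chiCoeff p a ha (k + 2) (Ebar j i) = 0 := by
  rw [Ebar, map_smul, map_smul, chiCoeff_gen_zero ha (comp_F j i), if_neg (by omega),
    if_neg (by omega), smul_zero]

theorem chiCoeff_one_qEnt {n : ℕ} (hn : 0 < n) {p : ZMod 2} {a : osp n} (ha : comp p a = a)
    (ha' : a ∈ nPos n) (i j : Fin (4 * n)) :
    chiCoeff p a ha 1 (qEnt n hn i j) = (sgn p * a.1 i j) • (1 : V n) := by
  rcases le_or_gt i j with h | h
  · rw [qEnt_of_le hn h, chiCoeff_one_Ebar]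
  · rw [qEnt_of_lt hn h, map_neg, chiCoeff_algebraMap,
      apply_eq_zero_of_mem_nPos ha' (xw_anti h.le)]
    simp

theorem chiCoeff_add_two_qEnt {n : ℕ} (hn : 0 < n) {p : ZMod 2} {a : osp n} (ha : comp p a = a)
    (i j : Fin (4 * n)) (k : ℕ) : chiCoeff p a ha (k + 2) (qEnt n hn i j) = 0 := by
  rcases le_or_gt i j with h | h
  · rw [qEnt_of_le hn h, chiCoeff_add_two_Ebar]
  · rw [qEnt_of_lt hn h, map_neg, chiCoeff_algebraMap, neg_zero]

/-- Modulo the ideal, the bracket acts on the matrix `qEnt` by supercommutators. -/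
theorem chiCoeff_zero_qEnt {n : ℕ} (hn : 0 < n) {p : ZMod 2} {a : osp n} (ha : comp p a = a)
    (ha' : a ∈ nPos n) (i j : Fin (4 * n)) : chiCoeff p a ha 0 (qEnt n hn i j) - ∑ k,
      ((sgn (p * (par i + par j)) * a.1 k j) • qEnt n hn i k - (sgn p * a.1 i k) • qEnt n hn k j)
        ∈ idealJ n hn := by
  -- Below the diagonal the difference is a constant minus $\bar E_{ji}$ with $F_{ji}\in\mathfrak
  -- n$, and its bracket is in the ideal because $[\mathfrak n,\mathfrak n]$ lies in $\mathfrak n$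
  -- and is orthogonal to $f$.
  have h1 : chiCoeff p a ha 0 (qEnt n hn i j - Ebar j i) ∈ idealJ n hn := by
    rcases le_or_gt i j with h | h
    · rw [qEnt_of_le hn h, sub_self, map_zero]; exact zero_mem _
    · have hb := bracket_mem_nPos hn ha' (F_mem_nPos hn h)
      have h2 := idealJ_gen_zero hn hb.1
      rw [show form (f n hn) (bracket a (F j i)) = 0 from hb.2, map_zero, sub_zero] at h2
      rw [qEnt_of_lt hn h, map_sub, map_neg, chiCoeff_algebraMap, neg_zero, zero_sub, Ebar,
        map_smul, map_smul, chiCoeff_gen_zero ha (comp_F j i), if_pos rfl]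
      exact neg_mem (idealJ_smul hn _ (idealJ_smul hn _ h2))
  have h2 : ∑ k, ((sgn (p * (par i + par j)) * a.1 k j) • (qEnt n hn i k - Ebar k i)
      - (sgn p * a.1 i k) • (qEnt n hn k j - Ebar j k)) ∈ idealJ n hn :=
    sum_mem fun k _ => sub_mem (idealJ_smul hn _ (qEnt_sub_Ebar_mem hn i k))
      (idealJ_smul hn _ (qEnt_sub_Ebar_mem hn k j))
  have h3 := sub_mem h1 h2
  rw [map_sub, chiCoeff_zero_Ebar] at h3
  simp only [smul_sub, Finset.sum_sub_distrib] at h3 ⊢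
  convert h3 using 1
  abel

/-- The coefficientwise action of `chiCoeff` on series. -/
def chiOp {n : ℕ} (p : ZMod 2) (a : osp n) (ha : comp p a = a) (k : ℕ) :
    Module.End ℂ (Series n) where
  toFun z := ⟨fun j => chiCoeff p a ha k (z.1 j), by
    obtain ⟨N, hN⟩ := z.2
    exact ⟨N, fun j hj => by simp only [hN j hj, map_zero]⟩⟩
  map_add' z z' := by ext j; simp
  map_smul' c z := by ext j; simp

theorem chiOp_apply {n : ℕ} (p : ZMod 2) (a : osp n) (ha : comp p a = a) (k : ℕ) (z : Series n)
    (j : ℤ) : (chiOp p a ha k z).1 j = chiCoeff p a ha k (z.1 j) := rfl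

theorem chiOp_mulOp {n : ℕ} (p : ZMod 2) (a : osp n) (ha : comp p a = a) (k : ℕ) (u : V n)
    (z : Series n) : chiOp p a ha k (mulOp u z)
      = mulOp (sigPow (p + k) u) (chiOp p a ha k z) + mulOp (chiCoeff p a ha k u) z := by
  ext j
  exact chiCoeff_mul p a ha k u (z.1 j)

theorem chiOp_zero_dOp {n : ℕ} (p : ZMod 2) (a : osp n) (ha : comp p a = a) (z : Series n) :
    chiOp p a ha 0 (dOp z) = sgn p • dOp (chiOp p a ha 0 z) := by
  ext j
  change chiCoeff p a ha 0 (D (z.1 j) + sig (z.1 (j - 1)))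
    = sgn p • (D (chiCoeff p a ha 0 (z.1 j)) + sig (chiCoeff p a ha 0 (z.1 (j - 1))))
  rw [map_add, chiCoeff_zero_D, chiCoeff_sig, Nat.cast_zero, add_zero, smul_add]

theorem chiOp_succ_dOp {n : ℕ} (p : ZMod 2) (a : osp n) (ha : comp p a = a) (k : ℕ)
    (z : Series n) : chiOp p a ha (k + 1) (dOp z)
      = sgn (p + (k + 1 : ℕ)) • dOp (chiOp p a ha (k + 1) z) + sgn (p + k) • chiOp p a ha k z := by
  ext j
  change chiCoeff p a ha (k + 1) (D (z.1 j) + sig (z.1 (j - 1)))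
    = sgn (p + (k + 1 : ℕ)) • (D (chiCoeff p a ha (k + 1) (z.1 j))
        + sig (chiCoeff p a ha (k + 1) (z.1 (j - 1)))) + sgn (p + k) • chiCoeff p a ha k (z.1 j)
  rw [map_add, chiCoeff_succ_D, chiCoeff_sig, smul_add]
  abel

/-! ### Gauge transformations -/

/-- A space of series that is stable under differential operators, and contains the products of the
elements of the ideal with all series. -/
structure IsStable {n : ℕ} (hn : 0 < n) (K : Submodule ℂ (Series n)) : Prop where
  mulOp_mem : ∀ (u : V n) (z : Series n), z ∈ K → mulOp u z ∈ K
  dOp_mem : ∀ z : Series n, z ∈ K → dOp z ∈ K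
  ideal_mem : ∀ u ∈ idealJ n hn, ∀ z : Series n, mulOp u z ∈ K

/-- The product of a matrix of operators and a vector of series. -/
def actOn {n : ℕ} (A : Matrix (Fin (4 * n)) (Fin (4 * n)) (Module.End ℂ (Series n)))
    (v : Fin (4 * n) → Series n) (i : Fin (4 * n)) : Series n := ∑ j, A i j (v j)

theorem matM_act {n : ℕ} (hn : 0 < n) (i j : Fin (4 * n)) (z : Series n) :
    matM n hn i j z = (if i = j then dOp z else 0) + mulOp (qEnt n hn i j) z := by
  rw [matM_apply, LinearMap.add_apply]
  congr 1
  split_ifs <;> rfl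

theorem IsStable.matM_mem {n : ℕ} {hn : 0 < n} {K : Submodule ℂ (Series n)} (hK : IsStable hn K)
    (i j : Fin (4 * n)) {z : Series n} (hz : z ∈ K) : matM n hn i j z ∈ K := by
  rw [matM_act]
  refine add_mem ?_ (hK.mulOp_mem _ _ hz)
  split_ifs
  · exact hK.dOp_mem _ hz
  · exact zero_mem _

theorem IsStable.matTilde_mem {n : ℕ} {hn : 0 < n} {K : Submodule ℂ (Series n)}
    (hK : IsStable hn K) (i j : Fin (4 * n)) {z : Series n} (hz : z ∈ K) :
    matTilde n hn i j z ∈ K := by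
  rw [matTilde_apply, LinearMap.add_apply, LinearMap.add_apply]
  refine add_mem (add_mem ?_ ?_) (hK.mulOp_mem _ _ hz)
  · split_ifs
    · exact hK.dOp_mem _ hz
    · exact zero_mem _
  · split_ifs
    · exact K.smul_mem _ (hK.dOp_mem _ hz)
    · exact zero_mem _

/-- The row and column operations relating `matM` and `matTilde`. -/
theorem matN_act {n : ℕ} (hn : 0 < n) {v v' : Fin (4 * n) → Series n}
    (hv : ∀ j, v' j = v j + if j = idx1 n hn then v (idx0 n hn) else 0) (i : Fin (4 * n)) :
    actOn (matN n hn) v' i = actOn (matM n hn) v i := by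
  have h : ∀ j, matM n hn i j
      = matN n hn i j + if j = idx0 n hn then matM n hn i (idx1 n hn) else 0 := by
    intro j
    rw [matN_apply]
    split_ifs with h
    · subst h
      exact (sub_add_cancel (matM n hn i (idx0 n hn)) (matM n hn i (idx1 n hn))).symm
    · exact (add_zero _).symm
  have h1 : matN n hn i (idx1 n hn) = matM n hn i (idx1 n hn) := by
    rw [matN_apply, if_neg (idx0_lt_idx1 hn).ne']
  have e1 : ∀ j, matN n hn i j (v' j) = matN n hn i j (v j)
      + if j = idx1 n hn then matN n hn i (idx1 n hn) (v (idx0 n hn)) else 0 := by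
    intro j
    rw [hv, map_add]
    congr 1
    split_ifs with h
    · rw [h]
    · exact map_zero _
  have e2 : ∀ j, matM n hn i j (v j) = matN n hn i j (v j)
      + if j = idx0 n hn then matM n hn i (idx1 n hn) (v (idx0 n hn)) else 0 := by
    intro j
    rw [h, LinearMap.add_apply]
    congr 1
    split_ifs with h
    · rw [h]
    · rfl
  rw [actOn, actOn, Finset.sum_congr rfl fun j _ => e1 j, Finset.sum_congr rfl fun j _ => e2 j,
    Finset.sum_add_distrib, Finset.sum_add_distrib, Finset.sum_ite_eq', Finset.sum_ite_eq',
    if_pos (Finset.mem_univ _), if_pos (Finset.mem_univ _), h1]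

theorem matTilde_act {n : ℕ} (hn : 0 < n) {v v' : Fin (4 * n) → Series n}
    (hv : ∀ j, v' j = v j + if j = idx1 n hn then v (idx0 n hn) else 0) (i : Fin (4 * n)) :
    actOn (matM n hn) v i = actOn (matTilde n hn) v' i
      + if i = idx1 n hn then actOn (matTilde n hn) v' (idx0 n hn) else 0 := by
  have h0 : actOn (matTilde n hn) v' (idx0 n hn) = actOn (matN n hn) v' (idx0 n hn) := by
    refine Finset.sum_congr rfl fun j _ => ?_
    rw [matTilde_apply', if_neg (idx0_lt_idx1 hn).ne]
  rw [← matN_act hn hv, h0]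
  split_ifs with h
  · rw [actOn, actOn, actOn, ← Finset.sum_add_distrib]
    refine Finset.sum_congr rfl fun j _ => ?_
    rw [matTilde_apply', if_pos h, ← LinearMap.add_apply, h]
    congr 1
    exact (sub_add_cancel (matN n hn (idx1 n hn) j) (matN n hn (idx0 n hn) j)).symm
  · rw [add_zero]
    refine Finset.sum_congr rfl fun j _ => ?_
    rw [matTilde_apply', if_neg h]

/-- The solutions of the homogeneous system are determined by their last entries. -/
theorem IsStable.mem_of_actOn_mem {n : ℕ} {hn : 0 < n} {K : Submodule ℂ (Series n)}
    (hK : IsStable hn K) {m : ℕ} (hm : m ≠ 2 * n)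
    (hd : 2 * n ≤ m → ∀ z : Series n, dOp z ∈ K → z ∈ K) {u : Fin (4 * n) → Series n}
    (hm' : m < 4 * n) (hu : ∀ j : Fin (4 * n), m ≤ j → u j ∈ K)
    (h : ∀ i : Fin (4 * n), (i : ℕ) ≠ 0 → actOn (matM n hn) u i ∈ K) (j : Fin (4 * n)) :
    u j ∈ K := by
  have v0 := idx0_val hn
  have v1 := idx1_val hn
  let u' : Fin (4 * n) → Series n := fun j => u j + if j = idx1 n hn then u (idx0 n hn) else 0
  -- Undoing the row operation adds the row of `idx0` to that of `idx1`. Since `idx0` is not the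
  -- first index, no unknown row is involved.
  have hB : ∀ i : Fin (4 * n), (i : ℕ) ≠ 0 → actOn (matTilde n hn) u' i ∈ K := by
    have h1 : ∀ i : Fin (4 * n), i ≠ idx1 n hn → (i : ℕ) ≠ 0 → actOn (matTilde n hn) u' i ∈ K := by
      intro i hi hi0
      have := h i hi0
      rwa [matTilde_act hn (v' := u') (fun _ => rfl), if_neg hi, add_zero] at this
    intro i hi0
    by_cases hi : i = idx1 n hn
    · have := h i hi0
      rwa [matTilde_act hn (v' := u') (fun _ => rfl), if_pos hi,
        K.add_mem_iff_left (h1 _ (idx0_lt_idx1 hn).ne (by omega))] at this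
    · exact h1 i hi hi0
  -- Back substitution from the bottom: row `j + 1` of `matTilde` contains, besides its subdiagonal
  -- entry in column `j`, only columns that are already settled.
  have key : ∀ d : ℕ, ∀ j : Fin (4 * n), 4 * n - 1 - d ≤ (j : ℕ) → u' j ∈ K := by
    intro d
    induction d with
    | zero =>
      intro j hj
      have hj' := j.isLt
      refine add_mem (hu j (by omega)) ?_
      rw [if_neg (fun e => by rw [e] at hj; omega)]
      exact zero_mem _
    | succ d ih =>
      intro j hj
      have hj' := j.isLt
      by_cases hjm : m ≤ (j : ℕ)
      · refine add_mem (hu j hjm) ?_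
        split_ifs with e
        · rw [e] at hjm; exact hu _ (by omega)
        · exact zero_mem _
      by_cases hjd : 4 * n - 1 - d ≤ (j : ℕ)
      · exact ih j hjd
      have hlt : (j : ℕ) + 1 < 4 * n := by omega
      have h1 := hB ⟨j + 1, hlt⟩ (by simp)
      rw [actOn, ← Finset.add_sum_erase _ _ (Finset.mem_univ j), K.add_mem_iff_left] at h1
      · rw [← tildeN_val, tildeN_of_lt hn (by simp), if_pos hlt] at h1
        have h2 : ∀ c : ℂ, c ≠ 0 → ∀ z : Series n, c • z ∈ K → z ∈ K :=
          fun c hc z hz => (K.smul_mem_iff hc).1 hz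
        split_ifs at h1 with e e'
        -- The entry $-2D$: here `j = 2 * n - 1 < m`, so the cancellation of $D$ is available
        -- through `hd`.
        · exact hd (by omega) _ (h2 _ (by norm_num) _ h1)
        · rw [Module.algebraMap_end_apply] at h1
          refine h2 _ ?_ _ h1
          unfold subC
          split_ifs <;> simp
        · exact absurd rfl e'
      · refine sum_mem fun l hl => ?_
        by_cases hlj : (j : ℕ) < l
        · exact hK.matTilde_mem _ _ (ih l (by omega))
        · have hne : (l : ℕ) ≠ j := fun e => Finset.ne_of_mem_erase hl (Fin.ext e)
          rw [← tildeN_val, tildeN_of_lt hn (by simp; omega), if_pos hlt, if_neg (by simp; omega),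
            if_neg (by simp; omega)]
          exact zero_mem _
  have key' : ∀ j, u' j ∈ K := fun j => key (4 * n) j (by omega)
  have h0 : u (idx0 n hn) ∈ K := by
    have := key' (idx0 n hn)
    simpa only [u', if_neg (idx0_lt_idx1 hn).ne, add_zero] using this
  have h1 := key' j
  have h2 : (if j = idx1 n hn then u (idx0 n hn) else 0) ∈ K := by
    split_ifs
    · exact h0
    · exact zero_mem _
  exact (K.add_mem_iff_left h2).1 h1

/-- The order zero part of the entry $(i,j)$ has parity $p(i)+p(j)+1$, and so has $D$ on the
diagonal; hence a common sign. The middle term is the $\chi$ that sesquilinearity attaches to $D$.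
-/
theorem chiOp_matM {n : ℕ} (hn : 0 < n) {p : ZMod 2} {a : osp n} (ha : comp p a = a) (k : ℕ)
    (i j : Fin (4 * n)) (z : Series n) : chiOp p a ha k (matM n hn i j z)
      = sgn ((p + k) * (par i + par j + 1)) • matM n hn i j (chiOp p a ha k z)
        + (if i = j then (if k = 0 then 0 else sgn (p + (k - 1 : ℕ)) • chiOp p a ha (k - 1) z) else 0)
        + mulOp (chiCoeff p a ha k (qEnt n hn i j)) z := by
  have e : ∀ x : ZMod 2, x + x + 1 = 1 := by decide
  rw [matM_act, matM_act, map_add, chiOp_mulOp, sigPow_sgn_smul _ _ (sig_qEnt hn i j), mulOp_smul,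
    LinearMap.smul_apply, smul_add]
  have h : chiOp p a ha k (if i = j then dOp z else 0)
      = sgn ((p + k) * (par i + par j + 1)) • (if i = j then dOp (chiOp p a ha k z) else 0)
        + (if i = j then (if k = 0 then 0 else sgn (p + (k - 1 : ℕ)) • chiOp p a ha (k - 1) z)
            else 0) := by
    split_ifs with h h0
    · subst h h0
      rw [chiOp_zero_dOp, e, Nat.cast_zero, add_zero, mul_one, add_zero]
    · obtain ⟨k, rfl⟩ : ∃ l, k = l + 1 := ⟨k - 1, by omega⟩
      subst h
      rw [chiOp_succ_dOp, e, mul_one, Nat.add_sub_cancel]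
    · rw [map_zero, smul_zero, add_zero]
  rw [h]
  abel

/-- The infinitesimal gauge transformation of a vector of series. -/
def gaugeVec {n : ℕ} (p : ZMod 2) (a : osp n) (ha : comp p a = a) (v : Fin (4 * n) → Series n)
    (k : ℕ) (j : Fin (4 * n)) : Series n :=
  chiOp p a ha k (v j) + if k = 0 then ∑ l, a.1 j l • v l else 0

/-- The twisted action of `matM`. -/
def twistAct {n : ℕ} (hn : 0 < n) (r : ZMod 2) (u : Fin (4 * n) → Series n) (i : Fin (4 * n)) :
    Series n := ∑ j, sgn (r * (par i + par j + 1)) • matM n hn i j (u j)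

/-- The twisting sign splits into a row sign and a column sign, so the twisted system is equivalent
to the untwisted one after rescaling the unknowns. -/
theorem twistAct_eq {n : ℕ} (hn : 0 < n) (r : ZMod 2) (u : Fin (4 * n) → Series n)
    (i : Fin (4 * n)) : twistAct hn r u i
      = sgn (r * (par i + 1)) • actOn (matM n hn) (fun j => sgn (r * par j) • u j) i := by
  rw [twistAct, actOn, Finset.smul_sum]
  refine Finset.sum_congr rfl fun j _ => ?_
  rw [map_smul, smul_smul, ← sgn_add]
  congr 2
  ring

/-- The $\chi$ attached to $D$ contributes the variation of $v_i$ one degree lower; for `k = 0` the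
$\chi$-linear part of the bracket with $Q$ adds $(av)_i$, and the two combine to the gauge vector of
degree `k`. -/
theorem chiOp_succ_actOn {n : ℕ} (hn : 0 < n) {p : ZMod 2} {a : osp n} (ha : comp p a = a)
    (ha' : a ∈ nPos n) (v : Fin (4 * n) → Series n) (k : ℕ) (i : Fin (4 * n)) :
    chiOp p a ha (k + 1) (actOn (matM n hn) v i)
      = twistAct hn (p + (k + 1 : ℕ)) (gaugeVec p a ha v (k + 1)) i
        + sgn (p + k) • gaugeVec p a ha v k i := by
  have h0 : ∀ j, gaugeVec p a ha v (k + 1) j = chiOp p a ha (k + 1) (v j) := by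
    intro j; rw [gaugeVec, if_neg (Nat.succ_ne_zero k), add_zero]
  have h1 : ∑ j, mulOp (chiCoeff p a ha (k + 1) (qEnt n hn i j)) (v j)
      = sgn (p + k) • if k = 0 then ∑ l, a.1 i l • v l else 0 := by
    rcases k with _ | k
    · rw [if_pos rfl, Finset.smul_sum]
      refine Finset.sum_congr rfl fun j _ => ?_
      rw [chiCoeff_one_qEnt hn ha ha', mulOp_smul, mulOp_one, LinearMap.smul_apply,
        Module.End.one_apply, smul_smul, Nat.cast_zero, add_zero]
    · rw [if_neg (Nat.succ_ne_zero k), smul_zero]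
      refine Finset.sum_eq_zero fun j _ => ?_
      rw [chiCoeff_add_two_qEnt hn ha, mulOp_zero, LinearMap.zero_apply]
  rw [actOn, map_sum, Finset.sum_congr rfl fun j _ => chiOp_matM hn ha (k + 1) i j (v j),
    Finset.sum_add_distrib, Finset.sum_add_distrib, h1, Finset.sum_ite_eq,
    if_pos (Finset.mem_univ _), if_neg (Nat.succ_ne_zero k), Nat.add_sub_cancel, twistAct,
    gaugeVec, smul_add, add_assoc]
  simp only [h0]

/-- Gauge covariance in $\chi$-degree zero: the supercommutator $\pm Qa\pm aQ$ distributes its first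
part to the variation of $v$ and its second to $a(Mv)$. The error comes from the entries of $Q$,
which transform only modulo the ideal. -/
theorem IsStable.chiOp_zero_actOn {n : ℕ} {hn : 0 < n} {K : Submodule ℂ (Series n)}
    (hK : IsStable hn K) {p : ZMod 2} {a : osp n} (ha : comp p a = a)
    (ha' : a ∈ nPos n) (v : Fin (4 * n) → Series n) (i : Fin (4 * n)) :
    ∃ r ∈ K, chiOp p a ha 0 (actOn (matM n hn) v i)
        + sgn p • ∑ k, a.1 i k • actOn (matM n hn) v k
      = twistAct hn p (gaugeVec p a ha v 0) i + r := by
  have hJ := fun j => chiCoeff_zero_qEnt hn ha ha' i j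
  choose e he using fun j => show ∃ e : V n, e = chiCoeff p a ha 0 (qEnt n hn i j) - ∑ k,
      ((sgn (p * (par i + par j)) * a.1 k j) • qEnt n hn i k - (sgn p * a.1 i k) • qEnt n hn k j)
    from ⟨_, rfl⟩
  have he' : ∀ j, e j ∈ idealJ n hn := fun j => by rw [he]; exact hJ j
  refine ⟨∑ j, mulOp (e j) (v j), sum_mem fun j _ => hK.ideal_mem _ (he' j) _, ?_⟩
  have h1 : ∀ j, mulOp (chiCoeff p a ha 0 (qEnt n hn i j)) (v j)
      + ∑ k, (sgn p * a.1 i k) • mulOp (qEnt n hn k j) (v j)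
      = ∑ k, (sgn (p * (par i + par k + 1)) * a.1 k j) • mulOp (qEnt n hn i k) (v j)
        + mulOp (e j) (v j) := by
    intro j
    ext s
    simp only [Submodule.coe_add, Pi.add_apply, Submodule.coe_sum, Finset.sum_apply,
      Submodule.coe_smul, Pi.smul_apply, mulOp_apply]
    rw [he, sub_mul, Finset.sum_sub_distrib, sub_mul, Finset.sum_mul, Finset.sum_mul]
    have e1 : ∀ k, (sgn (p * (par i + par k + 1)) * a.1 k j) • (qEnt n hn i k * (v j).1 s)
        = (sgn (p * (par i + par j)) * a.1 k j) • qEnt n hn i k * (v j).1 s := by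
      intro k
      rw [smul_mul_assoc]
      congr 1
      by_cases h0 : a.1 k j = 0
      · rw [h0, mul_zero, mul_zero]
      · have hp : par k + par j = p := by
          by_contra hne; exact h0 (entry_eq_zero ha hne)
        rw [← hp]
        congr 2
        generalize par i = x, par j = y, par k = z
        revert x y z; decide
    have e2 : ∀ k, (sgn p * a.1 i k) • (qEnt n hn k j * (v j).1 s)
        = (sgn p * a.1 i k) • qEnt n hn k j * (v j).1 s := fun k => (smul_mul_assoc _ _ _).symm
    rw [Finset.sum_congr rfl fun k _ => e1 k, Finset.sum_congr rfl fun k _ => e2 k]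
    abel
  have hz : ∀ x : ZMod 2, p * (x + x + 1) = p := by
    generalize p = p
    revert p; decide
  have h2 : sgn p • ∑ k, a.1 i k • actOn (matM n hn) v k
      = sgn p • ∑ k, a.1 i k • dOp (v k)
        + ∑ j, ∑ k, (sgn p * a.1 i k) • mulOp (qEnt n hn k j) (v j) := by
    rw [Finset.sum_comm, Finset.smul_sum, Finset.smul_sum, ← Finset.sum_add_distrib]
    refine Finset.sum_congr rfl fun k _ => ?_
    rw [actOn, Finset.sum_congr rfl fun j _ => matM_act hn k j (v j), Finset.sum_add_distrib,
      Finset.sum_ite_eq, if_pos (Finset.mem_univ _), smul_add, smul_add, ← Finset.smul_sum,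
      mul_smul]
  have h3 : ∑ j, sgn (p * (par i + par j + 1)) • matM n hn i j (∑ l, a.1 j l • v l)
      = sgn p • ∑ k, a.1 i k • dOp (v k) + ∑ j, ∑ k,
        (sgn (p * (par i + par k + 1)) * a.1 k j) • mulOp (qEnt n hn i k) (v j) := by
    have e1 : ∀ j, sgn (p * (par i + par j + 1)) • matM n hn i j (∑ l, a.1 j l • v l)
        = (if i = j then sgn p • ∑ k, a.1 i k • dOp (v k) else 0)
          + ∑ l, (sgn (p * (par i + par j + 1)) * a.1 j l) • mulOp (qEnt n hn i j) (v l) := by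
      intro j
      rw [matM_act, smul_add]
      congr 1
      · split_ifs with h
        · subst h
          rw [hz, map_sum]
          simp only [map_smul]
        · exact smul_zero _
      · rw [map_sum, Finset.smul_sum]
        simp only [map_smul, smul_smul]
    rw [Finset.sum_congr rfl fun j _ => e1 j, Finset.sum_add_distrib, Finset.sum_ite_eq,
      if_pos (Finset.mem_univ _), Finset.sum_comm]
  have h4 : ∀ j, chiOp p a ha 0 (matM n hn i j (v j))
      = sgn (p * (par i + par j + 1)) • matM n hn i j (chiOp p a ha 0 (v j))
        + mulOp (chiCoeff p a ha 0 (qEnt n hn i j)) (v j) := by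
    intro j
    rw [chiOp_matM, if_pos rfl, ite_self, add_zero, Nat.cast_zero, add_zero]
  have h5 : twistAct hn p (gaugeVec p a ha v 0) i
      = ∑ j, sgn (p * (par i + par j + 1)) • matM n hn i j (chiOp p a ha 0 (v j))
        + ∑ j, sgn (p * (par i + par j + 1)) • matM n hn i j (∑ l, a.1 j l • v l) := by
    rw [← Finset.sum_add_distrib, twistAct]
    refine Finset.sum_congr rfl fun j _ => ?_
    rw [gaugeVec, if_pos rfl, map_add, smul_add]
  have h6 : ∑ j, mulOp (chiCoeff p a ha 0 (qEnt n hn i j)) (v j)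
      + ∑ j, ∑ k, (sgn p * a.1 i k) • mulOp (qEnt n hn k j) (v j)
      = ∑ j, ∑ k, (sgn (p * (par i + par k + 1)) * a.1 k j) • mulOp (qEnt n hn i k) (v j)
        + ∑ j, mulOp (e j) (v j) := by
    rw [← Finset.sum_add_distrib, ← Finset.sum_add_distrib]
    exact Finset.sum_congr rfl fun j _ => h1 j
  rw [h5, h3, h2, actOn, map_sum, Finset.sum_congr rfl fun j _ => h4 j, Finset.sum_add_distrib]
  rw [add_assoc, add_left_comm (∑ j, mulOp _ _), h6, add_assoc, add_assoc]

/-- If a vector solves the system given by `matM`, up to its first row, then the first row is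
annihilated by the brackets. -/
theorem IsStable.chiOp_mem {n : ℕ} {hn : 0 < n} {K : Submodule ℂ (Series n)}
    (hK : IsStable hn K) {m : ℕ} (hm : m ≠ 2 * n) (hm' : m < 4 * n)
    (hd : 2 * n ≤ m → ∀ z : Series n, dOp z ∈ K → z ∈ K) {p : ZMod 2} {a : osp n}
    (ha : comp p a = a) (ha' : a ∈ nPos n) {v : Fin (4 * n) → Series n}
    (hv : ∀ (k : ℕ) (j : Fin (4 * n)), m ≤ j → gaugeVec p a ha v k j ∈ K)
    (h0 : ∀ i : Fin (4 * n), (i : ℕ) ≠ 0 → actOn (matM n hn) v i ∈ K)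
    (h1 : ∀ (k : ℕ) (i : Fin (4 * n)), (i : ℕ) ≠ 0 →
      chiOp p a ha k (actOn (matM n hn) v i) ∈ K) (k : ℕ) :
    chiOp p a ha k (actOn (matM n hn) v ⟨0, by omega⟩) ∈ K := by
  have hs : ∀ q, sgn q ≠ 0 := by intro q; unfold sgn; split_ifs <;> simp
  -- Row and column signs are invertible, so the uniqueness for the untwisted system applies.
  have hsolve : ∀ (r : ZMod 2) (k : ℕ),
      (∀ i : Fin (4 * n), (i : ℕ) ≠ 0 → twistAct hn r (gaugeVec p a ha v k) i ∈ K) →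
      ∀ j, gaugeVec p a ha v k j ∈ K := by
    intro r k h j
    have h2 := hK.mem_of_actOn_mem hm hd (u := fun j => sgn (r * par j) • gaugeVec p a ha v k j) hm'
      (fun j hj => K.smul_mem _ (hv k j hj)) (fun i hi => by
        have h3 := h i hi
        rwa [twistAct_eq, K.smul_mem_iff (hs _)] at h3) j
    exact (K.smul_mem_iff (hs _)).1 h2
  have htwist : ∀ (r : ZMod 2) (k : ℕ), (∀ j, gaugeVec p a ha v k j ∈ K) →
      ∀ i, twistAct hn r (gaugeVec p a ha v k) i ∈ K :=
    fun r k h i => sum_mem fun j _ => K.smul_mem _ (hK.matM_mem _ _ (h j))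
  -- Row by row, $a(Mv)$ avoids the unknown first entry of $Mv$ because the first column of $a$
  -- vanishes.
  have hrest : ∀ i, sgn p • ∑ k, a.1 i k • actOn (matM n hn) v k ∈ K := by
    intro i
    refine K.smul_mem _ (sum_mem fun k _ => ?_)
    by_cases hk : (k : ℕ) = 0
    · rw [apply_eq_zero_of_mem_nPos ha' (xw_anti (by rw [Fin.le_def, hk]; omega)), zero_smul]
      exact zero_mem _
    · exact K.smul_mem _ (h0 k hk)
  have base : ∀ j, gaugeVec p a ha v 0 j ∈ K := by
    refine hsolve p 0 fun i hi => ?_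
    obtain ⟨r, hr, e⟩ := hK.chiOp_zero_actOn ha ha' v i
    have h2 := add_mem (h1 0 i hi) (hrest i)
    rwa [e, K.add_mem_iff_left hr] at h2
  have step : ∀ k, ∀ j, gaugeVec p a ha v k j ∈ K := by
    intro k
    induction k with
    | zero => exact base
    | succ k ih =>
      refine hsolve (p + (k + 1 : ℕ)) (k + 1) fun i hi => ?_
      have h2 := h1 (k + 1) i hi
      rwa [chiOp_succ_actOn hn ha ha', K.add_mem_iff_left (K.smul_mem _ (ih i))] at h2
  rcases k with _ | k
  · obtain ⟨r, hr, e⟩ := hK.chiOp_zero_actOn ha ha' v ⟨0, by omega⟩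
    have h2 := add_mem (htwist p 0 base ⟨0, by omega⟩) hr
    rwa [← e, K.add_mem_iff_left (hrest _)] at h2
  · rw [chiOp_succ_actOn hn ha ha']
    exact add_mem (htwist _ _ (step _) _) (K.smul_mem _ (step k _))

/-! ### The solutions given by the row determinants -/

/-- The kernel vector of a Hessenberg matrix without its first row. -/
def hessVec {R : Type} [Ring R] [Algebra ℂ R] (H : ℕ → ℕ → R) (c : ℕ → ℂ) (N m : ℕ) : R :=
  (∏ l ∈ Finset.range m, -c l) • lowSeq (hessG H c) N (m + 1)

/-- The entries of `hessVec` are the cofactors of the first row. In row `i + 1` the subdiagonal term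
cancels the recursion for the minor starting at `i + 1`. -/
theorem sum_mul_hessVec {R : Type} [Ring R] [Algebra ℂ R] {N : ℕ} {H : ℕ → ℕ → R} {c : ℕ → ℂ}
    (h0 : ∀ i j, j + 1 < i → i < N → H i j = 0)
    (h1 : ∀ j, j + 1 < N → H (j + 1) j = algebraMap ℂ R (c j)) {i : ℕ} (hi : i < N) :
    ∑ m ∈ Finset.range N, H i m * hessVec H c N m = if i = 0 then lowSeq (hessG H c) N 0 else 0 := by
  have key : ∑ m ∈ Finset.Ico i N, H i m * hessVec H c N m
      = (∏ l ∈ Finset.range i, -c l) • lowSeq (hessG H c) N i := by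
    rw [lowSeq_eq _ hi, ← Finset.sum_Ico_add' _ i N 1, Finset.smul_sum]
    refine Finset.sum_congr rfl fun m hm => ?_
    rw [Finset.mem_Ico] at hm
    rw [hessVec, hessG, Nat.add_sub_cancel, mul_smul_comm, smul_mul_assoc, smul_smul,
      Finset.prod_range_mul_prod_Ico _ hm.1]
  rw [Finset.range_eq_Ico, ← Finset.sum_Ico_consecutive _ (Nat.zero_le i) hi.le, key]
  rcases i with _ | i
  · simp
  · rw [Finset.sum_Ico_succ_top (Nat.zero_le i), Finset.sum_eq_zero, h1 i hi, hessVec,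
      Finset.prod_range_succ, if_neg (Nat.succ_ne_zero i), zero_add, ← Algebra.smul_def, smul_smul,
      ← add_smul, mul_neg, mul_comm, add_neg_cancel, zero_smul]
    intro m hm
    rw [Finset.mem_Ico] at hm
    rw [h0 _ _ (by omega) hi, zero_mul]

theorem scaledN_of_lt {n : ℕ} (hn : 0 < n) {i j : ℕ} (h : j < i) (hi : i < 4 * n) :
    scaledN n hn i j = if i = j + 1 then algebraMap ℂ _ (subC n j) else 0 := by
  rw [scaledN, tildeN_of_lt hn h, if_pos hi]
  by_cases h2 : i = 2 * n
  · rw [if_pos h2]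
    by_cases hj : i = j + 1
    · rw [if_pos ⟨h2, by omega⟩, if_pos hj, mul_smul_comm, dInvOp_mul_dOp,
        Algebra.algebraMap_eq_smul_one, subC, if_neg (by omega), if_pos (by omega)]
    · rw [if_neg (by omega), if_neg hj, mul_zero]
  · rw [if_neg h2, if_neg (fun e => h2 e.1)]

/-- The cofactors of the scaled matrix also solve the system for `matTilde`: the two differ only in
the middle row, where the right-hand side is zero and $D$ can be multiplied back. -/
theorem sum_tildeN_mul_hessVec {n : ℕ} (hn : 0 < n) {i : ℕ} (hi : i < 4 * n) :
    ∑ m ∈ Finset.range (4 * n), tildeN n hn i m * hessVec (scaledN n hn) (subC n) (4 * n) m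
      = if i = 0 then rowDet (matA n hn) else 0 := by
  have h := sum_mul_hessVec (N := 4 * n) (H := scaledN n hn) (c := subC n)
    (fun i j hj hi => by rw [scaledN_of_lt hn (by omega) hi, if_neg (by omega)])
    (fun j hj => by rw [scaledN_of_lt hn (by omega) hj, if_pos rfl]) hi
  rw [rowDet_matA, ← h]
  by_cases h2 : i = 2 * n
  · rw [if_neg (by omega : i ≠ 0)] at h
    simp only [scaledN, if_pos h2, mul_assoc] at h ⊢
    rw [← Finset.mul_sum] at h ⊢
    have h3 : dOp * (dInvOp * _) = dOp * 0 := congrArg (dOp * ·) h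
    rw [← mul_assoc, dOp_mul_dInvOp, one_mul, mul_zero] at h3
    rw [h3, mul_zero]
  · simp only [scaledN, if_neg h2]

/-- The block cofactors, extended by zero, fail to solve the system below the block only in the
middle row. There $-2D$ meets the last cofactor, a scalar, and leaves a multiple of $D$. -/
theorem sum_tildeN_mul_hessVec_half {n : ℕ} (hn : 0 < n) {i : ℕ} (hi : i < 4 * n) :
    ∃ c : ℂ, ∑ m ∈ Finset.range (2 * n), tildeN n hn i m * hessVec (tildeN n hn) (subC n) (2 * n) m
      = (if i = 0 then detA2n n hn else 0) + c • dOp := by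
  by_cases h2 : i < 2 * n
  · refine ⟨0, ?_⟩
    rw [sum_mul_hessVec _ _ h2, zero_smul, add_zero, detA2n_eq]
    · intro i j hj hi
      rw [tildeN_of_lt hn (by omega), if_pos (by omega), if_neg (by omega), if_neg (by omega)]
    · intro j hj
      rw [tildeN_of_lt hn (by omega), if_pos (by omega), if_neg (by omega), if_pos rfl]
  · rw [if_neg (by omega)]
    have h3 : ∀ m, m < 2 * n → tildeN n hn i m
        = if m = 2 * n - 1 then (if i = 2 * n then (-2 : ℂ) else 0) • dOp else 0 := by
      intro m hm
      rw [tildeN_of_lt hn (by omega), if_pos hi]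
      by_cases hm' : m = 2 * n - 1
      · by_cases hi' : i = 2 * n
        · rw [if_pos ⟨hi', hm'⟩, if_pos hm', if_pos hi']
        · rw [if_neg (by omega), if_neg (by omega), if_pos hm', if_neg hi', zero_smul]
      · rw [if_neg (by omega), if_neg (by omega), if_neg hm']
    refine ⟨(if i = 2 * n then (-2 : ℂ) else 0) * ∏ l ∈ Finset.range (2 * n - 1), -subC n l, ?_⟩
    rw [Finset.sum_eq_single (2 * n - 1)]
    · rw [h3 _ (by omega), if_pos rfl, hessVec, show 2 * n - 1 + 1 = 2 * n by omega, lowSeq_self,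
        smul_mul_assoc, mul_smul_comm, mul_one, smul_smul, zero_add]
    · intro m hm hm'
      rw [h3 m (Finset.mem_range.1 hm), if_neg hm', zero_mul]
    · intro h; simp at h; omega

theorem chiOp_eq_zero {n : ℕ} {p : ZMod 2} {a : osp n} (ha : comp p a = a) (k : ℕ) {z : Series n}
    (h : ∀ j, ∃ c : ℂ, z.1 j = algebraMap ℂ (V n) c) : chiOp p a ha k z = 0 := by
  ext j
  obtain ⟨c, hc⟩ := h j
  rw [chiOp_apply, hc, chiCoeff_algebraMap]
  rfl

theorem chiOp_smul_one {n : ℕ} {p : ZMod 2} {a : osp n} (ha : comp p a = a) (k : ℕ) (c : ℂ) :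
    chiOp p a ha k (c • oneSeries n) = 0 := by
  refine chiOp_eq_zero ha k fun j => ⟨if j = 0 then c else 0, ?_⟩
  rw [Submodule.coe_smul, Pi.smul_apply, oneSeries_apply]
  split_ifs
  · rw [Algebra.algebraMap_eq_smul_one]
  · rw [smul_zero, map_zero]

theorem dOp_one_apply {n : ℕ} (j : ℤ) : (dOp (oneSeries n)).1 j = if j = 1 then 1 else 0 := by
  simpa using dOp_pow_one (n := n) 1 j

theorem chiOp_smul_dOp_one {n : ℕ} {p : ZMod 2} {a : osp n} (ha : comp p a = a) (k : ℕ) (c : ℂ) :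
    chiOp p a ha k (c • dOp (oneSeries n)) = 0 := by
  refine chiOp_eq_zero ha k fun j => ⟨if j = 1 then c else 0, ?_⟩
  rw [Submodule.coe_smul, Pi.smul_apply, dOp_one_apply]
  split_ifs
  · rw [Algebra.algebraMap_eq_smul_one]
  · rw [smul_zero, map_zero]

/-- The series whose coefficients at `D^k`, for the `k` in a set, belong to the ideal. -/
def idealSeries (n : ℕ) (hn : 0 < n) (T : Set ℤ) : Submodule ℂ (Series n) where
  carrier := {z | ∀ k ∈ T, z.1 k ∈ idealJ n hn}
  add_mem' h h' k hk := add_mem (h k hk) (h' k hk)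
  zero_mem' _ _ := zero_mem _
  smul_mem' c _ h k hk := idealJ_smul hn c (h k hk)

/-- Multiplication by $D$ brings the coefficient of degree `k - 1` into degree `k`, hence the
closure condition on `T`. -/
theorem isStable_idealSeries {n : ℕ} (hn : 0 < n) {T : Set ℤ} (hT : ∀ k ∈ T, k - 1 ∈ T) :
    IsStable hn (idealSeries n hn T) where
  mulOp_mem u _ hz k hk := idealJ_mul_left hn u (hz k hk)
  dOp_mem _ hz k hk := add_mem (idealJ_D hn (hz k hk)) (idealJ_sig hn (hz _ (hT k hk)))
  ideal_mem _ hu _ _ _ := idealJ_mul_right hn hu _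

/-- The descent of `dOp_injective` modulo the ideal. It starts above the top degree and therefore
uses all degrees. -/
theorem mem_idealSeries_of_dOp {n : ℕ} (hn : 0 < n) {z : Series n}
    (h : dOp z ∈ idealSeries n hn Set.univ) : z ∈ idealSeries n hn Set.univ := by
  obtain ⟨N, hN⟩ := z.2
  have key : ∀ (m : ℕ) (k : ℤ), N - m < k → z.1 k ∈ idealJ n hn := by
    intro m
    induction m with
    | zero =>
      intro k hk
      rw [hN k (by simpa using hk)]
      exact zero_mem _
    | succ m ih =>
      intro k hk
      have h1 := h (k + 1) trivial
      rw [dOp_apply, add_sub_cancel_right] at h1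
      have h2 := idealJ_D hn (ih (k + 1) (by push_cast at hk; omega))
      have h3 := idealJ_sig hn ((Submodule.add_mem_iff_right _ h2).1 h1)
      rwa [sig_sig] at h3
  exact fun k _ => key (N - k + 1).toNat k (by omega)

/-- The vector related to `v'` by the column operation. -/
def columnVec {n : ℕ} (hn : 0 < n) (v' : Fin (4 * n) → Series n) (j : Fin (4 * n)) : Series n :=
  v' j + if j = idx1 n hn then (-1 : ℂ) • v' (idx0 n hn) else 0

theorem columnVec_of_ne {n : ℕ} (hn : 0 < n) (v' : Fin (4 * n) → Series n) {j : Fin (4 * n)}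
    (h : j ≠ idx1 n hn) : columnVec hn v' j = v' j := by
  rw [columnVec, if_neg h, add_zero]

theorem columnVec_spec {n : ℕ} (hn : 0 < n) (v' : Fin (4 * n) → Series n) (j : Fin (4 * n)) :
    v' j = columnVec hn v' j + if j = idx1 n hn then columnVec hn v' (idx0 n hn) else 0 := by
  rw [columnVec_of_ne hn v' (idx0_lt_idx1 hn).ne, columnVec]
  split_ifs with h
  · ext s
    simp only [Submodule.coe_add, Submodule.coe_smul, Pi.add_apply, neg_smul, one_smul]
    exact (neg_add_cancel_right ((v' j).1 s) ((v' (idx0 n hn)).1 s)).symm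
  · rw [add_zero, add_zero]

/-- The reduction of the first row of `matTilde` to the rest. -/
theorem IsStable.chiOp_matTilde_mem {n : ℕ} {hn : 0 < n} {K : Submodule ℂ (Series n)}
    (hK : IsStable hn K) {m : ℕ} (hm : m ≠ 2 * n) (hm' : m < 4 * n)
    (hd : 2 * n ≤ m → ∀ z : Series n, dOp z ∈ K → z ∈ K) {p : ZMod 2} {a : osp n}
    (ha : comp p a = a) (ha' : a ∈ nPos n) {v' : Fin (4 * n) → Series n}
    (hv : ∀ (k : ℕ) (j : Fin (4 * n)), m ≤ j → gaugeVec p a ha (columnVec hn v') k j ∈ K)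
    (h : ∀ i : Fin (4 * n), (i : ℕ) ≠ 0 → actOn (matTilde n hn) v' i ∈ K ∧
      ∀ k, chiOp p a ha k (actOn (matTilde n hn) v' i) ∈ K) (k : ℕ) :
    chiOp p a ha k (actOn (matTilde n hn) v' ⟨0, by omega⟩) ∈ K := by
  have v0 := idx0_val hn
  have v1 := idx1_val hn
  have h01 := h (idx0 n hn) (by omega)
  have hrow := matTilde_act hn (columnVec_spec hn v')
  have h0 := hK.chiOp_mem hm hm' hd ha ha' hv
    (fun i hi => by
      rw [hrow]
      refine add_mem (h i hi).1 ?_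
      split_ifs
      · exact h01.1
      · exact zero_mem _)
    (fun k i hi => by
      rw [hrow, map_add]
      refine add_mem ((h i hi).2 k) ?_
      split_ifs
      · exact h01.2 k
      · rw [map_zero]; exact zero_mem _) k
  rwa [hrow, if_neg (fun e => by have := congrArg Fin.val e; simp only at this; omega),
    add_zero] at h0

theorem actOn_matTilde {n : ℕ} (hn : 0 < n) (X : ℕ → Module.End ℂ (Series n)) (z : Series n)
    (i : Fin (4 * n)) : actOn (matTilde n hn) (fun j => X j z) i
      = (∑ m ∈ Finset.range (4 * n), tildeN n hn i m * X m) z := by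
  rw [Finset.sum_range, LinearMap.sum_apply, actOn]
  refine Finset.sum_congr rfl fun j _ => ?_
  rw [tildeN_val, Module.End.mul_apply]

theorem gaugeVec_eq_zero {n : ℕ} {p : ZMod 2} {a : osp n} (ha : comp p a = a)
    {v : Fin (4 * n) → Series n} {j : Fin (4 * n)} (k : ℕ)
    (h : ∃ c : ℂ, v j = c • oneSeries n) (h' : ∀ l, a.1 j l = 0 ∨ v l = 0) :
    gaugeVec p a ha v k j = 0 := by
  obtain ⟨c, hc⟩ := h
  rw [gaugeVec, hc, chiOp_smul_one, zero_add, Finset.sum_eq_zero, ite_self]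
  intro l _
  rcases h' l with h | h
  · rw [h, zero_smul]
  · rw [h, smul_zero]

/-! ### Invariance of the coefficients of the two determinants. -/

theorem chiCoeff_coeffD_matA_mem {n : ℕ} (hn : 0 < n) {p : ZMod 2} {a : osp n}
    (ha : comp p a = a) (ha' : a ∈ nPos n) (k : ℕ) (j : ℤ) :
    chiCoeff p a ha k (coeffD (rowDet (matA n hn)) j) ∈ idealJ n hn := by
  have hrow : ∀ i : Fin (4 * n), actOn (matTilde n hn)
      (fun j => hessVec (scaledN n hn) (subC n) (4 * n) j (oneSeries n)) i
      = if (i : ℕ) = 0 then rowDet (matA n hn) (oneSeries n) else 0 := by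
    intro i
    rw [actOn_matTilde hn (hessVec (scaledN n hn) (subC n) (4 * n)),
      sum_tildeN_mul_hessVec hn i.isLt]
    split_ifs <;> rfl
  have h := (isStable_idealSeries hn (T := Set.univ) fun _ _ => trivial).chiOp_matTilde_mem
    (m := 4 * n - 1) (by omega) (by omega) (fun _ z hz => mem_idealSeries_of_dOp hn hz) ha ha'
    (v' := fun j => hessVec (scaledN n hn) (subC n) (4 * n) j (oneSeries n))
    (fun k j hj => by
      have hj' := j.isLt
      have v1 := idx1_val hn
      rw [gaugeVec_eq_zero ha k]
      · exact zero_mem _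
      · rw [columnVec_of_ne hn _ (fun e => by rw [e] at hj; omega)]
        refine ⟨∏ l ∈ Finset.range j, -subC n l, ?_⟩
        rw [hessVec, show (j : ℕ) + 1 = 4 * n by omega, lowSeq_self]
        rfl
      · exact fun l => Or.inl (apply_eq_zero_of_mem_nPos ha'
          (xw_anti (by rw [Fin.le_def]; omega))))
    (fun i hi => by
      rw [hrow, if_neg hi]
      exact ⟨zero_mem _, fun k => by rw [map_zero]; exact zero_mem _⟩) k
  rw [hrow, if_pos rfl] at h
  exact h j trivial

/-- Degrees at most $0$ suffice for the constant term and make the error $cD$ invisible. The entries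
from index `2 * n - 1` on are known from the start, so back substitution never has to cancel $D$. -/
theorem chiCoeff_wTilde_mem {n : ℕ} (hn : 0 < n) {p : ZMod 2} {a : osp n}
    (ha : comp p a = a) (ha' : a ∈ nPos n) (k : ℕ) :
    chiCoeff p a ha k (wTilde n hn) ∈ idealJ n hn := by
  let X : ℕ → Module.End ℂ (Series n) := fun j =>
    if j < 2 * n then hessVec (tildeN n hn) (subC n) (2 * n) j else 0
  have hrow : ∀ i : Fin (4 * n), ∃ c : ℂ, actOn (matTilde n hn) (fun j => X j (oneSeries n)) i
      = (if (i : ℕ) = 0 then detA2n n hn (oneSeries n) else 0) + c • dOp (oneSeries n) := by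
    intro i
    obtain ⟨c, hc⟩ := sum_tildeN_mul_hessVec_half hn i.isLt
    refine ⟨c, ?_⟩
    have e : ∑ m ∈ Finset.range (4 * n), tildeN n hn i m * X m = ∑ m ∈ Finset.range (2 * n),
        tildeN n hn i m * hessVec (tildeN n hn) (subC n) (2 * n) m := by
      symm
      refine Finset.sum_subset_zero_on_sdiff (Finset.range_mono (by omega)) ?_ ?_
      · intro m hm
        simp only [Finset.mem_sdiff, Finset.mem_range] at hm
        simp only [X, if_neg hm.2, mul_zero]
      · intro m hm
        simp only [X, if_pos (Finset.mem_range.1 hm)]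
    rw [actOn_matTilde, e, hc, LinearMap.add_apply]
    congr 1
    split_ifs <;> rfl
  have hsmall : ∀ c : ℂ, c • dOp (oneSeries n) ∈ idealSeries n hn (Set.Iic 0) := by
    intro c k hk
    have hk' : k ≤ 0 := hk
    rw [Submodule.coe_smul, Pi.smul_apply, dOp_one_apply, if_neg (by omega), smul_zero]
    exact zero_mem _
  have hX : ∀ j, 2 * n - 1 ≤ j → ∃ c : ℂ, X j (oneSeries n) = c • oneSeries n := by
    intro j hj
    by_cases hj' : j < 2 * n
    · refine ⟨∏ l ∈ Finset.range j, -subC n l, ?_⟩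
      simp only [X, if_pos hj']
      rw [hessVec, show j + 1 = 2 * n by omega, lowSeq_self]
      rfl
    · refine ⟨0, ?_⟩
      simp only [X, if_neg hj', zero_smul]
      rfl
  have v0 := idx0_val hn
  have v1 := idx1_val hn
  have h := (isStable_idealSeries hn (T := Set.Iic 0) fun k hk => by
      have hk' : k ≤ 0 := hk
      exact Set.mem_Iic.2 (by omega)).chiOp_matTilde_mem
    (m := 2 * n - 1) (by omega) (by omega) (fun h => by omega) ha ha'
    (v' := fun j => X j (oneSeries n))
    (fun k j hj => by
      rw [gaugeVec_eq_zero ha k]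
      · exact zero_mem _
      · obtain ⟨c, hc⟩ := hX j hj
        obtain ⟨c', hc'⟩ := hX (idx0 n hn) v0.ge
        by_cases h1 : j = idx1 n hn
        · refine ⟨c + (-1) * c', ?_⟩
          rw [columnVec, if_pos h1, hc, hc', smul_smul, add_smul]
        · exact ⟨c, by rw [columnVec_of_ne hn _ h1, hc]⟩
      -- For `l` up to the second middle index the entry of $a$ vanishes, because the two middle
      -- weights are equal and $a$ has positive degree; beyond it the extended vector is zero. The
      -- column operation makes the entry of the vector at `idx1` nonzero, so this equality of
      -- weights is needed.
      · intro l
        by_cases hl : (l : ℕ) ≤ 2 * n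
        · refine Or.inl (apply_eq_zero_of_mem_nPos ha' ?_)
          unfold xw
          split_ifs <;> omega
        · refine Or.inr ?_
          rw [columnVec_of_ne hn _ (fun e => by rw [e] at hl; omega)]
          simp only [X, if_neg (by omega : ¬ (l : ℕ) < 2 * n)]
          rfl)
    (fun i hi => by
      obtain ⟨c, hc⟩ := hrow i
      rw [hc, if_neg hi, zero_add]
      exact ⟨hsmall c, fun k => by rw [chiOp_smul_dOp_one]; exact zero_mem _⟩) k
  obtain ⟨c, hc⟩ := hrow ⟨0, by omega⟩
  rw [hc, if_pos rfl, map_add, chiOp_smul_dOp_one, add_zero] at h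
  exact h 0 (Set.mem_Iic.2 le_rfl)

theorem mem_W {n : ℕ} (hn : 0 < n) {v : V n} (hv : v ∈ Vp n)
    (h : ∀ (p : ZMod 2) (a : osp n) (ha : comp p a = a), a ∈ nPos n →
      ∀ k, chiCoeff p a ha k v ∈ idealJ n hn) : v ∈ W n hn := by
  refine ⟨hv, fun a ha k => ?_⟩
  rw [chiBracket, Finsupp.finsetSum_apply]
  exact sum_mem fun p _ => h p (comp p a) _ (comp_mem_nPos p ha) k

theorem w_mem_W {n : ℕ} (hn : 0 < n) (k : ℕ) : w n hn k ∈ W n hn :=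
  mem_W hn (w_mem_Vp hn k) fun _ _ ha ha' j => chiCoeff_coeffD_matA_mem hn ha ha' j _

theorem wTilde_mem_W {n : ℕ} (hn : 0 < n) : wTilde n hn ∈ W n hn :=
  mem_W hn (wTilde_mem_Vp hn) fun _ _ ha ha' j => chiCoeff_wTilde_mem hn ha ha' j

end SUSYW

end

theorem mainTheorem8 (n : ℕ) (hn : 0 < n) :
    (SUSYW.rowDet (SUSYW.matA n hn) =
      SUSYW.dOp ^ (4 * n - 1)
        + ∑ k ∈ Finset.range (4 * n - 1),
            SUSYW.mulOp (SUSYW.w n hn (4 * n - 1 - k)) * SUSYW.dOp ^ k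
        + (-1 : ℂ) ^ n • (SUSYW.mulOp (SUSYW.wTilde n hn) * SUSYW.dInvOp
            * SUSYW.mulOp (SUSYW.wTilde n hn))) ∧
    (∀ k : ℕ, 1 ≤ k → k ≤ 4 * n - 1 → SUSYW.w n hn k ∈ SUSYW.W n hn) ∧
    SUSYW.wTilde n hn ∈ SUSYW.W n hn := by
  exact ⟨SUSYW.rowDet_matA_expansion hn, fun k _ _ => SUSYW.w_mem_W hn k, SUSYW.wTilde_mem_W hn⟩
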